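/- Let $M$ be a smooth manifold of dimension $n>2$, let $a=a_{ij}\,dx^i dx^j$ be a (pseudo-)Riemannian metric and $b=b_i\,dx^i$ a smooth 1-form on $M$, and let $m\neq 0$ be a real number. Put $\alpha=\sqrt{a_{ij}y^iy^j}$, $\beta=b_iy^i$ and $F=\alpha^{1+m}\beta^{-m}$. Let $\mathcal A\subset TM\setminus\{0\}$ be an open conic subset (invariant under $y\mapsto\lambda y$ for $\lambda>0$) with non-empty fibres over $M$ such that on $\mathcal A$ one has $a_{ij}y^iy^j>0$ and either $\beta>0$, or $\beta\ne0$ and $m\in\mathbb Z$ (so that $F$ is well defined on $\mathcal A$). Suppose that $(M,\mathcal A,F)$ is a Finsler space, i.e. on $\mathcal A$ the function $F$ is smooth, positively homogeneous of degree one in $y$, and has non-degenerate fundamental tensor $g_{ij}=\bar\partial_i\bar\partial_j(\tfrac12F^2)$, where $\bar\partial_i=\partial/\partial y^i$ and $\partial_i=\partial/\partial x^i$. It is said to be Berwald if in every chart the coefficients of the Cartan non-linear connection $$N^i_j=\tfrac14\bar\partial_j\Big(g^{ik}\big(y^l\partial_l\bar\partial_kF^2-\partial_kF^2\big)\Big)$$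 are of the form $N^i_j(x,y)=\Gamma^i_{jk}(x)y^k$ on $\mathcal A$ with smooth functions $\Gamma^i_{jk}$. Suppose that $b$ is closed, $db=0$, and null, $b^2=a^{ij}b_ib_j=0$. Then $(M,\mathcal A,F)$ is Berwald if and only if around every $p\in M$ there are local coordinates $(u,v,x^3,\dots,x^n)$ in which $$a=-2\,du\,dv+H(u,v,x)\,du^2+W_a(u,x)\,du\,dx^a+h_{ab}(u,x)\,dx^a dx^b,\qquad b=du,$$ with smooth coefficients and with $(h_{ab})$ symmetric and non-degenerate, i.e. $h$ a (pseudo-)Riemannian metric; here $a,b$ as indices run from $3$ to $n$ and products of differentials are symmetrized tensor products, $du\,dv=\tfrac12(du\otimes dv+dv\otimes du)$. In that case there is exactly one function $c$ on $M$ with $$\nabla_jb_i=c\,\big[m\,b^2a_{ij}+(1-m)\,b_ib_j\big],$$ where $\nabla$ is the Levi-Civita connection of $a$. This function is smooth, and in all coordinates $(u,v,x^3,\dots,x^n)$ of the above form $$c=-\frac{\partial_vH}{2(1-m)}.$$ -/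

import Mathlib

open scoped Manifold ContDiff

/-!  Finsler spaces, the Cartan non-linear connection, Berwald spaces and m-Kropina spaces, in terms
of the local coordinates given by the charts of the maximal smooth atlas.  -/

namespace MKropina

/-- The coordinate space `ℝⁿ`. -/
abbrev Coord (n : ℕ) : Type := EuclideanSpace ℝ (Fin n)

/-- The partial derivative `∂ᵢ f` of a function on `ℝⁿ`. -/
noncomputable def pd {n : ℕ} (i : Fin n) (f : Coord n → ℝ) (x : Coord n) : ℝ :=
  fderiv ℝ f x (EuclideanSpace.single i 1)

/-- `∂ᵢ f` for a function of `(x, y)`: the partial derivative with respect to `xⁱ`. -/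
noncomputable def pdx {n : ℕ} (i : Fin n) (f : Coord n → Coord n → ℝ) (x y : Coord n) : ℝ :=
  pd i (fun x' => f x' y) x

/-- `∂̄ᵢ f` for a function of `(x, y)`: the partial derivative with respect to `yⁱ`. -/
noncomputable def pdy {n : ℕ} (i : Fin n) (f : Coord n → Coord n → ℝ) (x y : Coord n) : ℝ :=
  pd i (fun y' => f x y') y

section Manifold

variable {n : ℕ} {M : Type*} [TopologicalSpace M] [ChartedSpace (Coord n) M]

/-- The tangent vector `yⁱ ∂ᵢ` at the point with coordinates `x` in the chart `φ`. -/
noncomputable def coordVec (φ : OpenPartialHomeomorph M (Coord n)) (x y : Coord n) :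
    TangentSpace (𝓡 n) (φ.symm x) :=
  mfderiv (𝓡 n) (𝓡 n) φ.symm x y

/-- The coordinate vector field `∂ᵢ` of the chart `φ`, at the point with coordinates `x`. -/
noncomputable def basisVec (φ : OpenPartialHomeomorph M (Coord n)) (i : Fin n) (x : Coord n) :
    TangentSpace (𝓡 n) (φ.symm x) :=
  coordVec φ x (EuclideanSpace.single i 1)

/-- The point `(x, y)` of the tangent bundle, in the coordinates induced by the chart `φ`. -/
noncomputable def coordPoint (φ : OpenPartialHomeomorph M (Coord n)) (x y : Coord n) :
    TangentBundle (𝓡 n) M :=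
  ⟨φ.symm x, coordVec φ x y⟩

variable (n M) in
/-- A field of bilinear forms on the tangent spaces of `M`. -/
abbrev BilinField : Type _ :=
  (p : M) → TangentSpace (𝓡 n) p →L[ℝ] TangentSpace (𝓡 n) p →L[ℝ] ℝ

variable (n M) in
/-- A field of covectors on `M`. -/
abbrev CovectorField : Type _ := (p : M) → TangentSpace (𝓡 n) p →L[ℝ] ℝ

/-- The components `a_ij` in the chart `φ`. -/
noncomputable def metricComp (a : BilinField n M) (φ : OpenPartialHomeomorph M (Coord n))
    (i j : Fin n) (x : Coord n) : ℝ :=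
  a (φ.symm x) (basisVec φ i x) (basisVec φ j x)

/-- The components `b_i` in the chart `φ`. -/
noncomputable def formComp (b : CovectorField n M) (φ : OpenPartialHomeomorph M (Coord n))
    (i : Fin n) (x : Coord n) : ℝ :=
  b (φ.symm x) (basisVec φ i x)

/-- The components `a^ij` of the inverse metric in the chart `φ`. -/
noncomputable def invMetricComp (a : BilinField n M) (φ : OpenPartialHomeomorph M (Coord n))
    (i j : Fin n) (x : Coord n) : ℝ :=
  (Matrix.of fun k l => metricComp a φ k l x)⁻¹ i j

/-- `a` is a (pseudo-)Riemannian metric: symmetric, non-degenerate, with components that are smooth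
in every smooth chart. -/
structure IsPseudoRiemannianMetric (a : BilinField n M) : Prop where
  symm : ∀ (p : M) (X Y : TangentSpace (𝓡 n) p), a p X Y = a p Y X
  nondegenerate : ∀ (p : M) (X : TangentSpace (𝓡 n) p), (∀ Y, a p X Y = 0) → X = 0
  smooth : ∀ φ ∈ IsManifold.maximalAtlas (𝓡 n) ∞ M, ∀ i j,
    ContDiffOn ℝ ∞ (metricComp a φ i j) φ.target

/-- `b` is a smooth 1-form. -/
def IsSmoothForm (b : CovectorField n M) : Prop :=
  ∀ φ ∈ IsManifold.maximalAtlas (𝓡 n) ∞ M, ∀ i, ContDiffOn ℝ ∞ (formComp b φ i) φ.target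

/-- `db = 0`. -/
def IsClosedForm (b : CovectorField n M) : Prop :=
  ∀ φ ∈ IsManifold.maximalAtlas (𝓡 n) ∞ M, ∀ x ∈ φ.target, ∀ i j,
    pd i (formComp b φ j) x = pd j (formComp b φ i) x

/-- The squared norm `b² = a^ij b_i b_j` in the chart `φ`. -/
noncomputable def normSq (a : BilinField n M) (b : CovectorField n M)
    (φ : OpenPartialHomeomorph M (Coord n)) (x : Coord n) : ℝ :=
  ∑ i, ∑ j, invMetricComp a φ i j x * formComp b φ i x * formComp b φ j x

/-- `b` is null with respect to `a`: `b² = 0`. -/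
def IsNullForm (a : BilinField n M) (b : CovectorField n M) : Prop :=
  ∀ φ ∈ IsManifold.maximalAtlas (𝓡 n) ∞ M, ∀ x ∈ φ.target, normSq a b φ x = 0

/-- The Christoffel symbols `Γ^k_ij` of the Levi-Civita connection of `a` in the chart `φ`. -/
noncomputable def christoffel (a : BilinField n M) (φ : OpenPartialHomeomorph M (Coord n))
    (k i j : Fin n) (x : Coord n) : ℝ :=
  1 / 2 * ∑ l, invMetricComp a φ k l x *
    (pd i (metricComp a φ j l) x + pd j (metricComp a φ i l) x - pd l (metricComp a φ i j) x)

/-- `∇_j b_i`, for the Levi-Civita connection of `a`, in the chart `φ`. -/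
noncomputable def covDeriv (a : BilinField n M) (b : CovectorField n M)
    (φ : OpenPartialHomeomorph M (Coord n)) (j i : Fin n) (x : Coord n) : ℝ :=
  pd j (formComp b φ i) x - ∑ k, christoffel a φ k j i x * formComp b φ k x

/-- The condition `∇_j b_i = c (m b² a_ij + (1 - m) b_i b_j)` on the function `c` on `M`. -/
def BerwaldCondition (m : ℝ) (a : BilinField n M) (b : CovectorField n M) (c : M → ℝ) : Prop :=
  ∀ φ ∈ IsManifold.maximalAtlas (𝓡 n) ∞ M, ∀ x ∈ φ.target, ∀ i j,
    covDeriv a b φ j i x = c (φ.symm x) *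
      (m * normSq a b φ x * metricComp a φ i j x
        + (1 - m) * formComp b φ i x * formComp b φ j x)

/-- `F²` as a function of the coordinates `(x, y)` induced by the chart `φ`. -/
noncomputable def sqCoord (F : TangentBundle (𝓡 n) M → ℝ)
    (φ : OpenPartialHomeomorph M (Coord n)) (x y : Coord n) : ℝ :=
  F (coordPoint φ x y) ^ 2

/-- The fundamental tensor `g_ij = ∂̄ᵢ ∂̄ⱼ (F² / 2)`. -/
noncomputable def fundTensor (F : TangentBundle (𝓡 n) M → ℝ)
    (φ : OpenPartialHomeomorph M (Coord n)) (x y : Coord n) : Matrix (Fin n) (Fin n) ℝ :=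
  Matrix.of fun i j => pdy i (pdy j fun x' y' => 1 / 2 * sqCoord F φ x' y') x y

/-- The coefficients `N^i_j = (1/4) ∂̄ⱼ (g^ik (y^l ∂_l ∂̄_k F² - ∂_k F²))` of the Cartan non-linear
connection. -/
noncomputable def cartanConn (F : TangentBundle (𝓡 n) M → ℝ)
    (φ : OpenPartialHomeomorph M (Coord n)) (i j : Fin n) (x y : Coord n) : ℝ :=
  1 / 4 * pdy j (fun x' y' => ∑ k, (fundTensor F φ x' y')⁻¹ i k *
    ((∑ l, y' l * pdx l (pdy k (sqCoord F φ)) x' y') - pdx k (sqCoord F φ) x' y')) x y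

/-- `(M, 𝒜, F)` is a Finsler space: `𝒜` is a conic subbundle of `TM ∖ 0` with non-empty fibres, and
on `𝒜` the function `F` is smooth, positively homogeneous of degree one in `y`, and has a
non-degenerate fundamental tensor.  The values of `F` off `𝒜` play no role. -/
structure IsFinslerSpace (𝒜 : Set (TangentBundle (𝓡 n) M))
    (F : TangentBundle (𝓡 n) M → ℝ) [IsManifold (𝓡 n) ∞ M] : Prop where
  isOpen : IsOpen 𝒜
  ne_zero : ∀ Y ∈ 𝒜, Y.2 ≠ 0
  conic : ∀ Y ∈ 𝒜, ∀ r : ℝ, 0 < r → (⟨Y.1, r • Y.2⟩ : TangentBundle (𝓡 n) M) ∈ 𝒜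
  nonempty_fiber : ∀ p : M, ∃ y : TangentSpace (𝓡 n) p, (⟨p, y⟩ : TangentBundle (𝓡 n) M) ∈ 𝒜
  smooth : ContMDiffOn (𝓡 n).tangent 𝓘(ℝ, ℝ) ∞ F 𝒜
  homogeneous : ∀ Y ∈ 𝒜, ∀ r : ℝ, 0 < r → F ⟨Y.1, r • Y.2⟩ = r * F Y
  nondegenerate : ∀ φ ∈ IsManifold.maximalAtlas (𝓡 n) ∞ M, ∀ x ∈ φ.target, ∀ y,
    coordPoint φ x y ∈ 𝒜 → (fundTensor F φ x y).det ≠ 0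

/-- `(M, 𝒜, F)` is of Berwald type: in every smooth chart `N^i_j(x, y) = Γ^i_jk(x) y^k` on `𝒜`, for
smooth functions `Γ^i_jk`. -/
def IsBerwald (𝒜 : Set (TangentBundle (𝓡 n) M)) (F : TangentBundle (𝓡 n) M → ℝ) : Prop :=
  ∀ φ ∈ IsManifold.maximalAtlas (𝓡 n) ∞ M, ∃ Γ : Fin n → Fin n → Fin n → Coord n → ℝ,
    (∀ i j k, ContDiffOn ℝ ∞ (Γ i j k) φ.target) ∧
    ∀ x ∈ φ.target, ∀ y, coordPoint φ x y ∈ 𝒜 →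
      ∀ i j, cartanConn F φ i j x y = ∑ k, Γ i j k x * y k

/-- The `m`-Kropina function `F = α^(1+m) β^(-m)`, where `α = √(a_ij y^i y^j)` and `β = b_i y^i`. -/
noncomputable def kropina (m : ℝ) (a : BilinField n M) (b : CovectorField n M)
    (Y : TangentBundle (𝓡 n) M) : ℝ :=
  Real.sqrt (a Y.1 Y.2 Y.2) ^ (1 + m) * (b Y.1 Y.2) ^ (-m)

/-- `(M, 𝒜, F)` with `F = α^(1+m) β^(-m)` is an `m`-Kropina space: a Finsler space such that on `𝒜`
the root `α` is that of a positive number and the real power `β^(-m)` is meaningful, that is,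
`β > 0`, or `β ≠ 0` and `m` is an integer. -/
structure IsKropinaSpace (m : ℝ) (a : BilinField n M) (b : CovectorField n M)
    (𝒜 : Set (TangentBundle (𝓡 n) M)) [IsManifold (𝓡 n) ∞ M] : Prop where
  metric : IsPseudoRiemannianMetric a
  form : IsSmoothForm b
  root_pos : ∀ Y ∈ 𝒜, 0 < a Y.1 Y.2 Y.2
  power_defined : ∀ Y ∈ 𝒜, 0 < b Y.1 Y.2 ∨ (b Y.1 Y.2 ≠ 0 ∧ ∃ k : ℤ, m = k)
  finsler : IsFinslerSpace 𝒜 (kropina m a b)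

end Manifold

section NormalForm

variable {k : ℕ} {M : Type*} [TopologicalSpace M] [ChartedSpace (Coord (k + 2)) M]

/-- The coordinates `(x³, …, xⁿ)` of a point `(u, v, x³, …, xⁿ)`. -/
def transverse (x : Coord (k + 2)) : Fin k → ℝ := fun i => x i.succ.succ

/-- In the coordinates `(u, v, x³, …, xⁿ)` given by the chart `φ`,
`a = -2 du dv + H(u,v,x) du² + W_a(u,x) du dx^a + h_ab(u,x) dx^a dx^b` and `b = du`, with smooth
coefficients and with `h` symmetric and non-degenerate.  Products of differentials are symmetrized:
`du dv = (du ⊗ dv + dv ⊗ du) / 2`. -/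
structure HasNormalForm (a : BilinField (k + 2) M) (b : CovectorField (k + 2) M)
    (φ : OpenPartialHomeomorph M (Coord (k + 2))) (H : Coord (k + 2) → ℝ)
    (W : Fin k → ℝ → (Fin k → ℝ) → ℝ) (h : ℝ → (Fin k → ℝ) → Matrix (Fin k) (Fin k) ℝ) :
    Prop where
  mem_atlas : φ ∈ IsManifold.maximalAtlas (𝓡 (k + 2)) ∞ M
  smooth_H : ContDiffOn ℝ ∞ H φ.target
  smooth_W : ∀ i, ContDiffOn ℝ ∞ (fun x => W i (x 0) (transverse x)) φ.target
  smooth_h : ∀ i j, ContDiffOn ℝ ∞ (fun x => h (x 0) (transverse x) i j) φ.target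
  symm_h : ∀ x ∈ φ.target, (h (x 0) (transverse x)).IsSymm
  det_h : ∀ x ∈ φ.target, (h (x 0) (transverse x)).det ≠ 0
  metric_eq : ∀ x ∈ φ.target, ∀ y z : Coord (k + 2),
    a (φ.symm x) (coordVec φ x y) (coordVec φ x z) =
      -(y 0 * z 1 + y 1 * z 0) + H x * (y 0 * z 0)
      + (∑ i, W i (x 0) (transverse x) *
          (1 / 2 * (y 0 * transverse z i + transverse y i * z 0)))
      + ∑ i, ∑ j, h (x 0) (transverse x) i j * (transverse y i * transverse z j)
  form_eq : ∀ x ∈ φ.target, ∀ y : Coord (k + 2), b (φ.symm x) (coordVec φ x y) = y 0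

end NormalForm

end MKropina

/-! Let `B` be the vector field dual to `b`, and write `A = α²`, `h = ∇b`. For `b` closed and null,
the equation for the geodesic spray of `F` can be solved in closed form: it is `Γ(y,y) + (m
h(y,y)/(1-m)) (-(2/β) y + (A/β²) B)`, where `Γ` is the Levi-Civita connection of `a` (`spray_eq`).
The value `m = 1` cannot occur, since then the bracketed vector lies in the kernel of the
fundamental tensor (`ne_one_of_nondegenerate`).

By Euler's relation the Berwald condition makes the spray quadratic in `y`. The bracket has
denominator `β²`, so `h(y,y) (A - 2β a(y,z))` is divisible by `β²` whenever `b(z) = 1`. For `n > 2`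
the form `a` does not vanish identically on the kernel of `b`, and divisibility forces `h = μ b ⊗ b`
(`eq_smul_of_dvd`, `hessIsMultiple_of_isBerwald`). Conversely, if `h = μ b ⊗ b`, the denominators
cancel and the spray is a quadratic polynomial with smooth coefficients
(`isBerwald_of_hessIsMultiple`). Since `b² = 0`, the required function is `c = μ/(1-m)`.

It remains to read `h = μ b ⊗ b` in good coordinates. Closedness gives `b = du` locally; nullity
says that `B` is tangent to the levels of `u`, so that `-B` can be straightened to `∂_v` without
changing `u` (`exists_adaptedChart`). There `a(∂_v, ·) = -du`, and `∇b = -(1/2) ∂_v a`. Hence `∇b`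
is a multiple of `du ⊗ du` exactly when no component of `a` but the coefficient of `du²` depends on
`v`, which is the normal form, with `μ = -(1/2) ∂_v H`.

Straightening needs a flow that is smooth in time and initial point. It comes from the inverse
function theorem in the Banach space of curves, applied to the integral equation
(`exists_smooth_local_flow`). -/

namespace MKropina
open Set Filter Topology

/-! ### Smooth local inverses -/

section InverseFunction

variable {E F : Type*} [NormedAddCommGroup E] [NormedSpace ℝ E] [CompleteSpace E]
  [NormedAddCommGroup F] [NormedSpace ℝ F]

/-- The inverse function theorem, with smoothness on the whole domain of the local inverse. -/
theorem exists_smooth_localInverse {f : E → F} {U : Set E} (hU : IsOpen U)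
    (hf : ContDiffOn ℝ ∞ f U) {a : E} (ha : a ∈ U) {f' : E ≃L[ℝ] F}
    (hf' : HasFDerivAt f (f' : E →L[ℝ] F) a) :
    ∃ e : OpenPartialHomeomorph E F, a ∈ e.source ∧ e.source ⊆ U ∧ (∀ x, e x = f x) ∧
      ContDiffOn ℝ ∞ e e.source ∧ ContDiffOn ℝ ∞ e.symm e.target := by
  have hfa : ContDiffAt ℝ ∞ f a := hf.contDiffAt (hU.mem_nhds ha)
  have hcont : ContinuousAt (fderiv ℝ f) a :=
    (hfa.fderiv_right (m := 0) (by simp)).continuousAt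
  -- Invertible operators form an open set, so the derivative is invertible near `a`; restricting to
  -- such points makes the inverse smooth on its whole domain, not only at the image of `a`.
  have hinv : ∀ᶠ x in 𝓝 a, fderiv ℝ f x ∈ range ((↑) : (E ≃L[ℝ] F) → E →L[ℝ] F) := by
    refine hcont.eventually_mem ?_
    rw [hf'.fderiv]
    exact ContinuousLinearEquiv.nhds f'
  obtain ⟨V, hVsub, hVo, haV⟩ := mem_nhds_iff.1 hinv
  let e₀ := hfa.toOpenPartialHomeomorph f hf' (by simp)
  have he₀ : ∀ x, e₀ x = f x := fun x => rfl
  let e := e₀.restrOpen (U ∩ V) (hU.inter hVo)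
  have hsrc : e.source = e₀.source ∩ (U ∩ V) := rfl
  refine ⟨e, ⟨hfa.mem_toOpenPartialHomeomorph_source hf' (by simp), ha, haV⟩,
    fun x hx => hx.2.1, fun x => rfl, fun x hx => ?_, fun y hy => ?_⟩
  · exact (hf.contDiffAt (hU.mem_nhds hx.2.1)).contDiffWithinAt
  · have hx := e.map_target hy
    obtain ⟨g', hg'⟩ := hVsub hx.2.2
    have hfx := hf.contDiffAt (hU.mem_nhds hx.2.1)
    have : HasFDerivAt e (g' : E →L[ℝ] F) (e.symm y) := by
      rw [hg']
      exact (hfx.differentiableAt (by simp)).hasFDerivAt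
    exact (e.contDiffAt_symm hy this hfx).contDiffWithinAt

end InverseFunction

/-! ### Smoothness of superposition operators on spaces of continuous curves -/

section Nemytskii

variable {K : Type*} [TopologicalSpace K] [CompactSpace K]

/-- Pointwise application of a continuous family of linear maps to a continuous family of
vectors. -/
noncomputable def pointwiseApply (K : Type*) [TopologicalSpace K] [CompactSpace K]
    (E F : Type*) [NormedAddCommGroup E] [NormedSpace ℝ E]
    [NormedAddCommGroup F] [NormedSpace ℝ F] :
    C(K, E →L[ℝ] F) →L[ℝ] C(K, E) →L[ℝ] C(K, F) :=
  LinearMap.mkContinuous₂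
    (LinearMap.mk₂ ℝ (fun (A : C(K, E →L[ℝ] F)) (h : C(K, E)) =>
        (⟨fun t => A t (h t), by fun_prop⟩ : C(K, F)))
      (fun _ _ _ => by ext; simp) (fun _ _ _ => by ext; simp)
      (fun _ _ _ => by ext; simp) (fun _ _ _ => by ext; simp)) 1
    (fun A h => by
      rw [one_mul, ContinuousMap.norm_le _ (by positivity)]
      intro t
      exact ((A t).le_opNorm _).trans (mul_le_mul (A.norm_coe_le_norm t) (h.norm_coe_le_norm t)
        (norm_nonneg _) (norm_nonneg A)))

/-- The superposition operator `γ ↦ X ∘ γ` is differentiable if `X` is, with a uniformly continuous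
derivative. -/
theorem hasFDerivAt_superposition {E F : Type*} [NormedAddCommGroup E] [NormedSpace ℝ E]
    [NormedAddCommGroup F] [NormedSpace ℝ F] (X : C(E, F)) (X' : C(E, E →L[ℝ] F))
    (hX : ∀ x, HasFDerivAt X (X' x) x) (hu : UniformContinuous X') (γ : C(K, E)) :
    HasFDerivAt (fun γ : C(K, E) => X.comp γ) (pointwiseApply K E F (X'.comp γ)) γ := by
  rw [hasFDerivAt_iff_isLittleO_nhds_zero, Asymptotics.isLittleO_iff]
  intro ε hε
  obtain ⟨δ, hδ, hδ'⟩ := Metric.uniformContinuous_iff.1 hu ε hε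
  filter_upwards [Metric.ball_mem_nhds (0 : C(K, E)) hδ] with h hh
  rw [mem_ball_zero_iff] at hh
  rw [ContinuousMap.norm_le _ (by positivity)]
  intro t
  have hht : ‖h t‖ ≤ ‖h‖ := h.norm_coe_le_norm t
  -- Mean value inequality on the ball of radius `δ`, where `X'` differs from `X' (γ t)` by at most
  -- `ε`, uniformly in `t`.
  have key : ‖X (γ t + h t) - X (γ t) - X' (γ t) ((γ t + h t) - γ t)‖
      ≤ ε * ‖(γ t + h t) - γ t‖ := by
    refine (convex_ball (γ t) δ).norm_image_sub_le_of_norm_hasFDerivWithin_le'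
      (f := X) (f' := X') (fun x _ => (hX x).hasFDerivWithinAt) (fun x hx => ?_)
      (Metric.mem_ball_self hδ) ?_
    · rw [← dist_eq_norm]
      exact (hδ' hx).le
    · rw [Metric.mem_ball, dist_eq_norm, add_sub_cancel_left]
      exact hht.trans_lt hh
  rw [add_sub_cancel_left] at key
  calc _ = ‖X (γ t + h t) - X (γ t) - X' (γ t) (h t)‖ := rfl
    _ ≤ ε * ‖h t‖ := key
    _ ≤ ε * ‖h‖ := by gcongr

/-- The derivative of the superposition operator is the superposition operator of `fderiv ℝ X`
followed by a continuous linear map, so induction applies once the target space is allowed to vary.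
Both spaces share a universe so that `E →L[ℝ] F` stays in it. Compact support supplies the uniform
continuity and is inherited by the derivative. -/
theorem contDiff_superposition_nat {E : Type u} [NormedAddCommGroup E] [NormedSpace ℝ E] (n : ℕ) :
    ∀ {F : Type u} [NormedAddCommGroup F] [NormedSpace ℝ F] (X : C(E, F)),
      ContDiff ℝ ∞ X → HasCompactSupport X →
      ContDiff ℝ n (fun γ : C(K, E) => X.comp γ) := by
  induction n with
  | zero =>
    intro F _ _ X _ _
    exact contDiff_zero.2 (ContinuousMap.continuous_postcomp X)
  | succ n ih =>
    intro F _ _ X hX hc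
    have hX' : ContDiff ℝ ∞ (fderiv ℝ X) := hX.fderiv_right (by simp)
    have hc' : HasCompactSupport (fderiv ℝ X) := hc.fderiv ℝ
    let X' : C(E, E →L[ℝ] F) := ⟨fderiv ℝ X, hX'.continuous⟩
    push_cast
    rw [contDiff_succ_iff_hasFDerivAt]
    refine ⟨fun γ => pointwiseApply K E F (X'.comp γ), ?_, fun γ => ?_⟩
    · exact (pointwiseApply K E F).contDiff.comp (ih X' hX' hc')
    · exact hasFDerivAt_superposition X X'
        (fun x => (hX.differentiable (by simp) x).hasFDerivAt)
        (hc'.uniformContinuous_of_continuous hX'.continuous) γ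

theorem contDiff_superposition {E F : Type u} [NormedAddCommGroup E] [NormedSpace ℝ E]
    [NormedAddCommGroup F] [NormedSpace ℝ F] (X : C(E, F))
    (hX : ContDiff ℝ ∞ X) (hc : HasCompactSupport X) :
    ContDiff ℝ ∞ (fun γ : C(K, E) => X.comp γ) :=
  contDiff_infty.2 fun n => contDiff_superposition_nat n X hX hc

end Nemytskii

/-! ### Smooth local flows -/

section Flow

variable {E : Type u} [NormedAddCommGroup E] [NormedSpace ℝ E] [CompleteSpace E]

/-- The operator `γ ↦ ∫₀ᵗ γ` on continuous curves. -/
noncomputable def integralOp (E : Type*) [NormedAddCommGroup E] [NormedSpace ℝ E]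
    [CompleteSpace E] : C(Icc (0 : ℝ) 1, E) →L[ℝ] C(Icc (0 : ℝ) 1, E) :=
  LinearMap.mkContinuous
    { toFun := fun γ => ⟨fun t => ∫ τ in (0 : ℝ)..t, IccExtend zero_le_one γ τ, by
        have hc : Continuous (IccExtend zero_le_one γ) := γ.continuous.Icc_extend'
        exact (intervalIntegral.continuous_primitive
          (fun a b => hc.intervalIntegrable a b) 0).comp continuous_subtype_val⟩
      map_add' := fun γ η => by
        ext t
        have h1 : Continuous (IccExtend zero_le_one γ) := γ.continuous.Icc_extend'
        have h2 : Continuous (IccExtend zero_le_one η) := η.continuous.Icc_extend'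
        exact intervalIntegral.integral_add (h1.intervalIntegrable _ _) (h2.intervalIntegrable _ _)
      map_smul' := fun c γ => by
        ext t
        exact intervalIntegral.integral_smul c _ } 1
    (fun γ => by
      rw [one_mul, ContinuousMap.norm_le _ (norm_nonneg _)]
      intro t
      have := intervalIntegral.norm_integral_le_of_norm_le_const (a := 0) (b := (t : ℝ))
        (f := IccExtend zero_le_one γ) (C := ‖γ‖) (fun x _ => γ.norm_coe_le_norm _)
      refine this.trans ?_
      rw [sub_zero, abs_of_nonneg t.2.1]
      exact mul_le_of_le_one_right (norm_nonneg _) t.2.2)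

theorem integralOp_apply (γ : C(Icc (0 : ℝ) 1, E)) (t : Icc (0 : ℝ) 1) :
    integralOp E γ t = ∫ τ in (0 : ℝ)..t, IccExtend zero_le_one γ τ := rfl

/-- A solution of the integral equation `γ(t) = z + s ∫₀ᵗ X(γ)` is the rescaled integral curve. -/
theorem eq_of_integral_equation {X : E → E} (hX : Continuous X) {L : NNReal}
    (hL : LipschitzWith L X) {z : E} {s : ℝ} {γ : C(Icc (0 : ℝ) 1, E)}
    (hγ : ∀ t, γ t = z + s • integralOp E ((ContinuousMap.mk X hX).comp γ) t)
    {α : ℝ → E} (hα0 : α 0 = z)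
    (hα : ∀ t ∈ Icc (0 : ℝ) 1, HasDerivAt α (X (α (s * t))) (s * t)) :
    γ 1 = α s := by
  let δ : ℝ → E := IccExtend zero_le_one γ
  have hδc : Continuous δ := γ.continuous.Icc_extend'
  have hXδ : Continuous (fun τ => X (δ τ)) := hX.comp hδc
  have hδ : ∀ t ∈ Icc (0 : ℝ) 1, δ t = z + s • ∫ τ in (0 : ℝ)..t, X (δ τ) := by
    intro t ht
    have h1 : δ t = γ ⟨t, ht⟩ := IccExtend_of_mem _ _ ht
    rw [h1, hγ, integralOp_apply]
    rfl
  have hδ' : ∀ t ∈ Icc (0 : ℝ) 1, HasDerivWithinAt δ (s • X (δ t)) (Icc 0 1) t := by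
    intro t ht
    have h1 : HasDerivAt (fun t => z + s • ∫ τ in (0 : ℝ)..t, X (δ τ)) (s • X (δ t)) t :=
      ((intervalIntegral.integral_hasDerivAt_right (hXδ.intervalIntegrable _ _)
        hXδ.aestronglyMeasurable.stronglyMeasurableAtFilter hXδ.continuousAt).const_smul
        s).const_add z
    exact h1.hasDerivWithinAt.congr hδ (hδ t ht)
  have hα' : ∀ t ∈ Icc (0 : ℝ) 1, HasDerivAt (fun t => α (s * t)) (s • X (α (s * t))) t := by
    intro t ht
    have h2 : HasDerivAt (fun t : ℝ => s * t) s t := by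
      simpa using (hasDerivAt_id t).const_mul s
    exact (hα t ht).scomp t h2
  have hLs : LipschitzWith (‖s‖₊ * L) (fun x => s • X x) := 
    (lipschitzWith_smul s).comp hL
  -- The extended curve and `t ↦ α (s * t)` both solve `y' = s X(y)` with initial value `z`.
  have huniq := ODE_solution_unique (v := fun _ x => s • X x) (K := ‖s‖₊ * L) (a := 0) (b := 1)
    (f := δ) (g := fun t => α (s * t)) (fun _ => hLs) hδc.continuousOn
    (fun t ht => (hδ' t ⟨ht.1, ht.2.le⟩).mono_of_mem_nhdsWithin (Icc_mem_nhdsGE_of_mem ht))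
    (fun t ht => (hα' t ht).continuousAt.continuousWithinAt)
    (fun t ht => (hα' t ⟨ht.1, ht.2.le⟩).hasDerivWithinAt)
    (by
      show δ 0 = α (s * 0)
      rw [hδ 0 (by simp)]
      simp [hα0])
  have h1 := huniq (right_mem_Icc.2 zero_le_one)
  have h2 : δ 1 = γ 1 := IccExtend_of_mem _ _ (right_mem_Icc.2 zero_le_one)
  rw [← h2, h1]
  simp

/-- The local flow of a smooth vector field with compact support is smooth. -/
theorem exists_smooth_local_flow {X : E → E} (hX : ContDiff ℝ ∞ X) (hc : HasCompactSupport X)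
    (x₀ : E) : ∃ (α : E → ℝ → E) (U : Set (E × ℝ)), IsOpen U ∧ (x₀, 0) ∈ U ∧
      ContDiffOn ℝ ∞ (fun p : E × ℝ => α p.1 p.2) U ∧
      ∀ p ∈ U, α p.1 0 = p.1 ∧ HasDerivAt (α p.1) (X (α p.1 p.2)) p.2 := by
  obtain ⟨L, hL⟩ := hX.lipschitzWith_of_hasCompactSupport hc (by simp)
  -- Picard–Lindelöf supplies the integral curves; what is missing is their smooth dependence on the
  -- initial point and time.
  obtain ⟨r, hr, ε, hε, hα⟩ :
      ∃ r > (0 : ℝ), ∃ ε > (0 : ℝ), ∃ α : E → ℝ → E, ∀ x ∈ Metric.closedBall x₀ r,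
        α x 0 = x ∧ ∀ t ∈ Ioo (0 - ε) (0 + ε), HasDerivAt (α x) (X (α x t)) t := by
    obtain ⟨r, hr, ε, hε, H⟩ :=
      (hX.contDiffAt (x := x₀)).of_le (m := 1) (by simp)
        |>.exists_forall_mem_closedBall_exists_eq_forall_mem_Ioo_hasDerivAt 0
    choose! α hα using H
    exact ⟨r, hr, ε, hε, α, hα⟩
  obtain ⟨α, hα⟩ := hα
  let Xc : C(E, E) := ⟨X, hX.continuous⟩
  let N : C(Icc (0 : ℝ) 1, E) → C(Icc (0 : ℝ) 1, E) := fun γ => Xc.comp γ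
  have hN : ContDiff ℝ ∞ N := contDiff_superposition Xc hX hc
  let cst : E →L[ℝ] C(Icc (0 : ℝ) 1, E) := ContinuousLinearMap.const ℝ (Icc (0 : ℝ) 1)
  -- The time is a parameter `s` of the equation, so all curves live on the fixed interval `[0, 1]`.
  -- The parameters `(z, s)` are carried along as first component, which turns the implicit function
  -- problem into an inversion; the second component vanishes exactly on solutions of the integral
  -- equation.
  let Ψ : (E × ℝ) × C(Icc (0 : ℝ) 1, E) → (E × ℝ) × C(Icc (0 : ℝ) 1, E) :=
    fun q => (q.1, q.2 - cst q.1.1 - q.1.2 • integralOp E (N q.2))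
  have hΨ : ContDiff ℝ ∞ Ψ := by
    have h1 : ContDiff ℝ ∞ (fun q : (E × ℝ) × C(Icc (0 : ℝ) 1, E) => integralOp E (N q.2)) :=
      (integralOp E).contDiff.comp (hN.comp contDiff_snd)
    have h2 : ContDiff ℝ ∞ (fun q : (E × ℝ) × C(Icc (0 : ℝ) 1, E) => cst q.1.1) :=
      cst.contDiff.comp (contDiff_fst.comp contDiff_fst)
    exact contDiff_fst.prodMk ((contDiff_snd.sub h2).sub
      ((contDiff_snd.comp contDiff_fst).smul h1))
  let q₀ : (E × ℝ) × C(Icc (0 : ℝ) 1, E) := ((x₀, 0), cst x₀)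
  let w := integralOp E (N (cst x₀))
  -- At `s = 0` the integral term contributes only through `ds`, so the derivative is the triangular
  -- map `(dz, ds, dγ) ↦ (dz, ds, dγ - dz - ds • w)`, inverted by changing two signs.
  let f' : ((E × ℝ) × C(Icc (0 : ℝ) 1, E)) ≃L[ℝ] ((E × ℝ) × C(Icc (0 : ℝ) 1, E)) :=
    ContinuousLinearEquiv.equivOfInverse
      ((ContinuousLinearMap.fst ℝ _ _).prod (ContinuousLinearMap.snd ℝ _ _
        - cst ∘L (ContinuousLinearMap.fst ℝ _ _) ∘L (ContinuousLinearMap.fst ℝ _ _)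
        - ((ContinuousLinearMap.snd ℝ _ _) ∘L (ContinuousLinearMap.fst ℝ _ _)).smulRight w))
      ((ContinuousLinearMap.fst ℝ _ _).prod (ContinuousLinearMap.snd ℝ _ _
        + cst ∘L (ContinuousLinearMap.fst ℝ _ _) ∘L (ContinuousLinearMap.fst ℝ _ _)
        + ((ContinuousLinearMap.snd ℝ _ _) ∘L (ContinuousLinearMap.fst ℝ _ _)).smulRight w))
      (fun d => by ext <;> simp <;> abel) (fun d => by ext <;> simp <;> abel)
  have hf' : HasFDerivAt Ψ (f' : _ →L[ℝ] _) q₀ := by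
    have hg : HasFDerivAt (fun q : (E × ℝ) × C(Icc (0 : ℝ) 1, E) => integralOp E (N q.2))
        (fderiv ℝ (fun q : (E × ℝ) × C(Icc (0 : ℝ) 1, E) => integralOp E (N q.2)) q₀) q₀ :=
      (((integralOp E).contDiff.comp (hN.comp contDiff_snd)).differentiable
        (by simp) q₀).hasFDerivAt
    have h1 : HasFDerivAt (fun q : (E × ℝ) × C(Icc (0 : ℝ) 1, E) => q.1) _ q₀ :=
      hasFDerivAt_fst (𝕜 := ℝ)
    have h2 : HasFDerivAt (fun q : (E × ℝ) × C(Icc (0 : ℝ) 1, E) => q.2) _ q₀ :=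
      hasFDerivAt_snd (𝕜 := ℝ)
    have h := h1.prodMk ((h2.sub (cst.hasFDerivAt.comp q₀ (h1.fst))).sub (h1.snd.smul hg))
    refine h.congr_fderiv ?_
    ext d <;> simp [f', q₀, w]
  obtain ⟨e, he₀, -, heΨ, -, hesymm⟩ :=
    exists_smooth_localInverse isOpen_univ hΨ.contDiffOn (mem_univ q₀) hf'
  have hΨq : Ψ q₀ = ((x₀, 0), 0) := by simp [Ψ, q₀]
  let ι : E × ℝ → (E × ℝ) × C(Icc (0 : ℝ) 1, E) := fun p => (p, 0)
  have hι : ContDiff ℝ ∞ ι := contDiff_id.prodMk contDiff_const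
  refine ⟨α, (ι ⁻¹' e.target) ∩ (Metric.ball x₀ r ×ˢ Ioo (-ε) ε),
    (e.open_target.preimage hι.continuous).inter (Metric.isOpen_ball.prod isOpen_Ioo),
    ⟨?_, Metric.mem_ball_self hr, by simpa using hε⟩, ?_, ?_⟩
  · show ((x₀, 0), 0) ∈ e.target
    rw [← hΨq, ← heΨ]
    exact e.map_source he₀
  · have hev : ContDiff ℝ ∞ (fun γ : C(Icc (0 : ℝ) 1, E) => γ 1) :=
      (ContinuousMap.evalCLM (M := E) ℝ (1 : Icc (0 : ℝ) 1)).contDiff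
    have hs : ContDiffOn ℝ ∞ (fun p => (e.symm (ι p)).2 1)
        ((ι ⁻¹' e.target) ∩ (Metric.ball x₀ r ×ˢ Ioo (-ε) ε)) :=
      hev.comp_contDiffOn
        (contDiff_snd.comp_contDiffOn (hesymm.comp hι.contDiffOn fun p hp => hp.1))
    refine hs.congr fun p hp => ?_
    have hq : Ψ (e.symm (ι p)) = ι p := by rw [← heΨ]; exact e.right_inv hp.1
    have hq1 : (e.symm (ι p)).1 = p := congrArg Prod.fst hq
    have hq2 : (e.symm (ι p)).2 - cst (e.symm (ι p)).1.1
      - (e.symm (ι p)).1.2 • integralOp E (N (e.symm (ι p)).2) = 0 := congrArg Prod.snd hq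
    rw [hq1] at hq2
    have hαp := hα p.1 (Metric.ball_subset_closedBall hp.2.1)
    -- Uniqueness identifies the endpoint of the smoothly varying solution with the integral curve
    -- at time `s`.
    refine (eq_of_integral_equation hX.continuous hL (s := p.2) (fun t => ?_) hαp.1
      (fun t ht => hαp.2 _ ?_)).symm
    · have := congrArg (fun γ : C(Icc (0 : ℝ) 1, E) => γ t) hq2
      simp only [ContinuousMap.sub_apply, ContinuousMap.smul_apply, ContinuousMap.zero_apply,
        sub_eq_zero] at this
      have hcst : cst p.1 t = p.1 := rfl
      change _ = p.1 + p.2 • integralOp E (N (e.symm (ι p)).2) t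
      rw [← this, hcst]
      abel
    · have h1 : |p.2| < ε := abs_lt.2 hp.2.2
      have h2 : |p.2 * t| < ε := by
        rw [abs_mul, abs_of_nonneg ht.1]
        exact (mul_le_of_le_one_right (abs_nonneg _) ht.2).trans_lt h1
      simpa using abs_lt.1 h2
  · intro p hp
    have hαp := hα p.1 (Metric.ball_subset_closedBall hp.2.1)
    exact ⟨hαp.1, hαp.2 _ (by simpa using hp.2.2)⟩

end Flow

/-! ### Tensors in charts and their transformation rules -/

section Charts

variable {n : ℕ} {M : Type*} [TopologicalSpace M] [ChartedSpace (Coord n) M]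

theorem sum_smul_single (y : Coord n) : ∑ i, y i • EuclideanSpace.single i (1 : ℝ) = y := by
  ext j
  simp [Finset.sum_apply, Pi.single_apply]

theorem sum_mul_apply_single (f : Coord n →L[ℝ] ℝ) (y : Coord n) :
    ∑ i, y i * f (EuclideanSpace.single i 1) = f y := by
  conv_rhs => rw [← sum_smul_single y]
  simp

/-- The metric in the chart `φ`, as a field of bilinear forms on the coordinate space. -/
noncomputable def chartMetric (a : BilinField n M) (φ : OpenPartialHomeomorph M (Coord n))
    (x : Coord n) : Coord n →L[ℝ] Coord n →L[ℝ] ℝ :=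
  let T : Coord n →L[ℝ] Coord n := mfderiv (𝓡 n) (𝓡 n) φ.symm x
  let A : Coord n →L[ℝ] Coord n →L[ℝ] ℝ := a (φ.symm x)
  A.bilinearComp T T

/-- The form in the chart `φ`, as a field of linear forms on the coordinate space. -/
noncomputable def chartForm (b : CovectorField n M) (φ : OpenPartialHomeomorph M (Coord n))
    (x : Coord n) : Coord n →L[ℝ] ℝ :=
  let T : Coord n →L[ℝ] Coord n := mfderiv (𝓡 n) (𝓡 n) φ.symm x
  let A : Coord n →L[ℝ] ℝ := b (φ.symm x)
  A.comp T

theorem chartMetric_apply (a : BilinField n M) (φ : OpenPartialHomeomorph M (Coord n))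
    (x y z : Coord n) :
    chartMetric a φ x y z = a (φ.symm x) (coordVec φ x y) (coordVec φ x z) := rfl

theorem chartForm_apply (b : CovectorField n M) (φ : OpenPartialHomeomorph M (Coord n))
    (x y : Coord n) : chartForm b φ x y = b (φ.symm x) (coordVec φ x y) := rfl

theorem metricComp_eq (a : BilinField n M) (φ : OpenPartialHomeomorph M (Coord n))
    (i j : Fin n) (x : Coord n) :
    metricComp a φ i j x =
      chartMetric a φ x (EuclideanSpace.single i 1) (EuclideanSpace.single j 1) := rfl

theorem formComp_eq (b : CovectorField n M) (φ : OpenPartialHomeomorph M (Coord n))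
    (i : Fin n) (x : Coord n) :
    formComp b φ i x = chartForm b φ x (EuclideanSpace.single i 1) := rfl

theorem contDiffOn_chartForm {b : CovectorField n M} (hb : IsSmoothForm b)
    {φ : OpenPartialHomeomorph M (Coord n)} (hφ : φ ∈ IsManifold.maximalAtlas (𝓡 n) ∞ M) :
    ContDiffOn ℝ ∞ (chartForm b φ) φ.target := by
  rw [contDiffOn_clm_apply]
  intro y
  have h : ∀ x, chartForm b φ x y = ∑ i, y i * formComp b φ i x := fun x =>
    (sum_mul_apply_single _ y).symm
  simp only [h]
  exact ContDiffOn.sum fun i _ => contDiffOn_const.mul (hb φ hφ i)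

theorem contDiffOn_chartMetric {a : BilinField n M} (ha : IsPseudoRiemannianMetric a)
    {φ : OpenPartialHomeomorph M (Coord n)} (hφ : φ ∈ IsManifold.maximalAtlas (𝓡 n) ∞ M) :
    ContDiffOn ℝ ∞ (chartMetric a φ) φ.target := by
  rw [contDiffOn_clm_apply]
  intro y
  rw [contDiffOn_clm_apply]
  intro z
  have h : ∀ x, chartMetric a φ x y z = ∑ i, y i * ∑ j, z j * metricComp a φ i j x := fun x => by
    have h1 := sum_mul_apply_single ((chartMetric a φ x).flip z) y
    simp only [ContinuousLinearMap.flip_apply] at h1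
    rw [← h1]
    exact Finset.sum_congr rfl fun i _ => congrArg _ (sum_mul_apply_single _ z).symm
  simp only [h]
  exact ContDiffOn.sum fun i _ => contDiffOn_const.mul
    (ContDiffOn.sum fun j _ => contDiffOn_const.mul (ha.smooth φ hφ i j))

theorem chartMetric_symm {a : BilinField n M} (ha : IsPseudoRiemannianMetric a)
    (φ : OpenPartialHomeomorph M (Coord n)) (x y z : Coord n) :
    chartMetric a φ x y z = chartMetric a φ x z y := ha.symm _ _ _

variable [IsManifold (𝓡 n) ∞ M]

theorem mdifferentiable_of_mem_maximalAtlas {φ : OpenPartialHomeomorph M (Coord n)}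
    (hφ : φ ∈ IsManifold.maximalAtlas (𝓡 n) ∞ M) : φ.MDifferentiable (𝓡 n) (𝓡 n) :=
  ⟨(contMDiffOn_of_mem_maximalAtlas hφ).mdifferentiableOn (by simp),
    (contMDiffOn_symm_of_mem_maximalAtlas hφ).mdifferentiableOn (by simp)⟩

theorem bijective_coordVec {φ : OpenPartialHomeomorph M (Coord n)}
    (hφ : φ ∈ IsManifold.maximalAtlas (𝓡 n) ∞ M) {x : Coord n} (hx : x ∈ φ.target) :
    Function.Bijective (coordVec φ x) :=
  haveI : IsManifold (𝓡 n) 1 M := IsManifold.of_le (n := ∞) (by simp)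
  (mdifferentiable_of_mem_maximalAtlas hφ).symm.mfderiv_bijective hx

theorem chartMetric_nondegenerate {a : BilinField n M} (ha : IsPseudoRiemannianMetric a)
    {φ : OpenPartialHomeomorph M (Coord n)} (hφ : φ ∈ IsManifold.maximalAtlas (𝓡 n) ∞ M)
    {x : Coord n} (hx : x ∈ φ.target) {y : Coord n} (hy : ∀ z, chartMetric a φ x y z = 0) :
    y = 0 := by
  have hbij := bijective_coordVec hφ hx
  have h0 : coordVec φ x y = 0 := by
    refine ha.nondegenerate _ _ fun Y => ?_
    obtain ⟨z, rfl⟩ := hbij.2 Y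
    exact hy z
  exact hbij.1 (h0.trans (map_zero (mfderiv (𝓡 n) (𝓡 n) φ.symm x)).symm)

theorem trans_mem_maximalAtlas {φ : OpenPartialHomeomorph M (Coord n)}
    (hφ : φ ∈ IsManifold.maximalAtlas (𝓡 n) ∞ M) {e : OpenPartialHomeomorph (Coord n) (Coord n)}
    (he : ContDiffOn ℝ ∞ e e.source) (he' : ContDiffOn ℝ ∞ e.symm e.target) :
    φ.trans e ∈ IsManifold.maximalAtlas (𝓡 n) ∞ M := by
  refine (φ.trans e).mem_maximalAtlas_of_contMDiffOn ?_ ?_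
  · refine (contMDiffOn_iff_contDiffOn.2 he).comp
      ((contMDiffOn_of_mem_maximalAtlas hφ).mono ?_) ?_
    · intro p hp
      exact hp.1
    · intro p hp
      exact hp.2
  · refine (contMDiffOn_symm_of_mem_maximalAtlas hφ).comp
      ((contMDiffOn_iff_contDiffOn.2 he').mono ?_) ?_
    · intro p hp
      exact hp.1
    · intro p hp
      exact hp.2

variable {φ ψ : OpenPartialHomeomorph M (Coord n)}

theorem contDiffAt_transition (hφ : φ ∈ IsManifold.maximalAtlas (𝓡 n) ∞ M)
    (hψ : ψ ∈ IsManifold.maximalAtlas (𝓡 n) ∞ M) {x : Coord n} (hx : x ∈ φ.target)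
    (hx' : φ.symm x ∈ ψ.source) : ContDiffAt ℝ ∞ (fun y => ψ (φ.symm y)) x :=
  contMDiffAt_iff_contDiffAt.1 ((contMDiffAt_of_mem_maximalAtlas hψ hx').comp x
    (contMDiffAt_symm_of_mem_maximalAtlas hφ hx))

theorem eventually_symm_mem_source {x : Coord n} (hx : x ∈ φ.target)
    (hx' : φ.symm x ∈ ψ.source) : ∀ᶠ y in 𝓝 x, y ∈ φ.target ∧ φ.symm y ∈ ψ.source :=
  (show ∀ᶠ y in 𝓝 x, y ∈ φ.target from φ.open_target.mem_nhds hx).and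
    ((φ.continuousAt_symm hx).eventually_mem (ψ.open_source.mem_nhds hx'))

/-- Chain rule for `ψ.symm ∘ (ψ ∘ φ.symm)`, which is `φ.symm` near `x`. Both sides are viewed in
`Coord n` because their tangent spaces sit over base points that are only propositionally equal. -/
theorem coordVec_transition (hφ : φ ∈ IsManifold.maximalAtlas (𝓡 n) ∞ M)
    (hψ : ψ ∈ IsManifold.maximalAtlas (𝓡 n) ∞ M) {x : Coord n} (hx : x ∈ φ.target)
    (hx' : φ.symm x ∈ ψ.source) (y : Coord n) :
    (coordVec φ x y : Coord n) =
      (coordVec ψ (ψ (φ.symm x)) (fderiv ℝ (fun y => ψ (φ.symm y)) x y) : Coord n) := by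
  have hτ : MDifferentiableAt (𝓡 n) (𝓡 n) (fun y => ψ (φ.symm y)) x :=
    ((contDiffAt_transition hφ hψ hx hx').differentiableAt (by simp)).mdifferentiableAt
  have hψ' : MDifferentiableAt (𝓡 n) (𝓡 n) ψ.symm (ψ (φ.symm x)) :=
    (mdifferentiable_of_mem_maximalAtlas hψ).mdifferentiableAt_symm (ψ.map_source hx')
  have hcomp := mfderiv_comp x hψ' hτ
  have hev : (ψ.symm ∘ fun y => ψ (φ.symm y)) =ᶠ[𝓝 x] φ.symm := by
    filter_upwards [eventually_symm_mem_source hx hx'] with y hy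
    exact ψ.left_inv hy.2
  have h := hev.mfderiv_eq (I := 𝓡 n) (I' := 𝓡 n)
  rw [mfderiv_eq_fderiv] at hcomp
  have h2 : (mfderiv (𝓡 n) (𝓡 n) φ.symm x : Coord n →L[ℝ] Coord n) =
      (mfderiv (𝓡 n) (𝓡 n) ψ.symm (ψ (φ.symm x)) : Coord n →L[ℝ] Coord n).comp
        (fderiv ℝ (fun y => ψ (φ.symm y)) x) := h.symm.trans hcomp
  exact congrArg (fun f : Coord n →L[ℝ] Coord n => f y) h2

theorem chartMetric_transition (a : BilinField n M) (hφ : φ ∈ IsManifold.maximalAtlas (𝓡 n) ∞ M)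
    (hψ : ψ ∈ IsManifold.maximalAtlas (𝓡 n) ∞ M) {x : Coord n} (hx : x ∈ φ.target)
    (hx' : φ.symm x ∈ ψ.source) (y z : Coord n) :
    chartMetric a φ x y z = chartMetric a ψ (ψ (φ.symm x))
      (fderiv ℝ (fun y => ψ (φ.symm y)) x y) (fderiv ℝ (fun y => ψ (φ.symm y)) x z) := by
  -- Moves the base point along an equality while the vectors stay fixed in the model space.
  have h : ∀ p q : M, p = q → ∀ u v : Coord n, (a p : Coord n →L[ℝ] Coord n →L[ℝ] ℝ) u v =
      (a q : Coord n →L[ℝ] Coord n →L[ℝ] ℝ) u v := by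
    rintro p _ rfl u v
    rfl
  have h1 := h _ _ (ψ.left_inv hx').symm (coordVec φ x y) (coordVec φ x z)
  refine h1.trans ?_
  rw [coordVec_transition hφ hψ hx hx' y, coordVec_transition hφ hψ hx hx' z]
  rfl

theorem chartForm_transition (b : CovectorField n M) (hφ : φ ∈ IsManifold.maximalAtlas (𝓡 n) ∞ M)
    (hψ : ψ ∈ IsManifold.maximalAtlas (𝓡 n) ∞ M) {x : Coord n} (hx : x ∈ φ.target)
    (hx' : φ.symm x ∈ ψ.source) (y : Coord n) :
    chartForm b φ x y = chartForm b ψ (ψ (φ.symm x))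
      (fderiv ℝ (fun y => ψ (φ.symm y)) x y) := by
  have h : ∀ p q : M, p = q → ∀ u : Coord n, (b p : Coord n →L[ℝ] ℝ) u =
      (b q : Coord n →L[ℝ] ℝ) u := by
    rintro p _ rfl u
    rfl
  have h1 := h _ _ (ψ.left_inv hx').symm (coordVec φ x y)
  refine h1.trans ?_
  rw [coordVec_transition hφ hψ hx hx' y]
  rfl

end Charts

/-! ### Bilinear forms, and the covariant derivative of a 1-form under coordinate changes -/

section LinearAlgebra

variable {n : ℕ}

theorem bilin_ext {f g : Coord n →L[ℝ] Coord n →L[ℝ] ℝ}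
    (h : ∀ i j, f (EuclideanSpace.single i 1) (EuclideanSpace.single j 1) =
      g (EuclideanSpace.single i 1) (EuclideanSpace.single j 1)) : f = g := by
  ext y z
  have h1 : ∀ i, f (EuclideanSpace.single i 1) z = g (EuclideanSpace.single i 1) z := fun i => by
    rw [← sum_mul_apply_single (f _) z, ← sum_mul_apply_single (g _) z]
    exact Finset.sum_congr rfl fun j _ => by rw [h]
  have h2 := sum_mul_apply_single (f.flip z) y
  have h3 := sum_mul_apply_single (g.flip z) y
  simp only [ContinuousLinearMap.flip_apply] at h2 h3
  rw [← h2, ← h3]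
  exact Finset.sum_congr rfl fun i _ => by rw [h1]

end LinearAlgebra

section Hessian

variable {E : Type*} [NormedAddCommGroup E] [NormedSpace ℝ E]

theorem fderiv_apply_apply {g : E → E →L[ℝ] E →L[ℝ] ℝ} {x : E} (hg : DifferentiableAt ℝ g x)
    (v y z : E) : fderiv ℝ (fun x => g x y z) x v = fderiv ℝ g x v y z := by
  have h := (hg.hasFDerivAt.clm_apply (hasFDerivAt_const y x)).clm_apply (hasFDerivAt_const z x)
  rw [h.fderiv]
  simp

theorem fderiv_clm_apply_const {b : E → E →L[ℝ] ℝ} {x : E} (hb : DifferentiableAt ℝ b x)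
    (v y : E) : fderiv ℝ (fun x => b x y) x v = fderiv ℝ b x v y := by
  have h := hb.hasFDerivAt.clm_apply (hasFDerivAt_const y x)
  rw [h.fderiv]
  simp

theorem fderiv_symm_of_eventually_symm {g : E → E →L[ℝ] E →L[ℝ] ℝ} {x : E}
    (hg : DifferentiableAt ℝ g x) (hs : ∀ᶠ x' in 𝓝 x, ∀ y z, g x' y z = g x' z y) (v y z : E) :
    fderiv ℝ g x v y z = fderiv ℝ g x v z y := by
  rw [← fderiv_apply_apply hg, ← fderiv_apply_apply hg]
  have : (fun x => g x y z) =ᶠ[𝓝 x] fun x => g x z y := hs.mono fun x' h => h y z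
  rw [this.fderiv_eq]

/-- The covariant derivative `∇_y b (z)` of a linear form `b` for the Levi-Civita connection of `g`,
where `B` is the vector dual to `b`. -/
noncomputable def formHess (g : E → E →L[ℝ] E →L[ℝ] ℝ) (b : E → E →L[ℝ] ℝ) (B x y z : E) : ℝ :=
  fderiv ℝ b x y z
    - 1 / 2 * (fderiv ℝ g x y z B + fderiv ℝ g x z y B - fderiv ℝ g x B y z)

/-- `formHess` is natural under changes of coordinates. -/
theorem formHess_pullback {g g' : E → E →L[ℝ] E →L[ℝ] ℝ} {b b' : E → E →L[ℝ] ℝ} {τ : E → E}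
    {x : E} (hτ : ContDiffAt ℝ ∞ τ x) (hg : DifferentiableAt ℝ g (τ x))
    (hb : DifferentiableAt ℝ b (τ x)) (hs : ∀ y z, g (τ x) y z = g (τ x) z y)
    (hg' : ∀ᶠ x' in 𝓝 x, ∀ y z, g' x' y z = g (τ x') (fderiv ℝ τ x' y) (fderiv ℝ τ x' z))
    (hb' : ∀ᶠ x' in 𝓝 x, ∀ y, b' x' y = b (τ x') (fderiv ℝ τ x' y))
    (hdg' : DifferentiableAt ℝ g' x) (hdb' : DifferentiableAt ℝ b' x)
    {B : E} (hB : ∀ z, g (τ x) (fderiv ℝ τ x B) z = b (τ x) z) (y z : E) :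
    formHess g' b' B x y z =
      formHess g b (fderiv ℝ τ x B) (τ x) (fderiv ℝ τ x y) (fderiv ℝ τ x z) := by
  have hτ1 : HasFDerivAt τ (fderiv ℝ τ x) x := (hτ.differentiableAt (by simp)).hasFDerivAt
  have hτ2 : HasFDerivAt (fderiv ℝ τ) (fderiv ℝ (fderiv ℝ τ) x) x :=
    ((hτ.fderiv_right (m := ∞) (by simp)).differentiableAt (by simp)).hasFDerivAt
  have hsymm : ∀ u v, fderiv ℝ (fderiv ℝ τ) x u v = fderiv ℝ (fderiv ℝ τ) x v u := fun u v =>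
    (hτ.isSymmSndFDerivAt (by
      simp only [minSmoothness_of_isRCLikeNormedField]
      exact WithTop.coe_le_coe.2 (le_top : (2 : ℕ∞) ≤ ⊤))).eq u v
  have hDg : ∀ u v w, fderiv ℝ g' x u v w =
      fderiv ℝ g (τ x) (fderiv ℝ τ x u) (fderiv ℝ τ x v) (fderiv ℝ τ x w)
      + g (τ x) (fderiv ℝ (fderiv ℝ τ) x u v) (fderiv ℝ τ x w)
      + g (τ x) (fderiv ℝ τ x v) (fderiv ℝ (fderiv ℝ τ) x u w) := by
    intro u v w
    rw [← fderiv_apply_apply hdg']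
    have he : (fun x' => g' x' v w) =ᶠ[𝓝 x]
        fun x' => g (τ x') (fderiv ℝ τ x' v) (fderiv ℝ τ x' w) := hg'.mono fun x' h => h v w
    have hgτ : HasFDerivAt (fun x' => g (τ x'))
        ((fderiv ℝ g (τ x)).comp (fderiv ℝ τ x)) x :=
      HasFDerivAt.comp (g := g) (g' := fderiv ℝ g (τ x)) x hg.hasFDerivAt hτ1
    have h := (hgτ.clm_apply
      (hτ2.clm_apply (hasFDerivAt_const v x))).clm_apply
      (hτ2.clm_apply (hasFDerivAt_const w x))
    rw [he.fderiv_eq]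
    refine (congrArg (fun f : E →L[ℝ] ℝ => f u) h.fderiv).trans ?_
    simp
    ring
  have hDb : ∀ u v, fderiv ℝ b' x u v =
      fderiv ℝ b (τ x) (fderiv ℝ τ x u) (fderiv ℝ τ x v)
      + b (τ x) (fderiv ℝ (fderiv ℝ τ) x u v) := by
    intro u v
    rw [← fderiv_clm_apply_const hdb']
    have he : (fun x' => b' x' v) =ᶠ[𝓝 x]
        fun x' => b (τ x') (fderiv ℝ τ x' v) := hb'.mono fun x' h => h v
    have hbτ : HasFDerivAt (fun x' => b (τ x'))
        ((fderiv ℝ b (τ x)).comp (fderiv ℝ τ x)) x := hb.hasFDerivAt.comp x hτ1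
    have h := hbτ.clm_apply (hτ2.clm_apply (hasFDerivAt_const v x))
    rw [he.fderiv_eq]
    refine (congrArg (fun f : E →L[ℝ] ℝ => f u) h.fderiv).trans ?_
    simp
    ring
  unfold formHess
  -- The terms with second derivatives of `τ` cancel: `D²τ` and `g` are symmetric, and `hB` turns
  -- `b(D²τ(y, z))` into `g(Dτ B, D²τ(y, z))`.
  rw [hDb, hDg, hDg, hDg, hsymm z y, hsymm B y, hsymm B z, ← hB,
    hs (fderiv ℝ (fderiv ℝ τ) x y z) (fderiv ℝ τ x B),
    hs (fderiv ℝ (fderiv ℝ τ) x y B) (fderiv ℝ τ x z)]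
  ring

end Hessian

/-! ### The dual vector field, Christoffel symbols and `∇b` in a chart -/

section ChartTensors

variable {n : ℕ} {M : Type*} [TopologicalSpace M] [ChartedSpace (Coord n) M]

/-- The matrix of the metric in the chart `φ`. -/
noncomputable def metricMatrix (a : BilinField n M) (φ : OpenPartialHomeomorph M (Coord n))
    (x : Coord n) : Matrix (Fin n) (Fin n) ℝ :=
  Matrix.of fun k l => metricComp a φ k l x

/-- The vector field `B` dual to the form `b`, in the chart `φ`. -/
noncomputable def dualVec (a : BilinField n M) (b : CovectorField n M)
    (φ : OpenPartialHomeomorph M (Coord n)) (x : Coord n) : Coord n :=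
  WithLp.toLp 2 fun i => ∑ j, invMetricComp a φ i j x * formComp b φ j x

/-- The quadratic vector field `Γ^i_jk y^j y^k` of the Levi-Civita connection in the chart `φ`. -/
noncomputable def christoffelVec (a : BilinField n M) (φ : OpenPartialHomeomorph M (Coord n))
    (x y : Coord n) : Coord n :=
  WithLp.toLp 2 fun i => ∑ j, ∑ k, christoffel a φ i j k x * y j * y k

/-- `∇b` in the chart `φ`, as a function of two vectors. -/
noncomputable def chartHess (a : BilinField n M) (b : CovectorField n M)
    (φ : OpenPartialHomeomorph M (Coord n)) (x y z : Coord n) : ℝ :=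
  formHess (chartMetric a φ) (chartForm b φ) (dualVec a b φ x) x y z

variable [IsManifold (𝓡 n) ∞ M] {a : BilinField n M} {b : CovectorField n M}
  {φ : OpenPartialHomeomorph M (Coord n)}

theorem metricMatrix_isSymm (ha : IsPseudoRiemannianMetric a) (x : Coord n) :
    (metricMatrix a φ x).transpose = metricMatrix a φ x := by
  ext i j
  exact chartMetric_symm ha φ x _ _

theorem metricMatrix_mulVec (a : BilinField n M) (φ : OpenPartialHomeomorph M (Coord n))
    (x y : Coord n) (i : Fin n) :
    (metricMatrix a φ x).mulVec y i = chartMetric a φ x (EuclideanSpace.single i 1) y := by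
  rw [← sum_mul_apply_single (chartMetric a φ x (EuclideanSpace.single i 1)) y]
  change ∑ j, metricMatrix a φ x i j * y j = ∑ j, y j * metricMatrix a φ x i j
  exact Finset.sum_congr rfl fun j _ => mul_comm (metricMatrix a φ x i j) (y j)

theorem det_metricMatrix_ne_zero (ha : IsPseudoRiemannianMetric a)
    (hφ : φ ∈ IsManifold.maximalAtlas (𝓡 n) ∞ M) {x : Coord n} (hx : x ∈ φ.target) :
    (metricMatrix a φ x).det ≠ 0 := by
  intro h
  obtain ⟨v, hv, hv'⟩ := Matrix.exists_mulVec_eq_zero_iff.2 h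
  apply hv
  have h0 : (WithLp.toLp 2 v : Coord n) = 0 := by
    refine chartMetric_nondegenerate ha hφ hx fun z => ?_
    rw [chartMetric_symm ha, ← ContinuousLinearMap.flip_apply, ← sum_mul_apply_single _ z]
    refine Finset.sum_eq_zero fun i _ => ?_
    have h1 := metricMatrix_mulVec a φ x (WithLp.toLp 2 v) i
    rw [ContinuousLinearMap.flip_apply, ← h1]
    have h2 : (metricMatrix a φ x).mulVec v i = 0 := congrFun hv' i
    simp [h2]
  ext i
  exact congrArg (fun w : Coord n => w i) h0

theorem eq_of_mulVec_eq {A : Matrix (Fin n) (Fin n) ℝ} (hA : A.det ≠ 0) {v w : Fin n → ℝ}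
    (h : A.mulVec v = w) (i : Fin n) : ∑ j, A⁻¹ i j * w j = v i := by
  have : A⁻¹.mulVec w = v := by
    rw [← h, Matrix.mulVec_mulVec, Matrix.nonsing_inv_mul _ (isUnit_iff_ne_zero.2 hA),
      Matrix.one_mulVec]
  exact congrFun this i

theorem mulVec_of_eq_sum_inv {A : Matrix (Fin n) (Fin n) ℝ} (hA : A.det ≠ 0) {w : Fin n → ℝ} :
    A.mulVec (fun i => ∑ j, A⁻¹ i j * w j) = w := by
  have : (fun i => ∑ j, A⁻¹ i j * w j) = A⁻¹.mulVec w := rfl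
  rw [this, Matrix.mulVec_mulVec, Matrix.mul_nonsing_inv _ (isUnit_iff_ne_zero.2 hA),
      Matrix.one_mulVec]

theorem chartMetric_of_eq_sum_inv (ha : IsPseudoRiemannianMetric a)
    (hφ : φ ∈ IsManifold.maximalAtlas (𝓡 n) ∞ M) {x : Coord n} (hx : x ∈ φ.target)
    (f : Coord n →L[ℝ] ℝ) (v : Coord n)
    (hv : ∀ i, v i = ∑ j, invMetricComp a φ i j x * f (EuclideanSpace.single j 1)) (z : Coord n) :
    chartMetric a φ x v z = f z := by
  rw [chartMetric_symm ha, ← ContinuousLinearMap.flip_apply, ← sum_mul_apply_single _ z,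
    ← sum_mul_apply_single f z]
  refine Finset.sum_congr rfl fun i _ => ?_
  rw [ContinuousLinearMap.flip_apply, ← metricMatrix_mulVec]
  have h1 : (v : Fin n → ℝ) = fun i => ∑ j, (metricMatrix a φ x)⁻¹ i j *
      f (EuclideanSpace.single j 1) := funext hv
  rw [h1, mulVec_of_eq_sum_inv (det_metricMatrix_ne_zero ha hφ hx)]

theorem chartMetric_dualVec (ha : IsPseudoRiemannianMetric a)
    (hφ : φ ∈ IsManifold.maximalAtlas (𝓡 n) ∞ M) {x : Coord n} (hx : x ∈ φ.target)
    (z : Coord n) : chartMetric a φ x (dualVec a b φ x) z = chartForm b φ x z :=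
  chartMetric_of_eq_sum_inv ha hφ hx _ _ (fun _ => rfl) z

theorem eq_dualVec (ha : IsPseudoRiemannianMetric a)
    (hφ : φ ∈ IsManifold.maximalAtlas (𝓡 n) ∞ M) {x : Coord n} (hx : x ∈ φ.target)
    {v : Coord n} (hv : ∀ z, chartMetric a φ x v z = chartForm b φ x z) :
    v = dualVec a b φ x := by
  rw [← sub_eq_zero]
  refine chartMetric_nondegenerate ha hφ hx fun z => ?_
  rw [map_sub, sub_apply, hv, chartMetric_dualVec ha hφ hx, sub_self]

theorem normSq_eq (a : BilinField n M) (b : CovectorField n M)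
    (φ : OpenPartialHomeomorph M (Coord n)) (x : Coord n) :
    normSq a b φ x = chartForm b φ x (dualVec a b φ x) := by
  rw [← sum_mul_apply_single (chartForm b φ x)]
  refine Finset.sum_congr rfl fun i _ => ?_
  simp only [dualVec, Finset.sum_mul, ← formComp_eq]
  exact Finset.sum_congr rfl fun j _ => by ring

theorem differentiableAt_chartMetric (ha : IsPseudoRiemannianMetric a)
    (hφ : φ ∈ IsManifold.maximalAtlas (𝓡 n) ∞ M) {x : Coord n} (hx : x ∈ φ.target) :
    DifferentiableAt ℝ (chartMetric a φ) x :=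
  ((contDiffOn_chartMetric ha hφ).contDiffAt (φ.open_target.mem_nhds hx)).differentiableAt
    (by simp)

theorem differentiableAt_chartForm (hb : IsSmoothForm b)
    (hφ : φ ∈ IsManifold.maximalAtlas (𝓡 n) ∞ M) {x : Coord n} (hx : x ∈ φ.target) :
    DifferentiableAt ℝ (chartForm b φ) x :=
  ((contDiffOn_chartForm hb hφ).contDiffAt (φ.open_target.mem_nhds hx)).differentiableAt
    (by simp)

theorem pd_metricComp (ha : IsPseudoRiemannianMetric a)
    (hφ : φ ∈ IsManifold.maximalAtlas (𝓡 n) ∞ M) {x : Coord n} (hx : x ∈ φ.target)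
    (i j k : Fin n) : pd i (metricComp a φ j k) x = fderiv ℝ (chartMetric a φ) x
      (EuclideanSpace.single i 1) (EuclideanSpace.single j 1) (EuclideanSpace.single k 1) :=
  fderiv_apply_apply (differentiableAt_chartMetric ha hφ hx) _ _ _

theorem pd_formComp (hb : IsSmoothForm b)
    (hφ : φ ∈ IsManifold.maximalAtlas (𝓡 n) ∞ M) {x : Coord n} (hx : x ∈ φ.target)
    (i j : Fin n) : pd i (formComp b φ j) x = fderiv ℝ (chartForm b φ) x
      (EuclideanSpace.single i 1) (EuclideanSpace.single j 1) :=
  fderiv_clm_apply_const (differentiableAt_chartForm hb hφ hx) _ _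

theorem fderiv_chartForm_symm (hb : IsSmoothForm b) (hclosed : IsClosedForm b)
    (hφ : φ ∈ IsManifold.maximalAtlas (𝓡 n) ∞ M) {x : Coord n} (hx : x ∈ φ.target)
    (y z : Coord n) : fderiv ℝ (chartForm b φ) x y z = fderiv ℝ (chartForm b φ) x z y := by
  have h : fderiv ℝ (chartForm b φ) x = (fderiv ℝ (chartForm b φ) x).flip := bilin_ext fun i j => by
    rw [ContinuousLinearMap.flip_apply, ← pd_formComp hb hφ hx, ← pd_formComp hb hφ hx]
    exact hclosed φ hφ x hx i j
  exact congrArg (fun f : Coord n →L[ℝ] Coord n →L[ℝ] ℝ => f y z) h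

theorem fderiv_chartMetric_symm (ha : IsPseudoRiemannianMetric a)
    (hφ : φ ∈ IsManifold.maximalAtlas (𝓡 n) ∞ M) {x : Coord n} (hx : x ∈ φ.target)
    (v y z : Coord n) :
    fderiv ℝ (chartMetric a φ) x v y z = fderiv ℝ (chartMetric a φ) x v z y :=
  fderiv_symm_of_eventually_symm (differentiableAt_chartMetric ha hφ hx)
    (Eventually.of_forall fun x' => chartMetric_symm ha φ x') v y z

theorem chartHess_symm (ha : IsPseudoRiemannianMetric a) (hb : IsSmoothForm b)
    (hclosed : IsClosedForm b) (hφ : φ ∈ IsManifold.maximalAtlas (𝓡 n) ∞ M) {x : Coord n}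
    (hx : x ∈ φ.target) (y z : Coord n) : chartHess a b φ x y z = chartHess a b φ x z y := by
  unfold chartHess formHess
  rw [fderiv_chartForm_symm hb hclosed hφ hx y z, fderiv_chartMetric_symm ha hφ hx _ y z]
  ring

/-- In `Γ^k_ji b_k` the inverse metric, which is symmetric, raises the index of `b`, so the
Christoffel bracket is evaluated on the dual vector. -/
theorem covDeriv_eq (ha : IsPseudoRiemannianMetric a) (hb : IsSmoothForm b)
    (hφ : φ ∈ IsManifold.maximalAtlas (𝓡 n) ∞ M) {x : Coord n} (hx : x ∈ φ.target)
    (j i : Fin n) : covDeriv a b φ j i x =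
      chartHess a b φ x (EuclideanSpace.single j 1) (EuclideanSpace.single i 1) := by
  have hinv : ∀ k l, invMetricComp a φ k l x = invMetricComp a φ l k x := by
    intro k l
    have h1 : ((metricMatrix a φ x)⁻¹).transpose = (metricMatrix a φ x)⁻¹ := by
      rw [Matrix.transpose_nonsing_inv, metricMatrix_isSymm ha]
    exact congrFun (congrFun h1 l) k
  set D := fderiv ℝ (chartMetric a φ) x with hD
  let ej : Coord n := EuclideanSpace.single j 1
  let ei : Coord n := EuclideanSpace.single i 1
  let f : Coord n →L[ℝ] ℝ := D ej ei + D ei ej - (D.flip ej).flip ei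
  have hf : ∑ k, christoffel a φ k j i x * formComp b φ k x = 1 / 2 * f (dualVec a b φ x) := by
    rw [← sum_mul_apply_single f, Finset.mul_sum]
    simp only [christoffel, dualVec, pd_metricComp ha hφ hx, ← hD, Finset.sum_mul, Finset.mul_sum]
    rw [Finset.sum_comm]
    refine Finset.sum_congr rfl fun l _ => Finset.sum_congr rfl fun k _ => ?_
    rw [hinv k l]
    simp [f, ej, ei]
    ring
  rw [covDeriv, hf, pd_formComp hb hφ hx]
  simp [chartHess, formHess, f, ej, ei, hD]

/-- Lowering the index removes the inverse metric, and contraction with `y` twice makes the first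
two terms of the Christoffel bracket equal. -/
theorem chartMetric_christoffelVec (ha : IsPseudoRiemannianMetric a)
    (hφ : φ ∈ IsManifold.maximalAtlas (𝓡 n) ∞ M) {x : Coord n} (hx : x ∈ φ.target)
    (y z : Coord n) : chartMetric a φ x (christoffelVec a φ x y) z =
      fderiv ℝ (chartMetric a φ) x y y z - 1 / 2 * fderiv ℝ (chartMetric a φ) x z y y := by
  set D := fderiv ℝ (chartMetric a φ) x with hD
  let f : Coord n →L[ℝ] ℝ := D y y - (1 / 2 : ℝ) • (D.flip y).flip y
  refine (chartMetric_of_eq_sum_inv ha hφ hx f _ (fun i => ?_) z).trans (by simp [f])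
  simp only [christoffelVec, christoffel, pd_metricComp ha hφ hx, ← hD]
  have e1 : ∀ l : Fin n, ∑ j, ∑ k, y j * (y k * D (EuclideanSpace.single j 1)
      (EuclideanSpace.single k 1) (EuclideanSpace.single l 1)) =
      D y y (EuclideanSpace.single l 1) := by
    intro l
    have h1 := fun j => sum_mul_apply_single
      ((D (EuclideanSpace.single j 1)).flip (EuclideanSpace.single l 1)) y
    have h2 := sum_mul_apply_single ((D.flip y).flip (EuclideanSpace.single l 1)) y
    simp only [ContinuousLinearMap.flip_apply] at h1 h2
    rw [← h2]
    exact Finset.sum_congr rfl fun j _ => by rw [← Finset.mul_sum, h1]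
  have e2 : ∀ l : Fin n, ∑ j, ∑ k, y j * (y k * D (EuclideanSpace.single k 1)
      (EuclideanSpace.single j 1) (EuclideanSpace.single l 1)) =
      D y y (EuclideanSpace.single l 1) := by
    intro l
    rw [← e1, Finset.sum_comm]
    exact Finset.sum_congr rfl fun j _ => Finset.sum_congr rfl fun k _ => by ring
  have e3 : ∀ l : Fin n, ∑ j, ∑ k, y j * (y k * D (EuclideanSpace.single l 1)
      (EuclideanSpace.single j 1) (EuclideanSpace.single k 1)) =
      D (EuclideanSpace.single l 1) y y := by
    intro l
    have h1 := fun j => sum_mul_apply_single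
      (D (EuclideanSpace.single l 1) (EuclideanSpace.single j 1)) y
    have h2 := sum_mul_apply_single ((D (EuclideanSpace.single l 1)).flip y) y
    simp only [ContinuousLinearMap.flip_apply] at h1 h2
    rw [← h2]
    exact Finset.sum_congr rfl fun j _ => by rw [← Finset.mul_sum, h1]
  have e4 : ∀ l : Fin n, f (EuclideanSpace.single l 1) = 1 / 2 * ∑ j, ∑ k, (y j * (y k *
      D (EuclideanSpace.single j 1) (EuclideanSpace.single k 1) (EuclideanSpace.single l 1))
      + y j * (y k *
      D (EuclideanSpace.single k 1) (EuclideanSpace.single j 1) (EuclideanSpace.single l 1))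
      - y j * (y k *
      D (EuclideanSpace.single l 1) (EuclideanSpace.single j 1) (EuclideanSpace.single k 1))) := by
    intro l
    simp only [Finset.sum_sub_distrib, Finset.sum_add_distrib, e1, e2, e3]
    simp [f]
    ring
  simp only [e4, Finset.mul_sum, Finset.sum_mul]
  rw [Finset.sum_comm_cycle]
  refine Finset.sum_congr rfl fun l _ => Finset.sum_congr rfl fun j _ =>
    Finset.sum_congr rfl fun k _ => ?_
  ring

theorem chartHess_self (ha : IsPseudoRiemannianMetric a)
    (hφ : φ ∈ IsManifold.maximalAtlas (𝓡 n) ∞ M) {x : Coord n} (hx : x ∈ φ.target)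
    (y : Coord n) : chartHess a b φ x y y =
      fderiv ℝ (chartForm b φ) x y y - chartForm b φ x (christoffelVec a φ x y) := by
  rw [← chartMetric_dualVec ha hφ hx, chartMetric_symm ha, chartMetric_christoffelVec ha hφ hx]
  unfold chartHess formHess
  ring

theorem chartMetric_fderiv_dualVec (ha : IsPseudoRiemannianMetric a)
    {ψ : OpenPartialHomeomorph M (Coord n)}
    (hφ : φ ∈ IsManifold.maximalAtlas (𝓡 n) ∞ M)
    (hψ : ψ ∈ IsManifold.maximalAtlas (𝓡 n) ∞ M) {x : Coord n} (hx : x ∈ φ.target)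
    (hx' : φ.symm x ∈ ψ.source) (z : Coord n) :
    chartMetric a ψ (ψ (φ.symm x)) (fderiv ℝ (fun y => ψ (φ.symm y)) x (dualVec a b φ x)) z =
      chartForm b ψ (ψ (φ.symm x)) z := by
  -- It then suffices to test on vectors of the form `Dτ z`, where the transformation rules apply.
  have hsurj : Function.Surjective (fderiv ℝ (fun y => ψ (φ.symm y)) x) := by
    intro w
    obtain ⟨v, hv⟩ := (bijective_coordVec hφ hx).2 (coordVec ψ (ψ (φ.symm x)) w)
    refine ⟨v, (bijective_coordVec hψ (ψ.map_source hx')).1 ?_⟩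
    rw [← hv]
    exact (coordVec_transition hφ hψ hx hx' v).symm
  obtain ⟨z, rfl⟩ := hsurj z
  rw [← chartMetric_transition a hφ hψ hx hx', ← chartForm_transition b hφ hψ hx hx',
    chartMetric_dualVec ha hφ hx]

theorem fderiv_transition_dualVec (ha : IsPseudoRiemannianMetric a)
    {ψ : OpenPartialHomeomorph M (Coord n)}
    (hφ : φ ∈ IsManifold.maximalAtlas (𝓡 n) ∞ M)
    (hψ : ψ ∈ IsManifold.maximalAtlas (𝓡 n) ∞ M) {x : Coord n} (hx : x ∈ φ.target)
    (hx' : φ.symm x ∈ ψ.source) :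
    fderiv ℝ (fun y => ψ (φ.symm y)) x (dualVec a b φ x) = dualVec a b ψ (ψ (φ.symm x)) :=
  eq_dualVec ha hψ (ψ.map_source hx') (chartMetric_fderiv_dualVec ha hφ hψ hx hx')

theorem chartHess_transition (ha : IsPseudoRiemannianMetric a) (hb : IsSmoothForm b)
    {ψ : OpenPartialHomeomorph M (Coord n)}
    (hφ : φ ∈ IsManifold.maximalAtlas (𝓡 n) ∞ M)
    (hψ : ψ ∈ IsManifold.maximalAtlas (𝓡 n) ∞ M) {x : Coord n} (hx : x ∈ φ.target)
    (hx' : φ.symm x ∈ ψ.source) (y z : Coord n) :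
    chartHess a b φ x y z = chartHess a b ψ (ψ (φ.symm x))
      (fderiv ℝ (fun y => ψ (φ.symm y)) x y) (fderiv ℝ (fun y => ψ (φ.symm y)) x z) := by
  have hψx : ψ (φ.symm x) ∈ ψ.target := ψ.map_source hx'
  have h := formHess_pullback (contDiffAt_transition hφ hψ hx hx')
    (differentiableAt_chartMetric ha hψ hψx) (differentiableAt_chartForm hb hψ hψx)
    (chartMetric_symm ha ψ _)
    ((eventually_symm_mem_source hx hx').mono fun x' h =>
      chartMetric_transition a hφ hψ h.1 h.2)
    ((eventually_symm_mem_source hx hx').mono fun x' h =>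
      chartForm_transition b hφ hψ h.1 h.2)
    (differentiableAt_chartMetric ha hφ hx) (differentiableAt_chartForm hb hφ hx)
    (chartMetric_fderiv_dualVec ha hφ hψ hx hx') y z
  refine h.trans ?_
  rw [fderiv_transition_dualVec ha hφ hψ hx hx']
  rfl

/-- Cramer's rule: an entry of the inverse is a quotient of determinants with smooth entries. -/
theorem contDiffOn_invMetricComp (ha : IsPseudoRiemannianMetric a)
    (hφ : φ ∈ IsManifold.maximalAtlas (𝓡 n) ∞ M) (i j : Fin n) :
    ContDiffOn ℝ ∞ (invMetricComp a φ i j) φ.target := by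
  have hdet : ∀ A : Coord n → Matrix (Fin n) (Fin n) ℝ,
      (∀ i j, ContDiffOn ℝ ∞ (fun x => A x i j) φ.target) →
      ContDiffOn ℝ ∞ (fun x => (A x).det) φ.target := by
    intro A hA
    simp only [Matrix.det_apply']
    exact ContDiffOn.sum fun σ _ => contDiffOn_const.mul (contDiffOn_prod fun k _ => hA _ _)
  have h : ∀ x, invMetricComp a φ i j x = ((metricMatrix a φ x).det)⁻¹ *
      ((metricMatrix a φ x).updateRow j (Pi.single i 1)).det := by
    intro x
    have : invMetricComp a φ i j x = (metricMatrix a φ x)⁻¹ i j := rfl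
    rw [this, Matrix.inv_def, Matrix.smul_apply, Matrix.adjugate_apply, Ring.inverse_eq_inv',
      smul_eq_mul]
  simp only [funext h]
  refine ((hdet _ fun i j => ha.smooth φ hφ i j).inv
    fun x hx => det_metricMatrix_ne_zero ha hφ hx).mul (hdet _ fun k l => ?_)
  by_cases hk : k = j
  · subst hk
    simp only [Matrix.updateRow_self]
    exact contDiffOn_const
  · simp only [Matrix.updateRow_ne hk]
    exact ha.smooth φ hφ k l

theorem contDiffOn_dualVec (ha : IsPseudoRiemannianMetric a) (hb : IsSmoothForm b)
    (hφ : φ ∈ IsManifold.maximalAtlas (𝓡 n) ∞ M) :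
    ContDiffOn ℝ ∞ (dualVec a b φ) φ.target := by
  rw [contDiffOn_euclidean]
  intro i
  change ContDiffOn ℝ ∞ (fun x => ∑ j, invMetricComp a φ i j x * formComp b φ j x) _
  exact ContDiffOn.sum fun j _ => (contDiffOn_invMetricComp ha hφ i j).mul (hb φ hφ j)

theorem contDiffOn_pd {f : Coord n → ℝ} {s : Set (Coord n)} (hs : IsOpen s)
    (hf : ContDiffOn ℝ ∞ f s) (i : Fin n) : ContDiffOn ℝ ∞ (pd i f) s :=
  (hf.fderiv_of_isOpen hs (by simp)).clm_apply contDiffOn_const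

theorem contDiffOn_christoffel (ha : IsPseudoRiemannianMetric a)
    (hφ : φ ∈ IsManifold.maximalAtlas (𝓡 n) ∞ M) (k i j : Fin n) :
    ContDiffOn ℝ ∞ (christoffel a φ k i j) φ.target :=
  contDiffOn_const.mul (ContDiffOn.sum fun l _ => (contDiffOn_invMetricComp ha hφ k l).mul
    (((contDiffOn_pd φ.open_target (ha.smooth φ hφ j l) i).add
      (contDiffOn_pd φ.open_target (ha.smooth φ hφ i l) j)).sub
      (contDiffOn_pd φ.open_target (ha.smooth φ hφ i j) l)))

theorem contDiffOn_covDeriv (ha : IsPseudoRiemannianMetric a) (hb : IsSmoothForm b)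
    (hφ : φ ∈ IsManifold.maximalAtlas (𝓡 n) ∞ M) (j i : Fin n) :
    ContDiffOn ℝ ∞ (covDeriv a b φ j i) φ.target :=
  (contDiffOn_pd φ.open_target (hb φ hφ i) j).sub
    (ContDiffOn.sum fun k _ => (contDiffOn_christoffel ha hφ k j i).mul (hb φ hφ k))

end ChartTensors

/-! ### Scalar identities for `F²` as a function of `α²` and `β` -/

section Powers

variable {E : Type*} [NormedAddCommGroup E] [NormedSpace ℝ E]

/-- `α` is the root of a positive number and `β^(-m)` is meaningful. -/
def IsAdmissible (m A s : ℝ) : Prop := 0 < A ∧ (0 < s ∨ (s ≠ 0 ∧ ∃ k : ℤ, m = k))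

theorem IsAdmissible.ne_zero {m A s : ℝ} (h : IsAdmissible m A s) : s ≠ 0 :=
  h.2.elim (fun h => h.ne') fun h => h.1

theorem IsAdmissible.eventually {X : Type*} [TopologicalSpace X] {m : ℝ} {A s : X → ℝ} {x : X}
    (hA : ContinuousAt A x) (hs : ContinuousAt s x) (h : IsAdmissible m (A x) (s x)) :
    ∀ᶠ x' in 𝓝 x, IsAdmissible m (A x') (s x') := by
  have h1 := hA.eventually (lt_mem_nhds h.1)
  rcases h.2 with h2 | ⟨h2, h3⟩
  · filter_upwards [h1, hs.eventually (lt_mem_nhds h2)] with x' h1 h2 using ⟨h1, Or.inl h2⟩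
  · filter_upwards [h1, hs.eventually_ne h2] with x' h1 h2 using ⟨h1, Or.inr ⟨h2, h3⟩⟩

/-- The square of the `m`-Kropina function, as a function of `α²` and `β`. -/
noncomputable def kropinaSq (m A s : ℝ) : ℝ := A ^ (1 + m) * (s ^ 2) ^ (-m)

/-- Writing the second factor as a power of `s ^ 2 > 0` covers at once `β > 0` and `β < 0` with
integral `m`, and is differentiable for all `s ≠ 0`. -/
theorem sq_kropina {m A s : ℝ} (h : IsAdmissible m A s) :
    (Real.sqrt A ^ (1 + m) * s ^ (-m)) ^ 2 = kropinaSq m A s := by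
  have h1 : (Real.sqrt A ^ (1 + m)) ^ 2 = A ^ (1 + m) := by
    rw [Real.sqrt_eq_rpow, ← Real.rpow_mul h.1.le, ← Real.rpow_natCast, ← Real.rpow_mul h.1.le]
    congr 1
    push_cast
    ring
  have h2 : (s ^ (-m)) ^ 2 = (s ^ 2) ^ (-m) := by
    rcases h.2 with h2 | ⟨h2, k, rfl⟩
    · rw [← Real.rpow_natCast (s ^ (-m)), ← Real.rpow_natCast s, ← Real.rpow_mul h2.le,
        ← Real.rpow_mul h2.le, mul_comm]
    · have e : (-(k : ℝ)) = ((-k : ℤ) : ℝ) := by push_cast; ring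
      rw [e, Real.rpow_intCast, Real.rpow_intCast, ← zpow_natCast, ← zpow_natCast, ← zpow_mul,
        ← zpow_mul, mul_comm]
  rw [mul_pow, h1, h2, kropinaSq]

theorem hasFDerivAt_kropinaSq {m : ℝ} {A s : E → ℝ} {A' s' : E →L[ℝ] ℝ} {x : E}
    (hA : HasFDerivAt A A' x) (hs : HasFDerivAt s s' x) (hA0 : 0 < A x) (hs0 : s x ≠ 0) :
    HasFDerivAt (fun x => kropinaSq m (A x) (s x))
      (kropinaSq m (A x) (s x) • (((1 + m) / A x) • A' - (2 * m / s x) • s')) x := by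
  have hs2 : 0 < s x ^ 2 := by positivity
  have h := (hA.rpow_const (p := 1 + m) (Or.inl hA0.ne')).mul
    ((hs.pow 2).rpow_const (p := -m) (Or.inl hs2.ne'))
  refine h.congr_fderiv ?_
  ext v
  simp only [kropinaSq, add_apply, smul_apply, sub_apply, smul_eq_mul,
    Real.rpow_sub_one hA0.ne', Real.rpow_sub_one hs2.ne']
  field_simp
  norm_num
  ring

theorem hasFDerivAt_quotient {f g : E → ℝ} {f' g' : E →L[ℝ] ℝ} {x : E}
    (hf : HasFDerivAt f f' x) (hg : HasFDerivAt g g' x) (h0 : g x ≠ 0) :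
    HasFDerivAt (fun x => f x / g x) ((1 / g x) • f' - (f x / g x ^ 2) • g') x := by
  have h : HasFDerivAt (fun x => f x * (g x)⁻¹) _ x :=
    hf.mul ((hasDerivAt_inv h0).comp_hasFDerivAt x hg)
  simp only [div_eq_mul_inv]
  refine h.congr_fderiv ?_
  ext v
  simp only [add_apply, smul_apply, sub_apply, smul_eq_mul]
  ring

/-- Differentiability is not needed: for `c ≠ 0` multiplication by `c` is invertible, and for `c =
0` both sides vanish. -/
theorem fderiv_real_mul (c : ℝ) (f : E → ℝ) (x : E) :
    fderiv ℝ (fun y => c * f y) x = c • fderiv ℝ f x := by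
  by_cases hc : c = 0
  · simp [hc]
  · have := invertibleOfNonzero hc
    exact fderiv_const_smul_of_invertible (f := f) c

/-- The derivative of a first derivative of `F²`. -/
noncomputable def kropinaSnd (m A s P Q A' s' P' Q' : ℝ) : ℝ :=
  kropinaSq m A s * ((2 * (1 + m) * P / A - 2 * m * Q / s) * ((1 + m) * A' / A - 2 * m * s' / s)
    + 2 * (1 + m) * (P' / A - P * A' / A ^ 2) - 2 * m * (Q' / s - Q * s' / s ^ 2))

/-- The functions `P` and `Q` stand for `a(y, e_k)` and `b(e_k)`. The space `E` is arbitrary so that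
the formula serves for derivatives both in `x` and in `y`. -/
theorem hasFDerivAt_kropinaFst {m : ℝ} {A s P Q : E → ℝ} {A' s' P' Q' : E →L[ℝ] ℝ} {x : E}
    (hA : HasFDerivAt A A' x) (hs : HasFDerivAt s s' x) (hP : HasFDerivAt P P' x)
    (hQ : HasFDerivAt Q Q' x) (hA0 : 0 < A x) (hs0 : s x ≠ 0) :
    ∃ T : E →L[ℝ] ℝ, HasFDerivAt (fun x => kropinaSq m (A x) (s x) *
        (2 * (1 + m) * P x / A x - 2 * m * Q x / s x)) T x ∧
      ∀ v, T v = kropinaSnd m (A x) (s x) (P x) (Q x) (A' v) (s' v) (P' v) (Q' v) := by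
  have h1 := (hasFDerivAt_quotient (hP.const_mul (2 * (1 + m))) hA hA0.ne').sub
    (hasFDerivAt_quotient (hQ.const_mul (2 * m)) hs hs0)
  refine ⟨_, (hasFDerivAt_kropinaSq hA hs hA0 hs0).mul h1, fun v => ?_⟩
  simp only [kropinaSnd, add_apply, smul_apply, sub_apply, smul_eq_mul]
  field_simp
  ring

/-- Symmetry of the second `y`-derivative of `F²`: in direction `v` the derivative of `α²` is `2
a(y, v)`, whence the factors 2. -/
theorem kropinaSnd_symm (m A s P Q A' s' P' : ℝ) :
    kropinaSnd m A s P Q (2 * A') s' P' 0 = kropinaSnd m A s A' s' (2 * P) Q P' 0 := by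
  unfold kropinaSnd
  ring

/-- The scalar core of the spray formula. The left side is `y^l ∂_l ∂̄_k F² - ∂_k F²`, with the same
`Z` in both terms because `b` is closed. The right side is `∂̄_k F²` differentiated along the
proposed spray, with `h = ∇b(y, y)`; the entries `-A / s` and `-2` are the pairings of `-(2/β) y +
(A/β²) B` with `y` and with `b`, the second using `b(B) = 0`. -/
theorem kropinaSnd_spray {m A s : ℝ} (P Q a' b' X Y Z h : ℝ) (hA : A ≠ 0) (hs : s ≠ 0)
    (hm : 1 - m ≠ 0) :
    kropinaSnd m A s P Q a' b' X Z
        - kropinaSq m A s * ((1 + m) * Y / A - 2 * m * Z / s) =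
      kropinaSnd m A s P Q (2 * (1 / 2 * a' + m * h / (1 - m) * (-A / s)))
        (b' - h + m * h / (1 - m) * (-2))
        (X - 1 / 2 * Y + m * h / (1 - m) * (-2 / s * P + A / s ^ 2 * Q)) 0 := by
  unfold kropinaSnd
  generalize kropinaSq m A s = L
  field_simp
  ring

/-- For `m = 1` the vector `-(2/β) y + (A/β²) B` is in the kernel of the fundamental tensor. -/
theorem kropinaSnd_degenerate {A s : ℝ} (P Q : ℝ) (hA : A ≠ 0) (hs : s ≠ 0) :
    kropinaSnd 1 A s P Q (2 * (-A / s)) (-2) (-2 / s * P + A / s ^ 2 * Q) 0 = 0 := by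
  unfold kropinaSnd
  field_simp
  ring

end Powers

/-! ### The spray and the Cartan connection of an `m`-Kropina metric -/

section Finsler

variable {n : ℕ} {M : Type*} [TopologicalSpace M] [ChartedSpace (Coord n) M]
  {m : ℝ} {a : BilinField n M} {b : CovectorField n M}
  {φ : OpenPartialHomeomorph M (Coord n)} {x y : Coord n}

/-- `α² > 0` and `β` admit the `m`-Kropina function at the point `(x, y)` of the chart `φ`. -/
def IsAdmissibleAt (m : ℝ) (a : BilinField n M) (b : CovectorField n M)
    (φ : OpenPartialHomeomorph M (Coord n)) (x y : Coord n) : Prop :=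
  IsAdmissible m (chartMetric a φ x y y) (chartForm b φ x y)

theorem IsAdmissibleAt.eventually_snd (h : IsAdmissibleAt m a b φ x y) :
    ∀ᶠ y' in 𝓝 y, IsAdmissibleAt m a b φ x y' :=
  IsAdmissible.eventually (A := fun y => chartMetric a φ x y y) (s := fun y => chartForm b φ x y)
    (by fun_prop) (by fun_prop) h

theorem sqCoord_eq (h : IsAdmissibleAt m a b φ x y) :
    sqCoord (kropina m a b) φ x y =
      kropinaSq m (chartMetric a φ x y y) (chartForm b φ x y) := sq_kropina h

theorem hasFDerivAt_chartMetric_self (hs : ∀ y z, chartMetric a φ x y z = chartMetric a φ x z y)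
    (y : Coord n) : HasFDerivAt (fun y => chartMetric a φ x y y)
      ((2 : ℝ) • chartMetric a φ x y) y := by
  have h := (chartMetric a φ x).hasFDerivAt (x := y) |>.clm_apply (hasFDerivAt_id y)
  refine h.congr_fderiv ?_
  ext v
  simp [hs v y]
  ring

variable [IsManifold (𝓡 n) ∞ M]

theorem IsAdmissibleAt.eventually_fst (ha : IsPseudoRiemannianMetric a) (hb : IsSmoothForm b)
    (hφ : φ ∈ IsManifold.maximalAtlas (𝓡 n) ∞ M) (hx : x ∈ φ.target)
    (h : IsAdmissibleAt m a b φ x y) : ∀ᶠ x' in 𝓝 x, IsAdmissibleAt m a b φ x' y := by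
  have h1 := (differentiableAt_chartMetric ha hφ hx).continuousAt
  have h2 := (differentiableAt_chartForm hb hφ hx).continuousAt
  exact IsAdmissible.eventually (A := fun x => chartMetric a φ x y y)
    (s := fun x => chartForm b φ x y) (by fun_prop) (by fun_prop) h

theorem pdy_sqCoord (ha : IsPseudoRiemannianMetric a) (h : IsAdmissibleAt m a b φ x y)
    (k : Fin n) : pdy k (sqCoord (kropina m a b) φ) x y =
      kropinaSq m (chartMetric a φ x y y) (chartForm b φ x y) *
        (2 * (1 + m) * chartMetric a φ x y (EuclideanSpace.single k 1) / chartMetric a φ x y y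
        - 2 * m * chartForm b φ x (EuclideanSpace.single k 1) / chartForm b φ x y) := by
  have he : (fun y' => sqCoord (kropina m a b) φ x y') =ᶠ[𝓝 y] fun y' =>
      kropinaSq m (chartMetric a φ x y' y') (chartForm b φ x y') :=
    h.eventually_snd.mono fun y' h' => sqCoord_eq h'
  have hd := hasFDerivAt_kropinaSq (m := m)
    (hasFDerivAt_chartMetric_self (chartMetric_symm ha φ x) y) (chartForm b φ x).hasFDerivAt h.1 h.ne_zero
  rw [pdy, pd, he.fderiv_eq, hd.fderiv]
  simp only [smul_apply, sub_apply, smul_eq_mul]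
  ring

theorem pdx_sqCoord (ha : IsPseudoRiemannianMetric a) (hb : IsSmoothForm b)
    (hφ : φ ∈ IsManifold.maximalAtlas (𝓡 n) ∞ M) (hx : x ∈ φ.target)
    (h : IsAdmissibleAt m a b φ x y)
    (k : Fin n) : pdx k (sqCoord (kropina m a b) φ) x y =
      kropinaSq m (chartMetric a φ x y y) (chartForm b φ x y) *
        ((1 + m) * fderiv ℝ (chartMetric a φ) x (EuclideanSpace.single k 1) y y /
          chartMetric a φ x y y
        - 2 * m * fderiv ℝ (chartForm b φ) x (EuclideanSpace.single k 1) y /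
          chartForm b φ x y) := by
  have he : (fun x' => sqCoord (kropina m a b) φ x' y) =ᶠ[𝓝 x] fun x' =>
      kropinaSq m (chartMetric a φ x' y y) (chartForm b φ x' y) :=
    (h.eventually_fst ha hb hφ hx).mono fun y' h' => sqCoord_eq h'
  have hg := differentiableAt_chartMetric ha hφ hx
  have hf := differentiableAt_chartForm hb hφ hx
  have h1 : DifferentiableAt ℝ (fun x' => chartMetric a φ x' y y) x := by fun_prop
  have h2 : DifferentiableAt ℝ (fun x' => chartForm b φ x' y) x := by fun_prop
  have hd := hasFDerivAt_kropinaSq (m := m) h1.hasFDerivAt h2.hasFDerivAt h.1 h.ne_zero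
  rw [pdx, pd, he.fderiv_eq, hd.fderiv]
  simp only [smul_apply, sub_apply, smul_eq_mul, fderiv_apply_apply hg, fderiv_clm_apply_const hf]
  ring

/-- The second derivative `∂̄_k ∂̄_v F²`. -/
theorem fundTensor_mulVec (ha : IsPseudoRiemannianMetric a) (h : IsAdmissibleAt m a b φ x y)
    (v : Coord n) (i : Fin n) :
    (fundTensor (kropina m a b) φ x y).mulVec v i = 1 / 2 *
      kropinaSnd m (chartMetric a φ x y y) (chartForm b φ x y)
        (chartMetric a φ x y (EuclideanSpace.single i 1))
        (chartForm b φ x (EuclideanSpace.single i 1))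
        (2 * chartMetric a φ x y v) (chartForm b φ x v)
        (chartMetric a φ x v (EuclideanSpace.single i 1)) 0 := by
  have hT := fun k : Fin n => hasFDerivAt_kropinaFst (m := m)
    (hasFDerivAt_chartMetric_self (chartMetric_symm ha φ x) y)
    (chartForm b φ x).hasFDerivAt
    ((chartMetric a φ x).flip (EuclideanSpace.single k 1)).hasFDerivAt
    (hasFDerivAt_const (chartForm b φ x (EuclideanSpace.single k 1)) y) h.1 h.ne_zero
  choose T hT hT' using hT
  have hent : ∀ k j, fundTensor (kropina m a b) φ x y k j =
      1 / 2 * T j (EuclideanSpace.single k 1) := by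
    intro k j
    have he : (fun y' => pdy j (fun x' y' => 1 / 2 * sqCoord (kropina m a b) φ x' y') x y')
        =ᶠ[𝓝 y] fun y' => 1 / 2 * (kropinaSq m (chartMetric a φ x y' y') (chartForm b φ x y') *
          (2 * (1 + m) * (chartMetric a φ x).flip (EuclideanSpace.single j 1) y'
            / chartMetric a φ x y' y'
          - 2 * m * chartForm b φ x (EuclideanSpace.single j 1) / chartForm b φ x y')) := by
      filter_upwards [h.eventually_snd] with y' h'
      have h1 := pdy_sqCoord ha h' j
      rw [ContinuousLinearMap.flip_apply, ← h1]
      simp only [pdy, pd]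
      rw [fderiv_real_mul]
      rfl
    show pd k (fun y' => pdy j (fun x' y' => 1 / 2 * sqCoord (kropina m a b) φ x' y') x y') y = _
    rw [pd, he.fderiv_eq, ((hT j).const_mul (1 / 2)).fderiv]
    rfl
  -- The entry `(i, j)` differentiates in direction `j` first, so it is `T j` evaluated at `e_i`;
  -- symmetry is needed before summing over `j`.
  have hsymm : ∀ j, T j (EuclideanSpace.single i 1) = T i (EuclideanSpace.single j 1) := by
    intro j
    rw [hT', hT']
    simp only [smul_apply, smul_eq_mul, ContinuousLinearMap.flip_apply, zero_apply]
    rw [kropinaSnd_symm, chartMetric_symm ha φ x (EuclideanSpace.single i 1)]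
  have h1 : (fundTensor (kropina m a b) φ x y).mulVec v i = 1 / 2 * T i v := by
    rw [← sum_mul_apply_single (T i), Finset.mul_sum]
    change ∑ j, fundTensor (kropina m a b) φ x y i j * v j = _
    refine Finset.sum_congr rfl fun j _ => ?_
    rw [hent, hsymm]
    ring
  rw [h1, hT']
  simp [ContinuousLinearMap.flip_apply]

theorem sum_pdx_pdy_sqCoord (ha : IsPseudoRiemannianMetric a) (hb : IsSmoothForm b)
    (hφ : φ ∈ IsManifold.maximalAtlas (𝓡 n) ∞ M) (hx : x ∈ φ.target)
    (h : IsAdmissibleAt m a b φ x y) (k : Fin n) :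
    ∑ l, y l * pdx l (pdy k (sqCoord (kropina m a b) φ)) x y =
      kropinaSnd m (chartMetric a φ x y y) (chartForm b φ x y)
        (chartMetric a φ x y (EuclideanSpace.single k 1))
        (chartForm b φ x (EuclideanSpace.single k 1))
        (fderiv ℝ (chartMetric a φ) x y y y) (fderiv ℝ (chartForm b φ) x y y)
        (fderiv ℝ (chartMetric a φ) x y y (EuclideanSpace.single k 1))
        (fderiv ℝ (chartForm b φ) x y (EuclideanSpace.single k 1)) := by
  have hg := differentiableAt_chartMetric ha hφ hx
  have hf := differentiableAt_chartForm hb hφ hx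
  have h1 : DifferentiableAt ℝ (fun x' => chartMetric a φ x' y y) x := by fun_prop
  have h2 : DifferentiableAt ℝ (fun x' => chartForm b φ x' y) x := by fun_prop
  have h3 : DifferentiableAt ℝ
    (fun x' => chartMetric a φ x' y (EuclideanSpace.single k 1)) x := by fun_prop
  have h4 : DifferentiableAt ℝ
    (fun x' => chartForm b φ x' (EuclideanSpace.single k 1)) x := by fun_prop
  obtain ⟨T, hT, hT'⟩ := hasFDerivAt_kropinaFst (m := m) h1.hasFDerivAt h2.hasFDerivAt
    h3.hasFDerivAt h4.hasFDerivAt h.1 h.ne_zero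
  have he : (fun x' => pdy k (sqCoord (kropina m a b) φ) x' y) =ᶠ[𝓝 x] _ :=
    (h.eventually_fst ha hb hφ hx).mono fun x' h' => pdy_sqCoord ha h' k
  have h5 : ∀ l, pdx l (pdy k (sqCoord (kropina m a b) φ)) x y =
      T (EuclideanSpace.single l 1) := by
    intro l
    rw [pdx, pd, he.fderiv_eq, hT.fderiv]
  simp only [h5, sum_mul_apply_single]
  simp only [hT', fderiv_apply_apply hg, fderiv_clm_apply_const hf]

/-- Half the spray coefficients of the `m`-Kropina space, for a closed null form `b`. -/
noncomputable def kropinaSpray (m : ℝ) (a : BilinField n M) (b : CovectorField n M)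
    (φ : OpenPartialHomeomorph M (Coord n)) (x y : Coord n) : Coord n :=
  christoffelVec a φ x y + (m * chartHess a b φ x y y / (1 - m)) •
    ((-2 / chartForm b φ x y) • y +
      (chartMetric a φ x y y / chartForm b φ x y ^ 2) • dualVec a b φ x)

/-- The fundamental tensor is never inverted: it is applied to the proposed solution, whose pairings
with `y`, `b` and `e_k` reduce the claim to `kropinaSnd_spray`. Closedness gives `∂_k b(y) = ∂_y
b(e_k)`, nullity gives `b(B) = 0`. -/
theorem spray_eq (ha : IsPseudoRiemannianMetric a) (hb : IsSmoothForm b)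
    (hclosed : IsClosedForm b) (hnull : IsNullForm a b) (hm : 1 - m ≠ 0)
    (hφ : φ ∈ IsManifold.maximalAtlas (𝓡 n) ∞ M) (hx : x ∈ φ.target)
    (h : IsAdmissibleAt m a b φ x y) (hdet : (fundTensor (kropina m a b) φ x y).det ≠ 0)
    (i : Fin n) :
    ∑ k, (fundTensor (kropina m a b) φ x y)⁻¹ i k *
      ((∑ l, y l * pdx l (pdy k (sqCoord (kropina m a b) φ)) x y)
        - pdx k (sqCoord (kropina m a b) φ) x y) = 2 * kropinaSpray m a b φ x y i := by
  refine eq_of_mulVec_eq (v := fun i => 2 * kropinaSpray m a b φ x y i) hdet ?_ i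
  ext k
  have h0 : (fun i => 2 * kropinaSpray m a b φ x y i) =
    (((2 : ℝ) • kropinaSpray m a b φ x y : Coord n) : Fin n → ℝ) := rfl
  have hN : chartForm b φ x (dualVec a b φ x) = 0 := by
    rw [← normSq_eq]; exact hnull φ hφ x hx
  have hB := chartMetric_dualVec (b := b) ha hφ hx
  have hB' : ∀ z, chartMetric a φ x z (dualVec a b φ x) = chartForm b φ x z := fun z => by
    rw [chartMetric_symm ha, hB]
  have hΓ := chartMetric_christoffelVec ha hφ hx y
  have hΓ' : ∀ z, chartMetric a φ x z (christoffelVec a φ x y) = _ := fun z => by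
    rw [chartMetric_symm ha, hΓ]
  have hs := h.ne_zero
  have hA := h.1.ne'
  have hbΓ : chartForm b φ x (christoffelVec a φ x y) =
      fderiv ℝ (chartForm b φ) x y y - chartHess a b φ x y y := by
    rw [chartHess_self ha hφ hx]; ring
  rw [h0, sum_pdx_pdy_sqCoord ha hb hφ hx h, pdx_sqCoord ha hb hφ hx h,
    fderiv_chartForm_symm hb hclosed hφ hx (EuclideanSpace.single k 1) y,
    kropinaSnd_spray _ _ _ _ _ _ _ (chartHess a b φ x y y) hA hs hm]
  have h1 := fundTensor_mulVec ha h (kropinaSpray m a b φ x y) k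
  rw [WithLp.ofLp_smul, Matrix.mulVec_smul, Pi.smul_apply, h1, smul_eq_mul, ← mul_assoc]
  norm_num
  have e1 : chartMetric a φ x y (kropinaSpray m a b φ x y) =
      1 / 2 * fderiv ℝ (chartMetric a φ) x y y y + m * chartHess a b φ x y y / (1 - m) *
        (-chartMetric a φ x y y / chartForm b φ x y) := by
    simp only [kropinaSpray, map_add, map_smul, hB', hΓ', smul_eq_mul]
    field_simp
    ring
  have e2 : chartForm b φ x (kropinaSpray m a b φ x y) =
      fderiv ℝ (chartForm b φ) x y y - chartHess a b φ x y y
        + m * chartHess a b φ x y y / (1 - m) * (-2) := by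
    simp only [kropinaSpray, map_add, map_smul, hN, hbΓ, smul_eq_mul]
    field_simp
    ring
  have e3 : chartMetric a φ x (kropinaSpray m a b φ x y) (EuclideanSpace.single k 1) =
      fderiv ℝ (chartMetric a φ) x y y (EuclideanSpace.single k 1)
        - 1 / 2 * fderiv ℝ (chartMetric a φ) x (EuclideanSpace.single k 1) y y
        + m * chartHess a b φ x y y / (1 - m) *
        (-2 / chartForm b φ x y * chartMetric a φ x y (EuclideanSpace.single k 1)
          + chartMetric a φ x y y / chartForm b φ x y ^ 2 *
            chartForm b φ x (EuclideanSpace.single k 1)) := by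
    simp only [kropinaSpray, map_add, map_smul, add_apply, smul_apply, hB, hΓ, smul_eq_mul]
  rw [e1, e2, e3]
  norm_num

/-- For `m = 1` the vector `V = -(2/β) y + (A/β²) B` is annihilated by the fundamental tensor, and
it is not zero since `b(V) = -2`. -/
theorem ne_one_of_nondegenerate (ha : IsPseudoRiemannianMetric a)
    (hnull : IsNullForm a b)
    (hφ : φ ∈ IsManifold.maximalAtlas (𝓡 n) ∞ M) (hx : x ∈ φ.target)
    (h : IsAdmissibleAt m a b φ x y) (hdet : (fundTensor (kropina m a b) φ x y).det ≠ 0) :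
    m ≠ 1 := by
  rintro rfl
  have hN : chartForm b φ x (dualVec a b φ x) = 0 := by
    rw [← normSq_eq]; exact hnull φ hφ x hx
  have hB := chartMetric_dualVec (b := b) ha hφ hx
  have hB' : ∀ z, chartMetric a φ x z (dualVec a b φ x) = chartForm b φ x z := fun z => by
    rw [chartMetric_symm ha, hB]
  have hs := h.ne_zero
  have hA := h.1.ne'
  let V : Coord n := (-2 / chartForm b φ x y) • y +
      (chartMetric a φ x y y / chartForm b φ x y ^ 2) • dualVec a b φ x
  have hbV : chartForm b φ x V = -2 := by
    simp only [V, map_add, map_smul, hN, smul_eq_mul]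
    field_simp
    ring
  apply hdet
  refine Matrix.exists_mulVec_eq_zero_iff.1 ⟨V, fun hV => ?_, funext fun i => ?_⟩
  · have : V = 0 := by
      ext i
      exact congrFun hV i
    rw [this, map_zero] at hbV
    norm_num at hbV
  · have e1 : chartMetric a φ x y V = -chartMetric a φ x y y / chartForm b φ x y := by
      simp only [V, map_add, map_smul, hB', smul_eq_mul]
      field_simp
      ring
    rw [fundTensor_mulVec ha h, e1, hbV]
    simp only [V, map_add, map_smul, add_apply, smul_apply, hB, smul_eq_mul]
    rw [kropinaSnd_degenerate _ _ hA hs, mul_zero]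
    rfl

theorem cartanConn_eq (ha : IsPseudoRiemannianMetric a) (hb : IsSmoothForm b)
    (hclosed : IsClosedForm b) (hnull : IsNullForm a b) (hm : 1 - m ≠ 0)
    (hφ : φ ∈ IsManifold.maximalAtlas (𝓡 n) ∞ M) (hx : x ∈ φ.target)
    (h : ∀ᶠ y' in 𝓝 y, IsAdmissibleAt m a b φ x y' ∧
      (fundTensor (kropina m a b) φ x y').det ≠ 0) (i j : Fin n) :
    cartanConn (kropina m a b) φ i j x y =
      1 / 2 * pd j (fun y' => kropinaSpray m a b φ x y' i) y := by
  have he : (fun y' => ∑ k, (fundTensor (kropina m a b) φ x y')⁻¹ i k *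
      ((∑ l, y' l * pdx l (pdy k (sqCoord (kropina m a b) φ)) x y')
        - pdx k (sqCoord (kropina m a b) φ) x y')) =ᶠ[𝓝 y]
      fun y' => 2 * kropinaSpray m a b φ x y' i :=
    h.mono fun y' h' => spray_eq ha hb hclosed hnull hm hφ hx h'.1 h'.2 i
  rw [cartanConn, pdy, pd, he.fderiv_eq, fderiv_real_mul, pd]
  simp only [smul_apply, smul_eq_mul]
  ring

end Finsler

/-! ### The divisibility argument for quadratic forms -/

section QuadraticForms

variable {E : Type*} [NormedAddCommGroup E] [NormedSpace ℝ E]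

theorem eq_of_eventuallyEq_of_analytic {f g : E → ℝ} (hf : ContDiff ℝ ω f) (hg : ContDiff ℝ ω g)
    {x : E} (h : f =ᶠ[𝓝 x] g) : f = g :=
  ((contDiff_omega_iff_analyticOnNhd).1 hf).eq_of_eventuallyEq
    ((contDiff_omega_iff_analyticOnNhd).1 hg) h

/-- Polarization, on any set closed under addition. -/
theorem bilin_eq_zero_of_diag {h : E →L[ℝ] E →L[ℝ] ℝ} (hs : ∀ y z, h y z = h z y)
    {P : E → Prop} (hadd : ∀ y z, P y → P z → P (y + z)) (h0 : ∀ y, P y → h y y = 0)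
    {y z : E} (hy : P y) (hz : P z) : h y z = 0 := by
  have h1 := h0 _ (hadd y z hy hz)
  simp only [map_add, add_apply, h0 y hy, h0 z hz, hs z y] at h1
  linarith

/-- A nondegenerate form is not identically zero on the kernel of a null covector, in dimension
greater than two. -/
theorem exists_ker_ne_zero [FiniteDimensional ℝ E] (hdim : 2 < Module.finrank ℝ E)
    {g : E →L[ℝ] E →L[ℝ] ℝ} (hgs : ∀ y z, g y z = g z y)
    (hnd : ∀ y, (∀ z, g y z = 0) → y = 0) {b : E →L[ℝ] ℝ} {B z : E} (hB : ∀ y, g B y = b y)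
    (hz : b z = 1) : ∃ w, b w = 0 ∧ g w w ≠ 0 := by
  by_contra! hcon
  have h1 : ∀ w w', b w = 0 → b w' = 0 → g w w' = 0 := fun w w' hw hw' =>
    bilin_eq_zero_of_diag hgs (P := fun w => b w = 0)
      (fun y z hy hz => by rw [map_add, hy, hz, add_zero]) hcon hw hw'
  -- If `g` vanished on the kernel of `b`, each `w` in the kernel would pair with every vector as
  -- `g(w, z) B` does, hence equal it. The kernel would be at most a line and the space at most a
  -- plane.
  have h2 : (b : E →ₗ[ℝ] ℝ).ker ≤ Submodule.span ℝ {B} := by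
    intro w hw
    have hw0 : b w = 0 := hw
    refine Submodule.mem_span_singleton.2 ⟨g w z, ?_⟩
    rw [eq_comm, ← sub_eq_zero]
    refine hnd _ fun y => ?_
    have h3 := h1 w (y - b y • z) hw0 (by simp [hz])
    simp only [map_sub, map_smul, smul_eq_mul] at h3
    simp only [map_sub, map_smul, sub_apply, smul_apply, hB, smul_eq_mul]
    linarith
  have h3 := Submodule.finrank_mono h2
  have h4 := finrank_span_le_card (R := ℝ) ({B} : Set E)
  simp only [Set.toFinset_singleton, Finset.card_singleton] at h4
  have h5 := (b : E →ₗ[ℝ] ℝ).finrank_range_add_finrank_ker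
  have h6 := Submodule.finrank_le (b : E →ₗ[ℝ] ℝ).range
  rw [Module.finrank_self] at h6
  omega

/-- If `h(y, y) (g(y, y) - 2 b(y) g(y, z))` is divisible by `b(y)²`, then `h` is a multiple of
`b ⊗ b`. -/
theorem eq_smul_of_dvd [FiniteDimensional ℝ E] (hdim : 2 < Module.finrank ℝ E)
    {g h : E →L[ℝ] E →L[ℝ] ℝ} (hgs : ∀ y z, g y z = g z y) (hhs : ∀ y z, h y z = h z y)
    (hnd : ∀ y, (∀ z, g y z = 0) → y = 0) {b : E →L[ℝ] ℝ} {B z : E} (hB : ∀ y, g B y = b y)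
    (hz : b z = 1) {κ : ℝ} (hκ : κ ≠ 0) {q : E → ℝ} (hq : ContDiff ℝ ω q) {x : E}
    (hx : ∀ᶠ y in 𝓝 x, b y ^ 2 * q y = κ * h y y * (g y y - 2 * b y * g y z)) (y y' : E) :
    h y y' = h z z * b y * b y' := by
  -- Both sides are analytic, so the identity spreads from a neighbourhood of `x` to the whole
  -- space.
  have hall : ∀ y, b y ^ 2 * q y = κ * h y y * (g y y - 2 * b y * g y z) := by
    have := eq_of_eventuallyEq_of_analytic (f := fun y => b y ^ 2 * q y)
      (g := fun y => κ * h y y * (g y y - 2 * b y * g y z)) (by fun_prop) (by fun_prop) hx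
    exact fun y => congrFun this y
  -- The identity at `w` gives `h(w, w) = 0`; its first-order part along `w + t z` then gives `h(w,
  -- z) = 0`.
  have hker : ∀ w, b w = 0 → g w w ≠ 0 → h w w = 0 ∧ h w z = 0 := by
    intro w hw hgw
    have hww : h w w = 0 := by
      have h1 := hall w
      simp only [hw] at h1
      have h2 : κ * h w w * g w w = 0 := by linarith
      simpa [hκ, hgw] using h2
    refine ⟨hww, ?_⟩
    have hline : ∀ t : ℝ, t ≠ 0 → t * q (w + t • z) =
        κ * (2 * h w z + t * h z z) * (g w w - t ^ 2 * g z z) := by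
      intro t ht
      have h1 := hall (w + t • z)
      simp only [map_add, map_smul, add_apply, smul_apply, smul_eq_mul, hw, hz, hww, hhs z w,
        hgs z w] at h1
      refine mul_left_cancel₀ ht ?_
      linear_combination h1
    have hqc : Continuous q := hq.continuous
    -- Division by `t` was possible only for `t ≠ 0`; continuity gives the value at `t = 0`.
    have h1 : (fun t : ℝ => t * q (w + t • z)) =
        fun t : ℝ => κ * (2 * h w z + t * h z z) * (g w w - t ^ 2 * g z z) :=
      Continuous.ext_on (dense_compl_singleton (0 : ℝ)) (by fun_prop) (by fun_prop)
        fun t ht => hline t ht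
    have h2 := congrFun h1 0
    simp only [zero_mul, add_zero] at h2
    have h3 : κ * h w z * g w w = 0 := by linarith
    simpa [hκ, hgw] using h3
  obtain ⟨w₀, hw₀, hgw₀⟩ := exists_ker_ne_zero hdim hgs hnd hB hz
  -- Projection onto the kernel of `b` along `z`. Near `w₀` the form `g` does not vanish at `P y`,
  -- so `hker` applies there, and analyticity removes the restriction on `y`.
  let P : E → E := fun y => y - b y • z
  have hP : ∀ y, b (P y) = 0 := fun y => by simp [P, hz]
  have hPw₀ : P w₀ = w₀ := by simp [P, hw₀]
  have hev : ∀ᶠ y in 𝓝 w₀, g (P y) (P y) ≠ 0 := by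
    have hc : ContinuousAt (fun y => g (P y) (P y)) w₀ := by fun_prop
    exact hc.eventually_ne (by simpa only [hPw₀] using hgw₀)
  have hPω : ContDiff ℝ ω P := by fun_prop
  have h1 : (fun y => h (P y) (P y)) = fun _ => 0 :=
    eq_of_eventuallyEq_of_analytic (by fun_prop) contDiff_const
      (hev.mono fun y hy => (hker _ (hP y) hy).1)
  have h2 : (fun y => h (P y) z) = fun _ => 0 :=
    eq_of_eventuallyEq_of_analytic (by fun_prop) contDiff_const
      (hev.mono fun y hy => (hker _ (hP y) hy).2)
  have h3 : ∀ w, b w = 0 → h w w = 0 := by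
    intro w hw
    have := congrFun h1 w
    simpa [P, hw] using this
  have h4 : h (P y) (P y') = 0 := bilin_eq_zero_of_diag hhs (P := fun w => b w = 0)
    (fun y z hy hz => by rw [map_add, hy, hz, add_zero]) h3 (hP y) (hP y')
  have h5 : h (P y) z = 0 := congrFun h2 y
  have h6 : h (P y') z = 0 := congrFun h2 y'
  simp only [P, map_sub, map_smul, sub_apply, smul_apply, smul_eq_mul, hhs z y'] at h4 h5 h6
  linear_combination h4 + b y' * h5 + b y * h6

end QuadraticForms

/-! ### Necessity: a Berwald space has `∇b` proportional to `b ⊗ b` -/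

section Berwald

variable {n : ℕ} {M : Type*} [TopologicalSpace M] [ChartedSpace (Coord n) M]
  {m : ℝ} {a : BilinField n M} {b : CovectorField n M}
  {φ : OpenPartialHomeomorph M (Coord n)} {x y : Coord n}

theorem exists_bilin_eq_chartHess (a : BilinField n M) (b : CovectorField n M)
    (φ : OpenPartialHomeomorph M (Coord n)) (x : Coord n) :
    ∃ h : Coord n →L[ℝ] Coord n →L[ℝ] ℝ, ∀ y z, chartHess a b φ x y z = h y z := by
  let D := fderiv ℝ (chartMetric a φ) x
  let B := dualVec a b φ x
  let D' : Coord n →L[ℝ] Coord n →L[ℝ] ℝ :=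
    (ContinuousLinearMap.compL ℝ (Coord n) (Coord n →L[ℝ] ℝ) ℝ
      (ContinuousLinearMap.apply ℝ ℝ B)).comp D
  exact ⟨fderiv ℝ (chartForm b φ) x - (1 / 2 : ℝ) • (D' + D'.flip - D B), fun y z => rfl⟩

/-- `∇b` is a multiple of `b ⊗ b` at the point `x` of the chart `φ`. -/
def HessIsMultiple (a : BilinField n M) (b : CovectorField n M)
    (φ : OpenPartialHomeomorph M (Coord n)) (x : Coord n) : Prop :=
  ∃ μ : ℝ, ∀ y z, chartHess a b φ x y z = μ * chartForm b φ x y * chartForm b φ x z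

variable {𝒜 : Set (TangentBundle (𝓡 n) M)} [IsManifold (𝓡 n) ∞ M]

theorem isOpen_fiber (hF : IsKropinaSpace m a b 𝒜) (φ : OpenPartialHomeomorph M (Coord n))
    (x : Coord n) : IsOpen {y | coordPoint φ x y ∈ 𝒜} := by
  have h1 : Continuous (fun y : Coord n => coordPoint φ x y) :=
    (FiberBundle.continuous_totalSpaceMk (Coord n) (TangentSpace (𝓡 n) : M → Type) (φ.symm x)).comp
      (mfderiv (𝓡 n) (𝓡 n) φ.symm x).continuous
  exact hF.finsler.isOpen.preimage h1

theorem exists_mem_fiber (hF : IsKropinaSpace m a b 𝒜)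
    (hφ : φ ∈ IsManifold.maximalAtlas (𝓡 n) ∞ M) (hx : x ∈ φ.target) :
    ∃ y, coordPoint φ x y ∈ 𝒜 := by
  obtain ⟨Y, hY⟩ := hF.finsler.nonempty_fiber (φ.symm x)
  obtain ⟨y, rfl⟩ := (bijective_coordVec hφ hx).2 Y
  exact ⟨y, hY⟩

theorem isAdmissibleAt_of_mem (hF : IsKropinaSpace m a b 𝒜) (hy : coordPoint φ x y ∈ 𝒜) :
    IsAdmissibleAt m a b φ x y := by
  have h1 := hF.root_pos (coordPoint φ x y) hy
  have h2 := hF.power_defined (coordPoint φ x y) hy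
  unfold IsAdmissibleAt IsAdmissible
  rw [chartMetric_apply, chartForm_apply]
  exact ⟨h1, h2⟩

theorem eventually_of_mem (hF : IsKropinaSpace m a b 𝒜)
    (hφ : φ ∈ IsManifold.maximalAtlas (𝓡 n) ∞ M) (hx : x ∈ φ.target)
    (hy : coordPoint φ x y ∈ 𝒜) : ∀ᶠ y' in 𝓝 y, coordPoint φ x y' ∈ 𝒜 ∧
      IsAdmissibleAt m a b φ x y' ∧ (fundTensor (kropina m a b) φ x y').det ≠ 0 := by
  filter_upwards [(isOpen_fiber hF φ x).mem_nhds hy] with y' hy'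
  exact ⟨hy', isAdmissibleAt_of_mem hF hy', hF.finsler.nondegenerate φ hφ x hx y' hy'⟩

theorem one_sub_ne_zero (hF : IsKropinaSpace m a b 𝒜) (hnull : IsNullForm a b)
    (hφ : φ ∈ IsManifold.maximalAtlas (𝓡 n) ∞ M) (hx : x ∈ φ.target) : 1 - m ≠ 0 := by
  obtain ⟨y, hy⟩ := exists_mem_fiber hF hφ hx
  have h := (eventually_of_mem hF hφ hx hy).self_of_nhds
  exact sub_ne_zero.2 (ne_one_of_nondegenerate hF.metric hnull hφ hx h.2.1 h.2.2).symm

/-- Each fibre of `𝒜` contains a vector, and `β ≠ 0` on it; so `b` has no zeros. -/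
theorem exists_chartForm_eq_one (hF : IsKropinaSpace m a b 𝒜)
    (hφ : φ ∈ IsManifold.maximalAtlas (𝓡 n) ∞ M) (hx : x ∈ φ.target) :
    ∃ z, chartForm b φ x z = 1 := by
  obtain ⟨y, hy⟩ := exists_mem_fiber hF hφ hx
  have h := (isAdmissibleAt_of_mem hF hy).ne_zero
  exact ⟨(chartForm b φ x y)⁻¹ • y, by simp [h]⟩

theorem kropinaSpray_apply (m : ℝ) (a : BilinField n M) (b : CovectorField n M)
    (φ : OpenPartialHomeomorph M (Coord n)) (x y : Coord n) (i : Fin n) :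
    kropinaSpray m a b φ x y i = (∑ j, ∑ k, christoffel a φ i j k x * y j * y k) +
      m * chartHess a b φ x y y / (1 - m) * (-2 / chartForm b φ x y * y i +
      chartMetric a φ x y y / chartForm b φ x y ^ 2 * dualVec a b φ x i) := rfl

theorem differentiableAt_kropinaSpray (hs : chartForm b φ x y ≠ 0) (i : Fin n) :
    DifferentiableAt ℝ (fun y => kropinaSpray m a b φ x y i) y := by
  obtain ⟨h, hh⟩ := exists_bilin_eq_chartHess a b φ x
  simp only [kropinaSpray_apply, hh]
  have hs2 : chartForm b φ x y ^ 2 ≠ 0 := pow_ne_zero 2 hs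
  have h1 : DifferentiableAt ℝ (fun y => -2 / chartForm b φ x y) y :=
    (hasFDerivAt_quotient (hasFDerivAt_const _ _) (chartForm b φ x).hasFDerivAt hs).differentiableAt
  have h2 : DifferentiableAt ℝ
      (fun y => chartMetric a φ x y y / chartForm b φ x y ^ 2) y :=
    (hasFDerivAt_quotient
      (show DifferentiableAt ℝ (fun y => chartMetric a φ x y y) y by fun_prop).hasFDerivAt
      (show DifferentiableAt ℝ (fun y => chartForm b φ x y ^ 2) y by fun_prop).hasFDerivAt
      hs2).differentiableAt
  fun_prop

theorem kropinaSpray_smul {t : ℝ} (ht : t ≠ 0) (hs : chartForm b φ x y ≠ 0) (i : Fin n) :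
    kropinaSpray m a b φ x (t • y) i = t ^ 2 * kropinaSpray m a b φ x y i := by
  obtain ⟨h, hh⟩ := exists_bilin_eq_chartHess a b φ x
  simp only [kropinaSpray_apply, hh, map_smul, smul_apply, smul_eq_mul, PiLp.smul_apply]
  have h1 : ∑ j, ∑ k, christoffel a φ i j k x * (t * y j) * (t * y k) =
      t ^ 2 * ∑ j, ∑ k, christoffel a φ i j k x * y j * y k := by
    simp only [Finset.mul_sum]
    exact Finset.sum_congr rfl fun j _ => Finset.sum_congr rfl fun k _ => by ring
  rw [h1]
  field_simp

/-- Euler's relation for the spray. -/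
theorem fderiv_kropinaSpray_self (hs : chartForm b φ x y ≠ 0) (i : Fin n) :
    fderiv ℝ (fun y => kropinaSpray m a b φ x y i) y y = 2 * kropinaSpray m a b φ x y i := by
  have h1 : HasDerivAt (fun t : ℝ => t • y) y 1 := by
    simpa using (hasDerivAt_id (1 : ℝ)).smul_const y
  have h2 : HasFDerivAt (fun y => kropinaSpray m a b φ x y i)
      (fderiv ℝ (fun y => kropinaSpray m a b φ x y i) y) ((1 : ℝ) • y) := by
    rw [one_smul]
    exact (differentiableAt_kropinaSpray hs i).hasFDerivAt
  have h3 := h2.comp_hasDerivAt (1 : ℝ) h1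
  have h4 : HasDerivAt (fun t : ℝ => t ^ 2 * kropinaSpray m a b φ x y i)
      (2 * kropinaSpray m a b φ x y i) 1 := by
    simpa using (hasDerivAt_pow 2 (1 : ℝ)).mul_const (kropinaSpray m a b φ x y i)
  refine h3.unique (h4.congr_of_eventuallyEq ?_)
  filter_upwards [isOpen_ne.mem_nhds (one_ne_zero : (1 : ℝ) ≠ 0)] with t ht
  exact kropinaSpray_smul ht hs i

/-- On the fibre of `𝒜` the spray is a quadratic polynomial, hence so is its difference from the
Levi-Civita part. Pairing this difference with a vector `z` such that `b(z) = 1` and clearing `β²`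
gives the hypothesis of `eq_smul_of_dvd`, with `κ = m/(1-m)`, nonzero because `m ≠ 0`. -/
theorem hessIsMultiple_of_isBerwald (hn : 2 < n) (hm : m ≠ 0) (hF : IsKropinaSpace m a b 𝒜)
    (hclosed : IsClosedForm b) (hnull : IsNullForm a b) (hB : IsBerwald 𝒜 (kropina m a b))
    (hφ : φ ∈ IsManifold.maximalAtlas (𝓡 n) ∞ M) (hx : x ∈ φ.target) :
    HessIsMultiple a b φ x := by
  obtain ⟨Γ, -, hΓ⟩ := hB φ hφ
  have hm1 := one_sub_ne_zero hF hnull hφ hx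
  have ha := hF.metric
  have hb := hF.form
  obtain ⟨y₀, hy₀⟩ := exists_mem_fiber hF hφ hx
  obtain ⟨z, hz⟩ := exists_chartForm_eq_one hF hφ hx
  obtain ⟨h, hh⟩ := exists_bilin_eq_chartHess a b φ x
  have hspray : ∀ y, coordPoint φ x y ∈ 𝒜 → ∀ i, kropinaSpray m a b φ x y i =
      ∑ j, y j * ∑ k, Γ i j k x * y k := by
    intro y hy i
    have hs := (isAdmissibleAt_of_mem hF hy).ne_zero
    -- The spray is homogeneous of degree two and the connection is half its derivative, so
    -- contraction with `y` recovers the spray.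
    have h1 : ∑ j, y j * cartanConn (kropina m a b) φ i j x y =
        kropinaSpray m a b φ x y i := by
      have h2 := sum_mul_apply_single (fderiv ℝ (fun y => kropinaSpray m a b φ x y i) y) y
      rw [fderiv_kropinaSpray_self hs] at h2
      have h3 := fun j => cartanConn_eq ha hb hclosed hnull hm1 hφ hx
        ((eventually_of_mem hF hφ hx hy).mono fun _ h => h.2) i j
      simp only [h3, pd]
      calc _ = 1 / 2 * ∑ j, y j * fderiv ℝ (fun y => kropinaSpray m a b φ x y i) y
              (EuclideanSpace.single j 1) := by
            rw [Finset.mul_sum]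
            exact Finset.sum_congr rfl fun j _ => by ring
        _ = _ := by rw [h2]; ring
    rw [← h1]
    exact Finset.sum_congr rfl fun j _ => by rw [hΓ x hx y hy i j]
  let Q : Coord n → Coord n := fun y => WithLp.toLp 2 fun i =>
    (∑ j, y j * ∑ k, Γ i j k x * y k) - ∑ j, ∑ k, christoffel a φ i j k x * y j * y k
  have hQ : ContDiff ℝ ω Q := by
    rw [contDiff_euclidean]
    intro i
    change ContDiff ℝ ω fun y : Coord n =>
      (∑ j, y j * ∑ k, Γ i j k x * y k) - ∑ j, ∑ k, christoffel a φ i j k x * y j * y k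
    fun_prop
  have hκ : m / (1 - m) ≠ 0 := div_ne_zero hm hm1
  refine ⟨h z z, fun y y' => ?_⟩
  rw [hh]
  refine eq_smul_of_dvd (by simpa using hn) (chartMetric_symm ha φ x)
    (fun y z => by rw [← hh, ← hh, chartHess_symm ha hb hclosed hφ hx])
    (fun y hy => chartMetric_nondegenerate ha hφ hx hy) (chartMetric_dualVec ha hφ hx) hz hκ
    (q := fun y => chartMetric a φ x (Q y) z) (by fun_prop) (x := y₀) ?_ y y'
  filter_upwards [eventually_of_mem hF hφ hx hy₀] with y hy
  have hs := hy.2.1.ne_zero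
  have hQy : Q y = (m * h y y / (1 - m)) •
      ((-2 / chartForm b φ x y) • y +
        (chartMetric a φ x y y / chartForm b φ x y ^ 2) • dualVec a b φ x) := by
    ext i
    have h1 := hspray y hy.1 i
    rw [kropinaSpray_apply, hh] at h1
    change (∑ j, y j * ∑ k, Γ i j k x * y k) - ∑ j, ∑ k, christoffel a φ i j k x * y j * y k = _
    rw [← h1, add_sub_cancel_left]
    rfl
  rw [hQy]
  simp only [map_add, map_smul, add_apply, smul_apply, smul_eq_mul,
    chartMetric_dualVec ha hφ hx, hz]
  field_simp
  ring

end Berwald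

/-! ### Sufficiency of `∇b = μ b ⊗ b`, and the function `c` -/

section Sufficiency

variable {n : ℕ} {M : Type*} [TopologicalSpace M] [ChartedSpace (Coord n) M]
  {m : ℝ} {a : BilinField n M} {b : CovectorField n M}
  {φ : OpenPartialHomeomorph M (Coord n)} {x y : Coord n}

theorem pd_quadratic (C : Fin n → Fin n → ℝ) (j : Fin n) (y : Coord n) :
    pd j (fun y : Coord n => ∑ p, ∑ q, C p q * y p * y q) y =
      ∑ k, (C j k + C k j) * y k := by
  have hcoord : ∀ p : Fin n, HasFDerivAt (fun y : Coord n => y p)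
      (EuclideanSpace.proj p : Coord n →L[ℝ] ℝ) y := fun p =>
    (EuclideanSpace.proj p : Coord n →L[ℝ] ℝ).hasFDerivAt
  have h : HasFDerivAt (fun y : Coord n => ∑ p, ∑ q, C p q * y p * y q) _ y :=
    HasFDerivAt.fun_sum fun p _ => HasFDerivAt.fun_sum fun q _ =>
      (((hcoord p).const_mul (C p q)).mul (hcoord q))
  have hsing : ∀ p : Fin n, (EuclideanSpace.proj p : Coord n →L[ℝ] ℝ)
      (EuclideanSpace.single j 1) = if p = j then 1 else 0 := fun p => by
    simp [PiLp.single_apply]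
  have e1 : ∑ p, ∑ q, C p q * y p * (if q = j then 1 else 0) = ∑ p, C p j * y p :=
    Finset.sum_congr rfl fun p _ => by simp
  have e2 : ∑ p, ∑ q, y q * (C p q * if p = j then 1 else 0) = ∑ q, C j q * y q := by
    rw [Finset.sum_comm]
    exact Finset.sum_congr rfl fun q _ => by simp [mul_comm]
  rw [pd, h.fderiv]
  simp only [sum_apply, add_apply, smul_apply, smul_eq_mul, hsing, Finset.sum_add_distrib, e1, e2,
    add_mul]
  rw [add_comm]

/-- The factor `μ` in `∇b = μ b ⊗ b`, in terms of the components in the chart `φ`. -/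
noncomputable def hessFactor (a : BilinField n M) (b : CovectorField n M)
    (φ : OpenPartialHomeomorph M (Coord n)) (x : Coord n) : ℝ :=
  (∑ i, covDeriv a b φ i i x) / ∑ i, formComp b φ i x ^ 2

theorem sum_sq_formComp_ne_zero (h : ∃ z, chartForm b φ x z ≠ 0) :
    ∑ i, formComp b φ i x ^ 2 ≠ 0 := by
  intro h0
  obtain ⟨z, hz⟩ := h
  apply hz
  rw [Finset.sum_eq_zero_iff_of_nonneg fun i _ => sq_nonneg _] at h0
  rw [← sum_mul_apply_single (chartForm b φ x) z]
  refine Finset.sum_eq_zero fun i hi => ?_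
  have := pow_eq_zero_iff (two_ne_zero) |>.1 (h0 i hi)
  rw [formComp_eq] at this
  rw [this, mul_zero]

variable [IsManifold (𝓡 n) ∞ M] {𝒜 : Set (TangentBundle (𝓡 n) M)}

/-- Summing the diagonal components of `∇b = μ b ⊗ b` recovers `μ` as a quotient, without choosing
an index with `b_i ≠ 0`; this makes smoothness of `μ` visible. -/
theorem chartHess_eq_hessFactor (ha : IsPseudoRiemannianMetric a) (hb : IsSmoothForm b)
    (hφ : φ ∈ IsManifold.maximalAtlas (𝓡 n) ∞ M) (hx : x ∈ φ.target)
    (h0 : ∃ z, chartForm b φ x z ≠ 0) (h : HessIsMultiple a b φ x) (y z : Coord n) :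
    chartHess a b φ x y z = hessFactor a b φ x * chartForm b φ x y * chartForm b φ x z := by
  obtain ⟨μ, hμ⟩ := h
  have h1 : hessFactor a b φ x = μ := by
    rw [hessFactor, div_eq_iff (sum_sq_formComp_ne_zero h0), Finset.mul_sum]
    refine Finset.sum_congr rfl fun i _ => ?_
    rw [covDeriv_eq ha hb hφ hx, hμ, formComp_eq]
    ring
  rw [h1, hμ]

theorem contDiffOn_hessFactor (hF : IsKropinaSpace m a b 𝒜)
    (hφ : φ ∈ IsManifold.maximalAtlas (𝓡 n) ∞ M) :
    ContDiffOn ℝ ∞ (hessFactor a b φ) φ.target := by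
  refine (ContDiffOn.sum fun i _ => contDiffOn_covDeriv hF.metric hF.form hφ i i).div
    (ContDiffOn.sum fun i _ => (hF.form φ hφ i).pow 2) fun x hx => ?_
  obtain ⟨z, hz⟩ := exists_chartForm_eq_one hF hφ hx
  exact sum_sq_formComp_ne_zero ⟨z, by rw [hz]; exact one_ne_zero⟩

/-- On a vector `z` with `b(z) = 1`, the coordinate-independent number `∇b(z, z)` is the factor
itself. -/
theorem hessFactor_transition (hF : IsKropinaSpace m a b 𝒜)
    (hH : ∀ φ ∈ IsManifold.maximalAtlas (𝓡 n) ∞ M, ∀ x ∈ φ.target, HessIsMultiple a b φ x)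
    {ψ : OpenPartialHomeomorph M (Coord n)} (hφ : φ ∈ IsManifold.maximalAtlas (𝓡 n) ∞ M)
    (hψ : ψ ∈ IsManifold.maximalAtlas (𝓡 n) ∞ M) (hx : x ∈ φ.target)
    (hx' : φ.symm x ∈ ψ.source) :
    hessFactor a b φ x = hessFactor a b ψ (ψ (φ.symm x)) := by
  have ha := hF.metric
  have hb := hF.form
  have hψx := ψ.map_source hx'
  obtain ⟨z, hz⟩ := exists_chartForm_eq_one hF hφ hx
  obtain ⟨w, hw⟩ := exists_chartForm_eq_one hF hψ hψx
  have h1 := chartHess_transition ha hb hφ hψ hx hx' z z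
  rw [chartHess_eq_hessFactor ha hb hφ hx ⟨z, by rw [hz]; exact one_ne_zero⟩ (hH φ hφ x hx),
    chartHess_eq_hessFactor ha hb hψ hψx ⟨w, by rw [hw]; exact one_ne_zero⟩ (hH ψ hψ _ hψx),
    ← chartForm_transition b hφ hψ hx hx', hz] at h1
  linarith

/-- With `∇b(y, y) = μ β²` the denominators of the spray cancel, leaving the quadratic polynomial
with coefficients `C`. -/
theorem isBerwald_of_hessIsMultiple (hF : IsKropinaSpace m a b 𝒜)
    (hclosed : IsClosedForm b) (hnull : IsNullForm a b)
    (hH : ∀ φ ∈ IsManifold.maximalAtlas (𝓡 n) ∞ M, ∀ x ∈ φ.target, HessIsMultiple a b φ x) :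
    IsBerwald 𝒜 (kropina m a b) := by
  intro φ hφ
  have ha := hF.metric
  have hb := hF.form
  let C : Fin n → Fin n → Fin n → Coord n → ℝ := fun i j k x =>
    christoffel a φ i j k x + m * (hessFactor a b φ x / (1 - m)) *
      (-2 * formComp b φ j x * (if k = i then 1 else 0)
        + metricComp a φ j k x * dualVec a b φ x i)
  have hC : ∀ i j k, ContDiffOn ℝ ∞ (C i j k) φ.target := fun i j k =>
    (contDiffOn_christoffel ha hφ i j k).add
      ((contDiffOn_const.mul ((contDiffOn_hessFactor hF hφ).div_const _)).mul
        (((contDiffOn_const.mul (hb φ hφ j)).mul contDiffOn_const).add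
          ((ha.smooth φ hφ j k).mul
            ((contDiffOn_euclidean.1 (contDiffOn_dualVec ha hb hφ)) i))))
  -- The connection is half the `y`-derivative of the spray, which symmetrizes `C` in its lower
  -- indices.
  refine ⟨fun i j k x => 1 / 2 * (C i j k x + C i k j x), fun i j k =>
    contDiffOn_const.mul ((hC i j k).add (hC i k j)), fun x hx y hy i j => ?_⟩
  have hm := one_sub_ne_zero hF hnull hφ hx
  obtain ⟨z, hz⟩ := exists_chartForm_eq_one hF hφ hx
  have hess := chartHess_eq_hessFactor ha hb hφ hx ⟨z, by rw [hz]; exact one_ne_zero⟩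
    (hH φ hφ x hx)
  have hev := eventually_of_mem hF hφ hx hy
  rw [cartanConn_eq ha hb hclosed hnull hm hφ hx (hev.mono fun _ h => h.2)]
  have he : (fun y' => kropinaSpray m a b φ x y' i) =ᶠ[𝓝 y]
      fun y' => ∑ p, ∑ q, C i p q x * y' p * y' q := by
    filter_upwards [hev] with y' h'
    have hs := h'.2.1.ne_zero
    have e1 : ∑ p, ∑ q, C i p q x * y' p * y' q =
        (∑ p, ∑ q, christoffel a φ i p q x * y' p * y' q) +
        m * (hessFactor a b φ x / (1 - m)) *
          (-2 * (∑ p, ∑ q, y' p * formComp b φ p x * ((if q = i then 1 else 0) * y' q))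
            + (∑ p, y' p * ∑ q, y' q * metricComp a φ p q x) * dualVec a b φ x i) := by
      simp only [Finset.mul_sum, Finset.sum_mul, ← Finset.sum_add_distrib, C]
      exact Finset.sum_congr rfl fun p _ => Finset.sum_congr rfl fun q _ => by ring
    have e2 : ∑ p, ∑ q, y' p * formComp b φ p x * ((if q = i then 1 else 0) * y' q) =
        chartForm b φ x y' * y' i := by
      rw [← sum_mul_apply_single (chartForm b φ x) y', Finset.sum_mul]
      refine Finset.sum_congr rfl fun p _ => ?_
      rw [← Finset.mul_sum, formComp_eq]
      simp
    have e3 : ∑ p, y' p * ∑ q, y' q * metricComp a φ p q x = chartMetric a φ x y' y' := by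
      have h1 := sum_mul_apply_single ((chartMetric a φ x).flip y') y'
      simp only [ContinuousLinearMap.flip_apply] at h1
      rw [← h1]
      exact Finset.sum_congr rfl fun p _ => congrArg _
        (sum_mul_apply_single (chartMetric a φ x (EuclideanSpace.single p 1)) y')
    rw [e1, e2, e3, kropinaSpray_apply, hess]
    field_simp
  rw [show pd j (fun y' => kropinaSpray m a b φ x y' i) y =
    pd j (fun y' : Coord n => ∑ p, ∑ q, C i p q x * y' p * y' q) y by
      rw [pd, pd, he.fderiv_eq], pd_quadratic, Finset.mul_sum]
  exact Finset.sum_congr rfl fun k _ => by ring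

theorem covDeriv_eq_hessFactor (hF : IsKropinaSpace m a b 𝒜)
    (hφ : φ ∈ IsManifold.maximalAtlas (𝓡 n) ∞ M) (hx : x ∈ φ.target)
    (h : HessIsMultiple a b φ x) (i j : Fin n) :
    covDeriv a b φ j i x = hessFactor a b φ x * formComp b φ i x * formComp b φ j x := by
  obtain ⟨z, hz⟩ := exists_chartForm_eq_one hF hφ hx
  rw [covDeriv_eq hF.metric hF.form hφ hx, chartHess_eq_hessFactor hF.metric hF.form hφ hx
    ⟨z, by rw [hz]; exact one_ne_zero⟩ h, formComp_eq, formComp_eq]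
  ring

/-- The function `c` of the Berwald condition exists and is smooth. -/
theorem exists_berwaldCondition (hF : IsKropinaSpace m a b 𝒜) (hnull : IsNullForm a b)
    (hH : ∀ φ ∈ IsManifold.maximalAtlas (𝓡 n) ∞ M, ∀ x ∈ φ.target, HessIsMultiple a b φ x) :
    ∃ c : M → ℝ, ContMDiff (𝓡 n) 𝓘(ℝ, ℝ) ∞ c ∧ BerwaldCondition m a b c := by
  -- Since `b² = 0`, the condition reads `∇b = c (1 - m) b ⊗ b`, so `c` is the factor divided by `1
  -- - m`; the preferred chart at each point serves to define it.
  let c : M → ℝ := fun p => hessFactor a b (chartAt (Coord n) p) (chartAt (Coord n) p p) / (1 - m)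
  have hc : ∀ φ ∈ IsManifold.maximalAtlas (𝓡 n) ∞ M, ∀ x ∈ φ.target,
      c (φ.symm x) = hessFactor a b φ x / (1 - m) := by
    intro φ hφ x hx
    rw [hessFactor_transition hF hH hφ (IsManifold.chart_mem_maximalAtlas (φ.symm x)) hx
      (mem_chart_source _ _)]
  refine ⟨c, fun p => ?_, fun φ hφ x hx i j => ?_⟩
  · have hφ := IsManifold.chart_mem_maximalAtlas (I := 𝓡 n) (n := ∞) p
    set φ := chartAt (Coord n) p with hφ0
    have hp : p ∈ φ.source := mem_chart_source _ _
    have h1 : ContMDiffAt (𝓡 n) 𝓘(ℝ, ℝ) ∞ (fun x => hessFactor a b φ x / (1 - m)) (φ p) :=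
      (((contDiffOn_hessFactor hF hφ).div_const _).contDiffAt
        (φ.open_target.mem_nhds (φ.map_source hp))).contMDiffAt
    refine (h1.comp p (contMDiffAt_of_mem_maximalAtlas hφ hp)).congr_of_eventuallyEq ?_
    filter_upwards [φ.open_source.mem_nhds hp] with q hq
    rw [Function.comp_apply, ← hc φ hφ _ (φ.map_source hq), φ.left_inv hq]
  · have hm := one_sub_ne_zero hF hnull hφ hx
    rw [covDeriv_eq_hessFactor hF hφ hx (hH φ hφ x hx), hc φ hφ x hx, hnull φ hφ x hx]
    field_simp
    ring

/-- The sum of the diagonal components determines `c (1 - m) ∑ b_i²`, and neither `1 - m` nor the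
sum of squares vanishes. -/
theorem BerwaldCondition.unique (hF : IsKropinaSpace m a b 𝒜) (hnull : IsNullForm a b)
    {c c' : M → ℝ} (h : BerwaldCondition m a b c) (h' : BerwaldCondition m a b c') : c' = c := by
  ext p
  have hφ := IsManifold.chart_mem_maximalAtlas (I := 𝓡 n) (n := ∞) p
  have hx := mem_chart_target (Coord n) p
  have hm := one_sub_ne_zero hF hnull hφ hx
  obtain ⟨z, hz⟩ := exists_chartForm_eq_one hF hφ hx
  have h0 := sum_sq_formComp_ne_zero ⟨z, by rw [hz]; exact one_ne_zero⟩
  have h1 : ∀ i, c p * (1 - m) * formComp b (chartAt (Coord n) p) i (chartAt (Coord n) p p) ^ 2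
      = c' p * (1 - m) * formComp b (chartAt (Coord n) p) i (chartAt (Coord n) p p) ^ 2 := by
    intro i
    have e1 := h _ hφ _ hx i i
    have e2 := h' _ hφ _ hx i i
    rw [e1, hnull _ hφ _ hx, OpenPartialHomeomorph.left_inv _ (mem_chart_source _ _)] at e2
    linear_combination e2
  have h2 : c p * (1 - m) * ∑ i, formComp b (chartAt (Coord n) p) i (chartAt (Coord n) p p) ^ 2
      = c' p * (1 - m) *
        ∑ i, formComp b (chartAt (Coord n) p) i (chartAt (Coord n) p p) ^ 2 := by
    rw [Finset.mul_sum, Finset.mul_sum]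
    exact Finset.sum_congr rfl fun i _ => h1 i
  exact (mul_right_cancel₀ hm (mul_right_cancel₀ h0 h2)).symm

end Sufficiency

/-! ### Charts with `b = du` and dual vector field `-∂_v` -/

section AdaptedCharts

variable {k : ℕ} {M : Type*} [TopologicalSpace M] [ChartedSpace (Coord (k + 2)) M]
  [IsManifold (𝓡 (k + 2)) ∞ M]
  {a : BilinField (k + 2) M} {b : CovectorField (k + 2) M}
  {φ : OpenPartialHomeomorph M (Coord (k + 2))} {x : Coord (k + 2)}

/-- In the coordinates `(u, v, x³, …, xⁿ)` of the chart `φ` one has `b = du`, and the vector field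
dual to `b` is `-∂_v`. -/
structure IsAdaptedChart (a : BilinField (k + 2) M) (b : CovectorField (k + 2) M)
    (φ : OpenPartialHomeomorph M (Coord (k + 2))) : Prop where
  mem_atlas : φ ∈ IsManifold.maximalAtlas (𝓡 (k + 2)) ∞ M
  form_eq : ∀ x ∈ φ.target, ∀ y, chartForm b φ x y = y 0
  metric_eq : ∀ x ∈ φ.target, ∀ z, chartMetric a φ x (EuclideanSpace.single 1 1) z = -z 0

/-- The components of `b` and of `a(∂_v, ·)` are constant, so of all derivatives in `∇b` only that
of the metric along `B = -∂_v` survives. -/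
theorem IsAdaptedChart.chartHess_eq (h : IsAdaptedChart a b φ) (ha : IsPseudoRiemannianMetric a)
    (hb : IsSmoothForm b) (hx : x ∈ φ.target) (y z : Coord (k + 2)) :
    chartHess a b φ x y z =
      -(1 / 2) * fderiv ℝ (chartMetric a φ) x (EuclideanSpace.single 1 1) y z := by
  have hB : -EuclideanSpace.single 1 1 = dualVec a b φ x := by
    refine eq_dualVec ha h.mem_atlas hx fun z => ?_
    rw [map_neg, neg_apply, h.metric_eq x hx, h.form_eq x hx, neg_neg]
  have hev : ∀ᶠ x' in 𝓝 x, x' ∈ φ.target := φ.open_target.mem_nhds hx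
  have hg := differentiableAt_chartMetric ha h.mem_atlas hx
  have h1 : fderiv ℝ (chartForm b φ) x y z = 0 := by
    rw [← fderiv_clm_apply_const (differentiableAt_chartForm hb h.mem_atlas hx)]
    have : (fun x => chartForm b φ x z) =ᶠ[𝓝 x] fun _ => z 0 :=
      hev.mono fun x' hx' => h.form_eq x' hx' z
    rw [this.fderiv_eq]
    simp
  have h2 : ∀ y z, fderiv ℝ (chartMetric a φ) x y (EuclideanSpace.single 1 1) z = 0 := by
    intro y z
    rw [← fderiv_apply_apply hg]
    have : (fun x => chartMetric a φ x (EuclideanSpace.single 1 1) z) =ᶠ[𝓝 x] fun _ => -z 0 :=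
      hev.mono fun x' hx' => h.metric_eq x' hx' z
    rw [this.fderiv_eq]
    simp
  have hs := fderiv_chartMetric_symm ha h.mem_atlas hx
  unfold chartHess formHess
  rw [← hB, h1]
  simp only [map_neg, neg_apply, hs y z, hs z y, h2]
  ring

variable {H : Coord (k + 2) → ℝ} {W : Fin k → ℝ → (Fin k → ℝ) → ℝ}
  {h : ℝ → (Fin k → ℝ) → Matrix (Fin k) (Fin k) ℝ}

theorem HasNormalForm.isAdaptedChart (hn : HasNormalForm a b φ H W h) : IsAdaptedChart a b φ where
  mem_atlas := hn.mem_atlas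
  form_eq x hx y := hn.form_eq x hx y
  metric_eq x hx z := by
    rw [chartMetric_apply, hn.metric_eq x hx]
    have h0 : (EuclideanSpace.single 1 1 : Coord (k + 2)) 0 = 0 := by simp
    have h1 : (EuclideanSpace.single 1 1 : Coord (k + 2)) 1 = 1 := by simp
    have h2 : ∀ i, transverse (EuclideanSpace.single 1 1 : Coord (k + 2)) i = 0 := fun i => by
      simp [transverse, Fin.ext_iff]
    simp [h2]

/-- Of the coefficients of the normal form only `H` depends on `v`. -/
theorem HasNormalForm.chartHess_eq (hn : HasNormalForm a b φ H W h)
    (ha : IsPseudoRiemannianMetric a) (hb : IsSmoothForm b) (hx : x ∈ φ.target)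
    (y z : Coord (k + 2)) :
    chartHess a b φ x y z = -(1 / 2) * pd 1 H x * y 0 * z 0 := by
  rw [hn.isAdaptedChart.chartHess_eq ha hb hx]
  have hg := differentiableAt_chartMetric ha hn.mem_atlas hx
  have hH : DifferentiableAt ℝ H x :=
    (hn.smooth_H.contDiffAt (φ.open_target.mem_nhds hx)).differentiableAt (by simp)
  -- The derivative is taken along the line in direction `∂_v`, on which the arguments of `W` and
  -- `h` do not change; nothing about their derivatives is needed.
  let e : Coord (k + 2) := EuclideanSpace.single 1 1
  have hl : HasDerivAt (fun t : ℝ => x + t • e) e 0 := by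
    simpa using ((hasDerivAt_id (0 : ℝ)).smul_const e).const_add x
  have hl0 : x + (0 : ℝ) • e = x := by simp
  have hd1 : HasDerivAt (fun t : ℝ => chartMetric a φ (x + t • e) y z)
      (fderiv ℝ (chartMetric a φ) x e y z) 0 := by
    rw [← fderiv_apply_apply hg]
    have h1 : HasFDerivAt (fun x => chartMetric a φ x y z)
        (fderiv ℝ (fun x => chartMetric a φ x y z) x) (x + (0 : ℝ) • e) := by
      rw [hl0]
      exact (show DifferentiableAt ℝ (fun x => chartMetric a φ x y z) x by fun_prop).hasFDerivAt
    exact h1.comp_hasDerivAt (0 : ℝ) hl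
  have hd2 : HasDerivAt (fun t : ℝ => H (x + t • e)) (pd 1 H x) 0 := by
    have h1 : HasFDerivAt H (fderiv ℝ H x) (x + (0 : ℝ) • e) := by
      rw [hl0]
      exact hH.hasFDerivAt
    exact h1.comp_hasDerivAt (0 : ℝ) hl
  have h0 : ∀ t : ℝ, (x + t • e) 0 = x 0 := fun t => by simp [e]
  have h2 : ∀ t : ℝ, transverse (x + t • e) = transverse x := fun t => by
    ext i
    simp [transverse, e, Fin.ext_iff]
  have hev : ∀ᶠ t : ℝ in 𝓝 0, x + t • e ∈ φ.target := by
    have hc : ContinuousAt (fun t : ℝ => x + t • e) 0 := hl.continuousAt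
    exact hc.eventually_mem (by rw [hl0]; exact φ.open_target.mem_nhds hx)
  have hd3 := (hd2.mul_const (y 0 * z 0)).add_const
    (chartMetric a φ x y z - H x * (y 0 * z 0))
  have heq := hd1.unique (hd3.congr_of_eventuallyEq (hev.mono fun t ht => by
    simp only [chartMetric_apply]
    rw [hn.metric_eq _ ht, hn.metric_eq x hx, h0, h2]
    ring))
  rw [heq]
  ring

end AdaptedCharts

/-! ### A linear normalization and a cutoff -/

section Preparation

/-- A linear change of coordinates taking a covector and a vector in its kernel to standard
position. -/
theorem exists_equiv_standard {k : ℕ} {β : Coord (k + 2) →L[ℝ] ℝ} {z B : Coord (k + 2)}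
    (hz : β z = 1) (hB : β B = 0) (hB0 : B ≠ 0) :
    ∃ C : Coord (k + 2) ≃L[ℝ] Coord (k + 2), (∀ y, C y 0 = β y) ∧
      C B = -EuclideanSpace.single 1 1 := by
  let K := (β : Coord (k + 2) →ₗ[ℝ] ℝ).ker
  have hK : Module.finrank ℝ K = Module.finrank ℝ (Coord (k + 1)) := by
    have h1 := (β : Coord (k + 2) →ₗ[ℝ] ℝ).finrank_range_add_finrank_ker
    have h2 : (β : Coord (k + 2) →ₗ[ℝ] ℝ).range = ⊤ :=
      LinearMap.range_eq_top.2 fun c => ⟨c • z, by simp [hz]⟩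
    rw [h2, finrank_top, Module.finrank_self, finrank_euclideanSpace_fin] at h1
    rw [finrank_euclideanSpace_fin]
    change 1 + Module.finrank ℝ K = k + 2 at h1
    omega
  let L : K ≃ₗ[ℝ] Coord (k + 1) := LinearEquiv.ofFinrankEq _ _ hK
  let B' : K := ⟨B, hB⟩
  have hB' : L B' ≠ 0 := by
    rw [Ne, LinearEquiv.map_eq_zero_iff]
    exact fun h => hB0 (congrArg Subtype.val h)
  have he : -(EuclideanSpace.single 0 1 : Coord (k + 1)) ≠ 0 := by simp
  -- The target is minus the vector of index 0 because the kernel supplies the coordinates after the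
  -- zeroth: the index becomes 1 in `Coord (k + 2)`.
  obtain ⟨A, hA⟩ := SeparatingDual.exists_continuousLinearEquiv_apply_eq (R := ℝ) hB' he
  let P : Coord (k + 2) →ₗ[ℝ] K := LinearMap.codRestrict K
    (LinearMap.id - (β : Coord (k + 2) →ₗ[ℝ] ℝ).smulRight z) fun y => by
      change β (y - β y • z) = 0
      simp [hz]
  let T : Coord (k + 2) →ₗ[ℝ] Coord (k + 1) := (A : Coord (k + 1) →ₗ[ℝ] Coord (k + 1)) ∘ₗ
    (L : K →ₗ[ℝ] Coord (k + 1)) ∘ₗ P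
  let C₀ : Coord (k + 2) →ₗ[ℝ] Coord (k + 2) :=
    { toFun := fun y => WithLp.toLp 2 (Fin.cons (β y) fun i => T y i)
      map_add' := fun y y' => by
        ext i
        refine Fin.cases ?_ (fun i => ?_) i <;> simp
      map_smul' := fun c y => by
        ext i
        refine Fin.cases ?_ (fun i => ?_) i <;> simp }
  have hC0 : ∀ y, C₀ y 0 = β y := fun y => rfl
  have hCs : ∀ y i, C₀ y (Fin.succ i) = T y i := fun y i => rfl
  have hinj : Function.Injective C₀ := by
    rw [injective_iff_map_eq_zero]
    intro y hy
    have h1 : β y = 0 := by rw [← hC0, hy]; rfl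
    have h2 : T y = 0 := by
      ext i
      rw [← hCs, hy]
      rfl
    have h3 : P y = 0 := by
      have h4 : A (L (P y)) = 0 := h2
      simpa using h4
    have h5 : y - β y • z = 0 := congrArg Subtype.val h3
    simpa [h1] using h5
  have hPB : P B = B' := by
    ext1
    change B - β B • z = B
    simp [hB]
  refine ⟨(LinearEquiv.ofInjectiveEndo C₀ hinj).toContinuousLinearEquiv, hC0, ?_⟩
  change C₀ B = _
  have hTB : T B = -EuclideanSpace.single 0 1 := by
    change A (L (P B)) = _
    rw [hPB, hA]
  ext i
  refine Fin.cases ?_ (fun i => ?_) i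
  · rw [hC0, hB]
    simp
  · rw [hCs, hTB]
    have h1 : (i.succ = 1) = (i = 0) := by rw [← Fin.succ_zero_eq_one, Fin.succ_inj]
    simp only [PiLp.neg_apply, PiLp.single_apply, h1]

/-- A smooth map near a point extends, up to a cutoff, to a smooth map with compact support. -/
theorem exists_smooth_cutoff {E F : Type*} [NormedAddCommGroup E] [NormedSpace ℝ E]
    [FiniteDimensional ℝ E] [NormedAddCommGroup F] [NormedSpace ℝ F] {f : E → F} {s : Set E}
    (hs : IsOpen s) (hf : ContDiffOn ℝ ∞ f s) {x : E} (hx : x ∈ s) :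
    ∃ X : E → F, ContDiff ℝ ∞ X ∧ HasCompactSupport X ∧ (∃ r > 0, Metric.ball x r ⊆ s ∧
      ∀ y ∈ Metric.ball x r, X y = f y) ∧ ∀ y, X y = 0 ∨ (y ∈ s ∧ ∃ c : ℝ, X y = c • f y) := by
  obtain ⟨R, hR, hRs⟩ := Metric.nhds_basis_closedBall.mem_iff.1 (hs.mem_nhds hx)
  let χ : ContDiffBump x := ⟨R / 2, R, by positivity, by linarith⟩
  refine ⟨fun y => χ y • f y, ?_, χ.hasCompactSupport.smul_right,
    ⟨R / 2, by positivity, ?_, ?_⟩, ?_⟩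
  · rw [contDiff_iff_contDiffAt]
    intro y
    by_cases hy : y ∈ s
    · exact χ.contDiff.contDiffAt.smul (hf.contDiffAt (hs.mem_nhds hy))
    · have h1 : y ∉ tsupport χ := by
        rw [χ.tsupport_eq]
        exact fun h => hy (hRs h)
      have h2 : (fun y => χ y • f y) =ᶠ[𝓝 y] fun _ => 0 := by
        filter_upwards [notMem_tsupport_iff_eventuallyEq.1 h1] with y' hy'
        simp [hy']
      exact contDiffAt_const.congr_of_eventuallyEq h2
  · exact fun y hy => hRs (Metric.ball_subset_closedBall (Metric.ball_subset_ball (by linarith) hy))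
  · intro y hy
    simp only
    rw [χ.one_of_mem_closedBall (Metric.ball_subset_closedBall hy), one_smul]
  · intro y
    by_cases hy : y ∈ s
    · exact Or.inr ⟨hy, χ y, rfl⟩
    · left
      have h1 : χ y = 0 := by
        rw [← Function.notMem_support, χ.support_eq]
        exact fun h => hy (hRs (Metric.ball_subset_closedBall h))
      simp [h1]

end Preparation

/-! ### Construction of adapted charts -/

section Charts

variable {k : ℕ} {M : Type*} [TopologicalSpace M] [ChartedSpace (Coord (k + 2)) M]
  [IsManifold (𝓡 (k + 2)) ∞ M]
  {m : ℝ} {a : BilinField (k + 2) M} {b : CovectorField (k + 2) M}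
  {𝒜 : Set (TangentBundle (𝓡 (k + 2)) M)}

theorem eventually_trans_symm {n : ℕ} {N : Type*} [TopologicalSpace N]
    {φ : OpenPartialHomeomorph N (Coord n)} {e : OpenPartialHomeomorph (Coord n) (Coord n)}
    {x : Coord n} (hx : x ∈ (φ.trans e).target) :
    (fun y => φ ((φ.trans e).symm y)) =ᶠ[𝓝 x] e.symm := by
  filter_upwards [(φ.trans e).open_target.mem_nhds hx] with y hy
  exact φ.right_inv hy.2

/-- Around every point there is a chart in which `b = du` and in which the vector field dual to `b`
is `-∂_v` at the point. -/
theorem exists_chart_form_eq (hF : IsKropinaSpace m a b 𝒜) (hclosed : IsClosedForm b)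
    (hnull : IsNullForm a b) (p : M) :
    ∃ φ ∈ IsManifold.maximalAtlas (𝓡 (k + 2)) ∞ M, p ∈ φ.source ∧
      (∀ x ∈ φ.target, ∀ y, chartForm b φ x y = y 0) ∧
      dualVec a b φ (φ p) = -EuclideanSpace.single 1 1 := by
  have ha := hF.metric
  have hb := hF.form
  have hφ := IsManifold.chart_mem_maximalAtlas (I := 𝓡 (k + 2)) (n := ∞) p
  set φ := chartAt (Coord (k + 2)) p
  have hp : p ∈ φ.source := mem_chart_source _ p
  have hx₀ : φ p ∈ φ.target := φ.map_source hp
  set x₀ := φ p with hx₀_def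
  obtain ⟨z, hz⟩ := exists_chartForm_eq_one hF hφ hx₀
  have hB : chartForm b φ x₀ (dualVec a b φ x₀) = 0 := by
    rw [← normSq_eq]; exact hnull φ hφ x₀ hx₀
  have hB0 : dualVec a b φ x₀ ≠ 0 := by
    intro h0
    have := chartMetric_dualVec (b := b) ha hφ hx₀ z
    rw [h0, hz, map_zero] at this
    simp at this
  obtain ⟨C, hC, hCB⟩ := exists_equiv_standard hz hB hB0
  obtain ⟨R, hR, hRs⟩ := Metric.isOpen_iff.1 φ.open_target x₀ hx₀
  -- Poincaré lemma on a ball: the closed form has a primitive `u`.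
  obtain ⟨u, hu⟩ := (convex_ball x₀ R).exists_forall_hasFDerivAt_of_fderiv_symmetric
    Metric.isOpen_ball ((contDiffOn_chartForm hb hφ).differentiableOn (by simp) |>.mono hRs)
    (fun x hx y z => fderiv_chartForm_symm hb hclosed hφ (hRs hx) y z)
  have hu_smooth : ContDiffOn ℝ ∞ u (Metric.ball x₀ R) := by
    rw [contDiffOn_infty_iff_fderiv_of_isOpen Metric.isOpen_ball]
    exact ⟨fun x hx => (hu x hx).differentiableAt.differentiableWithinAt,
      ((contDiffOn_chartForm hb hφ).mono hRs).congr fun x hx => (hu x hx).fderiv⟩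
  let e₀ : Coord (k + 2) := EuclideanSpace.single 0 1
  let pr : Coord (k + 2) →L[ℝ] ℝ := EuclideanSpace.proj 0
  -- The linear coordinates `C` with the zeroth one replaced by `u`. Since `du` at `x₀` is the
  -- zeroth component of `C`, the derivative of `σ` there is still `C`.
  let σ : Coord (k + 2) → Coord (k + 2) := fun x => C x + (u x - pr (C x)) • e₀
  have hσ0 : ∀ x, σ x 0 = u x := fun x => by simp [σ, pr, e₀]
  have hσ : ContDiffOn ℝ ∞ σ (Metric.ball x₀ R) :=
    C.contDiff.contDiffOn.add ((hu_smooth.sub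
      (pr.contDiff.comp C.contDiff).contDiffOn).smul contDiffOn_const)
  have hσ' : HasFDerivAt σ (C : Coord (k + 2) →L[ℝ] Coord (k + 2)) x₀ := by
    have h1 := C.hasFDerivAt (x := x₀)
    have h := h1.add (((hu x₀ (Metric.mem_ball_self hR)).sub
      (pr.hasFDerivAt.comp x₀ h1)).smul_const e₀)
    refine h.congr_fderiv ?_
    ext1 y
    have h2 : pr (C y) = chartForm b φ x₀ y := hC y
    simp [h2]
  obtain ⟨e, hxe, heR, heσ, hes, hes'⟩ :=
    exists_smooth_localInverse Metric.isOpen_ball hσ (Metric.mem_ball_self hR) hσ'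
  have hψ := trans_mem_maximalAtlas hφ hes hes'
  have hpψ : p ∈ (φ.trans e).source := ⟨hp, hxe⟩
  refine ⟨φ.trans e, hψ, hpψ, fun x hx y => ?_, ?_⟩
  · have hxe : x ∈ e.target := hx.1
    have hex : e.symm x ∈ Metric.ball x₀ R := heR (e.map_target hxe)
    have hφx : (φ.trans e).symm x ∈ φ.source := φ.map_target hx.2
    have hτ := eventually_trans_symm hx
    rw [chartForm_transition b hψ hφ hx hφx, hτ.fderiv_eq, hτ.eq_of_nhds]
    have h1 : HasFDerivAt e.symm (fderiv ℝ e.symm x) x :=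
      ((hes'.contDiffAt (e.open_target.mem_nhds hxe)).differentiableAt (by simp)).hasFDerivAt
    have h2 := (hu _ hex).comp x h1
    have h3 : (u ∘ e.symm) =ᶠ[𝓝 x] pr := by
      filter_upwards [e.open_target.mem_nhds hxe] with x' hx'
      rw [Function.comp_apply, ← hσ0, ← heσ, e.right_inv hx']
      rfl
    have h4 := h2.unique (pr.hasFDerivAt.congr_of_eventuallyEq h3)
    exact congrArg (fun f : Coord (k + 2) →L[ℝ] ℝ => f y) h4
  · have hφp : φ.symm x₀ = p := φ.left_inv hp
    have hτ : (fun y => (φ.trans e) (φ.symm y)) =ᶠ[𝓝 x₀] σ := by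
      filter_upwards [φ.open_target.mem_nhds hx₀] with y hy
      change e (φ (φ.symm y)) = σ y
      rw [φ.right_inv hy, heσ]
    have h1 := fderiv_transition_dualVec (b := b) ha hφ hψ hx₀ (by rw [hφp]; exact hpψ)
    rw [hφp, hτ.fderiv_eq, hσ'.fderiv] at h1
    rw [← h1]
    exact hCB

/-- The flow of a vector field tangent to the levels of the first coordinate, which is `∂_v` at
`x₀`, gives coordinates in which the field is `∂_v`, without changing the first coordinate. -/
theorem exists_straightening {X : Coord (k + 2) → Coord (k + 2)} (hX : ContDiff ℝ ∞ X)
    (hc : HasCompactSupport X) (hX0 : ∀ x, X x 0 = 0) {x₀ : Coord (k + 2)}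
    (hx₀ : X x₀ = EuclideanSpace.single 1 1) {V : Set (Coord (k + 2))} (hV : V ∈ 𝓝 x₀) :
    ∃ (e : OpenPartialHomeomorph (Coord (k + 2)) (Coord (k + 2))) (ρ : ℝ), 0 < ρ ∧
      e.source = Metric.ball 0 ρ ∧ e 0 = x₀ ∧ (∀ y ∈ e.source, e y ∈ V) ∧
      ContDiffOn ℝ ∞ e e.source ∧ ContDiffOn ℝ ∞ e.symm e.target ∧
      ∀ y ∈ e.source, (∀ w, fderiv ℝ e y w 0 = w 0) ∧
        fderiv ℝ e y (EuclideanSpace.single 1 1) = X (e y) := by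
  obtain ⟨α, U, hU, hxU, hα, hαU⟩ := exists_smooth_local_flow hX hc x₀
  obtain ⟨r, hr, hrU⟩ := Metric.isOpen_iff.1 hU _ hxU
  have hprod : Metric.ball x₀ r ×ˢ Metric.ball (0 : ℝ) r ⊆ U := by
    rw [ball_prod_same]
    exact hrU
  let F : Coord (k + 2) × ℝ → Coord (k + 2) := fun q => α q.1 q.2
  let U' : Set (Coord (k + 2) × ℝ) := Metric.ball x₀ r ×ˢ Metric.ball (0 : ℝ) r
  have hU' : IsOpen U' := Metric.isOpen_ball.prod Metric.isOpen_ball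
  have hxU' : (x₀, (0 : ℝ)) ∈ U' := ⟨Metric.mem_ball_self hr, Metric.mem_ball_self hr⟩
  have hFd : ∀ q ∈ U', HasFDerivAt F (fderiv ℝ F q) q := fun q hq =>
    ((hα.contDiffAt (hU.mem_nhds (hprod hq))).differentiableAt (by simp)).hasFDerivAt
  have hFt : ∀ q ∈ U', fderiv ℝ F q (0, 1) = X (F q) := by
    intro q hq
    have h1 : HasDerivAt (fun t : ℝ => (q.1, t)) ((0 : Coord (k + 2)), (1 : ℝ)) q.2 :=
      (hasDerivAt_const q.2 q.1).prodMk (hasDerivAt_id q.2)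
    have hq' : HasFDerivAt F (fderiv ℝ F q) (q.1, q.2) := hFd q hq
    have h2 := hq'.comp_hasDerivAt q.2 h1
    exact h2.unique (hαU q (hprod hq)).2
  -- The field has no zeroth component, so that coordinate is constant along the flow.
  have hF0 : ∀ q ∈ U', F q 0 = q.1 0 := by
    intro q hq
    have h1 : ∀ t ∈ Metric.ball (0 : ℝ) r, HasDerivAt (fun t => α q.1 t 0) 0 t := by
      intro t ht
      have h2 := (hαU (q.1, t) (hprod ⟨hq.1, ht⟩)).2
      have h3 := ((EuclideanSpace.proj 0 : Coord (k + 2) →L[ℝ] ℝ).hasFDerivAt).comp_hasDerivAt t h2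
      have h4 : (EuclideanSpace.proj 0 : Coord (k + 2) →L[ℝ] ℝ) (X (α q.1 t)) = 0 := hX0 _
      rw [h4] at h3
      exact h3
    have h2 := Metric.isOpen_ball.is_const_of_deriv_eq_zero (convex_ball (0 : ℝ) r).isPreconnected
      (fun t ht => (h1 t ht).differentiableAt.differentiableWithinAt)
      (fun t ht => (h1 t ht).deriv) hq.2 (Metric.mem_ball_self hr)
    rw [(hαU (q.1, 0) (hprod ⟨hq.1, Metric.mem_ball_self hr⟩)).1] at h2
    exact h2
  have hFx : F (x₀, 0) = x₀ := (hαU _ hxU).1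
  have hFz : ∀ v, fderiv ℝ F (x₀, 0) (v, 0) = v := by
    intro v
    have h1 : HasFDerivAt (fun z : Coord (k + 2) => (z, (0 : ℝ)))
        ((ContinuousLinearMap.id ℝ (Coord (k + 2))).prod 0) x₀ :=
      (hasFDerivAt_id x₀).prodMk (hasFDerivAt_const 0 x₀)
    have h2 := (hFd _ hxU').comp x₀ h1
    have h3 : (F ∘ fun z : Coord (k + 2) => (z, (0 : ℝ))) =ᶠ[𝓝 x₀] id := by
      filter_upwards [Metric.ball_mem_nhds x₀ hr] with z hz
      exact (hαU (z, 0) (hprod ⟨hz, Metric.mem_ball_self hr⟩)).1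
    have h4 := h2.unique ((hasFDerivAt_id x₀).congr_of_eventuallyEq h3)
    have h5 := congrArg (fun f : Coord (k + 2) →L[ℝ] Coord (k + 2) => f v) h4
    simpa using h5
  let e₁ : Coord (k + 2) := EuclideanSpace.single 1 1
  let pr : Coord (k + 2) →L[ℝ] ℝ := EuclideanSpace.proj 1
  let Λ' : Coord (k + 2) →L[ℝ] Coord (k + 2) × ℝ :=
    (ContinuousLinearMap.id ℝ (Coord (k + 2)) - pr.smulRight e₁).prod pr
  -- The point `y` is sent to an initial point in the hyperplane through `x₀` transverse to `e₁`,
  -- and to the time `y 1`. Composed with the flow this maps `e₁` to `X`, and its derivative at `0`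
  -- is the identity because `X x₀ = e₁`.
  let Λ : Coord (k + 2) → Coord (k + 2) × ℝ := fun y => (x₀, 0) + Λ' y
  have hΛ : ∀ y, HasFDerivAt Λ Λ' y := fun y => Λ'.hasFDerivAt.const_add _
  have hΛs : ContDiff ℝ ∞ Λ := contDiff_const.add Λ'.contDiff
  have hΛ0 : Λ 0 = (x₀, 0) := by simp [Λ]
  have hΛe : Λ' e₁ = (0, 1) := by simp [Λ', pr, e₁]
  let Φ : Coord (k + 2) → Coord (k + 2) := fun y => F (Λ y)
  have hΦ0 : Φ 0 = x₀ := by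
    change F (Λ 0) = x₀
    rw [hΛ0, hFx]
  have hΦd : ∀ y ∈ Λ ⁻¹' U', HasFDerivAt Φ ((fderiv ℝ F (Λ y)).comp Λ') y := fun y hy =>
    (hFd _ hy).comp y (hΛ y)
  have hΦs : ContDiffOn ℝ ∞ Φ (Λ ⁻¹' U') :=
    (hα.mono hprod).comp hΛs.contDiffOn fun y hy => hy
  have hΦV : ∀ᶠ y in 𝓝 0, Φ y ∈ V := by
    have h1 := (hΦd 0 (by rw [mem_preimage, hΛ0]; exact hxU')).continuousAt
    exact h1.eventually_mem (by rw [hΦ0]; exact hV)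
  obtain ⟨s, hs, hsV, hs0⟩ := eventually_nhds_iff.1 hΦV
  have hD : HasFDerivAt Φ (ContinuousLinearEquiv.refl ℝ (Coord (k + 2)) :
      Coord (k + 2) →L[ℝ] Coord (k + 2)) 0 := by
    refine (hΦd 0 (by rw [mem_preimage, hΛ0]; exact hxU')).congr_fderiv ?_
    ext1 y
    have h1 : Λ' y = (y - y 1 • e₁, (0 : ℝ)) + y 1 • ((0 : Coord (k + 2)), (1 : ℝ)) := by
      simp [Λ', pr]
    rw [ContinuousLinearMap.comp_apply, h1, hΛ0, map_add, map_smul, hFz, hFt _ hxU', hFx, hx₀]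
    simp [e₁]
  obtain ⟨e, h0e, heU, heΦ, hes, hes'⟩ := exists_smooth_localInverse
    ((hU'.preimage hΛs.continuous).inter hsV) (hΦs.mono inter_subset_left)
    (a := 0) ⟨by rw [mem_preimage, hΛ0]; exact hxU', hs0⟩ hD
  obtain ⟨ρ, hρ, hρe⟩ := Metric.isOpen_iff.1 e.open_source 0 h0e
  -- The coordinates should range over a ball, which contains the segment from each of its points to
  -- the hyperplane `v = 0`.
  let e' := e.restrOpen (Metric.ball 0 ρ) Metric.isOpen_ball
  have hsrc : e'.source = Metric.ball 0 ρ := inter_eq_right.2 hρe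
  have hfun : (e' : Coord (k + 2) → Coord (k + 2)) = Φ := funext heΦ
  have hsub : e'.source ⊆ e.source := inter_subset_left
  refine ⟨e', ρ, hρ, hsrc, ?_, fun y hy => ?_, ?_, ?_, fun y hy => ⟨fun w => ?_, ?_⟩⟩
  · rw [hfun, hΦ0]
  · rw [hfun]
    exact hs y (heU (hsub hy)).2
  · rw [hfun]
    exact hΦs.mono fun y hy => (heU (hsub hy)).1
  · exact hes'.mono fun y hy => hy.1
  · have hy' : y ∈ Λ ⁻¹' U' := (heU (hsub hy)).1
    rw [hfun]
    let pr0 : Coord (k + 2) →L[ℝ] ℝ := EuclideanSpace.proj 0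
    have h1 := (pr0.hasFDerivAt (x := Φ y)).comp y (hΦd y hy')
    have h2 : (pr0 ∘ Φ) =ᶠ[𝓝 y] fun y => x₀ 0 + pr0 y := by
      filter_upwards [(hU'.preimage hΛs.continuous).mem_nhds hy'] with y' hy'
      refine (hF0 _ hy').trans ?_
      simp [Λ, Λ', e₁, pr0]
    have h3 := h1.unique ((pr0.hasFDerivAt.const_add (x₀ 0)).congr_of_eventuallyEq h2)
    rw [(hΦd y hy').fderiv]
    exact congrArg (fun f : Coord (k + 2) →L[ℝ] ℝ => f w) h3
  · have hy' : y ∈ Λ ⁻¹' U' := (heU (hsub hy)).1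
    rw [hfun, (hΦd y hy').fderiv, ContinuousLinearMap.comp_apply]
    rw [show Λ' (EuclideanSpace.single 1 1) = (0, 1) from hΛe, hFt _ hy']

/-- Start from coordinates with `b = du`. The field `-B` is tangent to the levels of `u`, as `du(B)
= b² = 0`, so straightening it to `∂_v` preserves `b = du`. -/
theorem exists_adaptedChart (hF : IsKropinaSpace m a b 𝒜) (hclosed : IsClosedForm b)
    (hnull : IsNullForm a b) (p : M) :
    ∃ (φ : OpenPartialHomeomorph M (Coord (k + 2))) (ρ : ℝ), p ∈ φ.source ∧
      φ.target = Metric.ball 0 ρ ∧ IsAdaptedChart a b φ := by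
  have ha := hF.metric
  have hb := hF.form
  obtain ⟨φ, hφ, hp, hform, hdual⟩ := exists_chart_form_eq hF hclosed hnull p
  have hx₀ : φ p ∈ φ.target := φ.map_source hp
  obtain ⟨X, hX, hXc, ⟨r, hr, hrs, hXr⟩, hX0⟩ := exists_smooth_cutoff φ.open_target
    (contDiffOn_dualVec (b := b) ha hb hφ).neg hx₀
  -- The cutoff only rescales `-B` or kills it, so tangency to the levels of `u` persists
  -- everywhere.
  have hXzero : ∀ x, X x 0 = 0 := by
    intro x
    rcases hX0 x with h | ⟨hx, c, h⟩
    · rw [h]; rfl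
    · have h1 : dualVec a b φ x 0 = 0 := by
        rw [← hform x hx, ← normSq_eq]
        exact hnull φ hφ x hx
      rw [h]
      simp [h1]
  have hXx : X (φ p) = EuclideanSpace.single 1 1 := by
    rw [hXr _ (Metric.mem_ball_self hr), hdual, neg_neg]
  obtain ⟨e, ρ, hρ, hsrc, he0, heV, hes, hes', hed⟩ :=
    exists_straightening hX hXc hXzero hXx (Metric.ball_mem_nhds (φ p) hr)
  have hψ := trans_mem_maximalAtlas hφ (e := e.symm) hes' (by simpa using hes)
  have htar : (φ.trans e.symm).target = Metric.ball 0 ρ := by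
    rw [← hsrc]
    ext y
    exact ⟨fun h => h.1, fun h => ⟨h, hrs (heV y h)⟩⟩
  have h0 : (0 : Coord (k + 2)) ∈ e.source := by
    rw [hsrc]
    exact Metric.mem_ball_self hρ
  refine ⟨φ.trans e.symm, ρ, ⟨hp, ?_⟩, htar, hψ, fun x hx y => ?_, fun x hx z => ?_⟩
  · change φ p ∈ e.target
    rw [← he0]
    exact e.map_source h0
  · have hφx : (φ.trans e.symm).symm x ∈ φ.source := φ.map_target hx.2
    have hτ := eventually_trans_symm hx
    rw [chartForm_transition b hψ hφ hx hφx, hτ.fderiv_eq, hτ.eq_of_nhds, hform _ hx.2]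
    exact (hed x hx.1).1 y
  · have hφx : (φ.trans e.symm).symm x ∈ φ.source := φ.map_target hx.2
    have hτ := eventually_trans_symm hx
    rw [chartMetric_transition a hψ hφ hx hφx, hτ.fderiv_eq, hτ.eq_of_nhds]
    have h1 : fderiv ℝ e x (EuclideanSpace.single 1 1) = -dualVec a b φ (e x) := by
      rw [(hed x hx.1).2, hXr _ (heV x hx.1)]
    have h2 : fderiv ℝ (e.symm.symm) x (EuclideanSpace.single 1 1) = -dualVec a b φ (e x) := h1
    rw [h2, map_neg, neg_apply]
    change -chartMetric a φ (e x) (dualVec a b φ (e x)) _ = _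
    have hex : e x ∈ φ.target := hx.2
    rw [chartMetric_dualVec ha hφ hex, hform _ hex]
    exact congrArg Neg.neg ((hed x hx.1).1 z)

end Charts

/-! ### From adapted charts to the normal form -/

section NormalForm

variable {k : ℕ}

/-- The point with coordinates `(u, 0, x³, …, xⁿ)`. -/
def basePoint (u : ℝ) (w : Fin k → ℝ) : Coord (k + 2) :=
  WithLp.toLp 2 (Fin.cons u (Fin.cons 0 w))

theorem basePoint_transverse (x : Coord (k + 2)) :
    basePoint (x 0) (transverse x) = x - x 1 • EuclideanSpace.single 1 1 := by
  ext i
  refine Fin.cases ?_ (fun i => Fin.cases ?_ (fun i => ?_) i) i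
  · simp [basePoint]
  · simp [basePoint]
  · simp [basePoint, transverse, Fin.ext_iff]

theorem norm_sub_smul_single_le {n : ℕ} (x : Coord n) (i : Fin n) {t : ℝ} (ht : t ∈ Icc (0 : ℝ) 1) :
    ‖x - (t * x i) • EuclideanSpace.single i (1 : ℝ)‖ ≤ ‖x‖ := by
  rw [EuclideanSpace.norm_eq, EuclideanSpace.norm_eq]
  refine Real.sqrt_le_sqrt (Finset.sum_le_sum fun j _ => ?_)
  rcases eq_or_ne j i with rfl | hj
  · have h1 : (x - (t * x j) • EuclideanSpace.single j (1 : ℝ)) j = (1 - t) * x j := by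
      simp
      ring
    rw [h1, norm_mul, mul_pow, Real.norm_eq_abs, sq_abs]
    have h2 : (1 - t) ^ 2 ≤ 1 := by nlinarith [ht.1, ht.2]
    exact mul_le_of_le_one_left (sq_nonneg _) h2
  · simp [hj]

variable {M : Type*} [TopologicalSpace M] [ChartedSpace (Coord (k + 2)) M]
  [IsManifold (𝓡 (k + 2)) ∞ M]
  {a : BilinField (k + 2) M} {b : CovectorField (k + 2) M}
  {φ : OpenPartialHomeomorph M (Coord (k + 2))} {x : Coord (k + 2)}

/-- Here `∂_v a = -2 ∇b` is a multiple of `du ⊗ du`, hence zero on pairs with `y 0 * z 0 = 0`. Such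
components are constant along the segment to `v = 0`, which stays in the ball. -/
theorem IsAdaptedChart.chartMetric_eq_basePoint (h : IsAdaptedChart a b φ)
    (ha : IsPseudoRiemannianMetric a) (hb : IsSmoothForm b) {ρ : ℝ}
    (hρ : φ.target = Metric.ball 0 ρ) (hH : ∀ x ∈ φ.target, HessIsMultiple a b φ x)
    (hx : x ∈ φ.target) {y z : Coord (k + 2)} (hyz : y 0 * z 0 = 0) :
    basePoint (x 0) (transverse x) ∈ φ.target ∧
      chartMetric a φ x y z = chartMetric a φ (basePoint (x 0) (transverse x)) y z := by
  let e : Coord (k + 2) := EuclideanSpace.single 1 1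
  have hmem : ∀ t ∈ Icc (0 : ℝ) 1, x - (t * x 1) • e ∈ φ.target := by
    intro t ht
    rw [hρ, mem_ball_zero_iff] at hx ⊢
    exact (norm_sub_smul_single_le x 1 ht).trans_lt hx
  have hd : ∀ t ∈ Icc (0 : ℝ) 1,
      HasDerivAt (fun t : ℝ => chartMetric a φ (x - (t * x 1) • e) y z) 0 t := by
    intro t ht
    have hl : HasDerivAt (fun t : ℝ => x - (t * x 1) • e) (-((1 * x 1) • e)) t :=
      (((hasDerivAt_id t).mul_const (x 1)).smul_const e).const_sub x
    have hg := differentiableAt_chartMetric ha h.mem_atlas (hmem t ht)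
    have h1 : HasFDerivAt (fun x => chartMetric a φ x y z) _ (x - (t * x 1) • e) :=
      (show DifferentiableAt ℝ (fun x => chartMetric a φ x y z) (x - (t * x 1) • e) by
        fun_prop).hasFDerivAt
    have h2 := h1.comp_hasDerivAt t hl
    rw [fderiv_apply_apply hg] at h2
    refine h2.congr_deriv ?_
    obtain ⟨μ, hμ⟩ := hH _ (hmem t ht)
    have h3 := hμ y z
    rw [h.chartHess_eq ha hb (hmem t ht), h.form_eq _ (hmem t ht), h.form_eq _ (hmem t ht),
      mul_assoc, hyz, mul_zero] at h3
    have h4 : fderiv ℝ (chartMetric a φ) (x - (t * x 1) • e) e y z = 0 := by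
      linarith
    simp [h4]
  have h1 := constant_of_has_deriv_right_zero
    (fun t ht => (hd t ht).continuousAt.continuousWithinAt)
    (fun t ht => (hd t ⟨ht.1, ht.2.le⟩).hasDerivWithinAt) 1 ⟨zero_le_one, le_rfl⟩
  simp only [one_mul, zero_mul, zero_smul, sub_zero] at h1
  rw [basePoint_transverse]
  exact ⟨by simpa using hmem 1 ⟨zero_le_one, le_rfl⟩, h1.symm⟩

theorem eq_single_add_sum_transverse (y : Coord (k + 2)) :
    y = y 0 • EuclideanSpace.single 0 1 + y 1 • EuclideanSpace.single 1 1 +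
      ∑ i, transverse y i • EuclideanSpace.single (Fin.succ (Fin.succ i)) (1 : ℝ) := by
  conv_lhs => rw [← sum_smul_single y, Fin.sum_univ_succ, Fin.sum_univ_succ, ← add_assoc]
  rfl

theorem IsAdaptedChart.chartMetric_eq (h : IsAdaptedChart a b φ)
    (ha : IsPseudoRiemannianMetric a) (hx : x ∈ φ.target) (y z : Coord (k + 2)) :
    chartMetric a φ x y z = -(y 0 * z 1 + y 1 * z 0)
      + metricComp a φ 0 0 x * (y 0 * z 0)
      + (∑ i : Fin k, 2 * metricComp a φ 0 i.succ.succ x *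
          (1 / 2 * (y 0 * transverse z i + transverse y i * z 0)))
      + ∑ i : Fin k, ∑ j : Fin k, metricComp a φ i.succ.succ j.succ.succ x *
          (transverse y i * transverse z j) := by
  have h1 := h.metric_eq x hx
  have h2 : ∀ z, chartMetric a φ x z (EuclideanSpace.single 1 1) = -z 0 := fun z => by
    rw [chartMetric_symm ha, h1]
  have h3 : ∀ i : Fin k, chartMetric a φ x (EuclideanSpace.single i.succ.succ 1)
      (EuclideanSpace.single 0 1) = metricComp a φ 0 i.succ.succ x := fun i => by
    rw [chartMetric_symm ha, metricComp_eq]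
  conv_lhs => rw [eq_single_add_sum_transverse y, eq_single_add_sum_transverse z]
  simp only [map_add, map_sum, map_smul, add_apply, sum_apply, smul_apply, smul_eq_mul, h1, h2, h3,
    ← metricComp_eq]
  simp only [PiLp.single_apply, Fin.ext_iff, Fin.val_succ, Fin.val_zero, Fin.val_one]
  simp only [Finset.mul_sum, mul_add, Finset.sum_add_distrib]
  simp
  have e1 : ∑ i : Fin k, z 0 * (transverse y i * metricComp a φ 0 i.succ.succ x) =
      ∑ i : Fin k, 2 * metricComp a φ 0 i.succ.succ x * (2⁻¹ * (transverse y i * z 0)) :=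
    Finset.sum_congr rfl fun i _ => by ring
  have e2 : ∑ i : Fin k, transverse z i * (y 0 * metricComp a φ 0 i.succ.succ x) =
      ∑ i : Fin k, 2 * metricComp a φ 0 i.succ.succ x * (2⁻¹ * (y 0 * transverse z i)) :=
    Finset.sum_congr rfl fun i _ => by ring
  have e3 : ∑ j : Fin k, ∑ i : Fin k, transverse z j *
      (transverse y i * metricComp a φ i.succ.succ j.succ.succ x) =
      ∑ i : Fin k, ∑ j : Fin k, metricComp a φ i.succ.succ j.succ.succ x *
        (transverse y i * transverse z j) := by
    rw [Finset.sum_comm]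
    exact Finset.sum_congr rfl fun i _ => Finset.sum_congr rfl fun j _ => by ring
  rw [e1, e2, e3]
  ring

/-- All components of the metric with a transverse index are independent of `v`, so `W` and `h` may
be defined by their values at `v = 0`. The factor 2 in `W` compensates the symmetrized product. -/
theorem IsAdaptedChart.exists_hasNormalForm (h : IsAdaptedChart a b φ)
    (ha : IsPseudoRiemannianMetric a) (hb : IsSmoothForm b) {ρ : ℝ}
    (hρ : φ.target = Metric.ball 0 ρ) (hH : ∀ x ∈ φ.target, HessIsMultiple a b φ x) :
    ∃ (H : Coord (k + 2) → ℝ) (W : Fin k → ℝ → (Fin k → ℝ) → ℝ)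
      (h : ℝ → (Fin k → ℝ) → Matrix (Fin k) (Fin k) ℝ), HasNormalForm a b φ H W h := by
  have hbase : ∀ i : Fin (k + 2), ∀ j : Fin k, ∀ x ∈ φ.target,
      metricComp a φ i j.succ.succ (basePoint (x 0) (transverse x)) =
        metricComp a φ i j.succ.succ x := fun i j x hx =>
    (h.chartMetric_eq_basePoint ha hb hρ hH hx (by simp)).2.symm
  refine ⟨metricComp a φ 0 0, fun i u w => 2 * metricComp a φ 0 i.succ.succ (basePoint u w),
    fun u w => Matrix.of fun i j => metricComp a φ i.succ.succ j.succ.succ (basePoint u w),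
    h.mem_atlas, ha.smooth φ h.mem_atlas 0 0, fun i => ?_, fun i j => ?_, fun x hx => ?_,
    fun x hx => ?_, fun x hx y z => ?_, fun x hx y => h.form_eq x hx y⟩
  · exact (contDiffOn_const.mul (ha.smooth φ h.mem_atlas _ _)).congr
      fun x hx => by rw [hbase 0 i x hx]
  · exact (ha.smooth φ h.mem_atlas _ _).congr fun x hx => hbase i.succ.succ j x hx
  · ext i j
    exact ha.symm _ _ _
  · intro h0
    obtain ⟨w, hw, hw0⟩ := Matrix.exists_mulVec_eq_zero_iff.2 h0
    -- A kernel vector `w` of `h` is completed to a vector orthogonal to everything: with `y 0 = 0`,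
    -- the `v`-component is chosen so that `-y 1 * z 0` cancels the mixed terms.
    let y : Coord (k + 2) := WithLp.toLp 2
      (Fin.cons 0 (Fin.cons (∑ i, metricComp a φ 0 i.succ.succ x * w i) w))
    have hy0 : y 0 = 0 := rfl
    have hy1 : y 1 = ∑ i, metricComp a φ 0 i.succ.succ x * w i := rfl
    have hyw : transverse y = w := rfl
    have hy : y = 0 := by
      refine chartMetric_nondegenerate ha h.mem_atlas hx fun z => ?_
      have h3 : ∑ i : Fin k, ∑ j : Fin k, metricComp a φ i.succ.succ j.succ.succ x *
          (w i * transverse z j) = 0 := by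
        rw [Finset.sum_comm]
        refine Finset.sum_eq_zero fun j _ => ?_
        have h4 := congrFun hw0 j
        simp only [Matrix.mulVec, dotProduct, Matrix.of_apply, hbase _ _ x hx,
          Pi.zero_apply] at h4
        calc ∑ i : Fin k, metricComp a φ i.succ.succ j.succ.succ x * (w i * transverse z j)
            = (∑ i : Fin k, metricComp a φ j.succ.succ i.succ.succ x * w i) * transverse z j := by
              rw [Finset.sum_mul]
              refine Finset.sum_congr rfl fun i _ => ?_
              rw [metricComp_eq, chartMetric_symm ha, ← metricComp_eq]
              ring
          _ = 0 := by rw [h4, zero_mul]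
      rw [h.chartMetric_eq ha hx, hyw, hy0, hy1, h3]
      have h5 : ∑ i : Fin k, 2 * metricComp a φ 0 i.succ.succ x *
          (1 / 2 * (0 * transverse z i + w i * z 0)) =
          (∑ i, metricComp a φ 0 i.succ.succ x * w i) * z 0 := by
        rw [Finset.sum_mul]
        exact Finset.sum_congr rfl fun i _ => by ring
      rw [h5]
      ring
    exact hw (by rw [← hyw, hy]; rfl)
  · rw [← chartMetric_apply, h.chartMetric_eq ha hx]
    simp only [Matrix.of_apply, hbase _ _ x hx]

end NormalForm

/-! ### The equivalence and the formula for `c` -/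

section NormalForm

variable {k : ℕ} {M : Type*} [TopologicalSpace M] [ChartedSpace (Coord (k + 2)) M]
  [IsManifold (𝓡 (k + 2)) ∞ M]
  {m : ℝ} {a : BilinField (k + 2) M} {b : CovectorField (k + 2) M}
  {𝒜 : Set (TangentBundle (𝓡 (k + 2)) M)}
  {φ ψ : OpenPartialHomeomorph M (Coord (k + 2))} {x : Coord (k + 2)}
  {H : Coord (k + 2) → ℝ} {W : Fin k → ℝ → (Fin k → ℝ) → ℝ}
  {h : ℝ → (Fin k → ℝ) → Matrix (Fin k) (Fin k) ℝ}

theorem HasNormalForm.hessIsMultiple (hn : HasNormalForm a b ψ H W h)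
    (ha : IsPseudoRiemannianMetric a) (hb : IsSmoothForm b)
    (hφ : φ ∈ IsManifold.maximalAtlas (𝓡 (k + 2)) ∞ M) (hx : x ∈ φ.target)
    (hx' : φ.symm x ∈ ψ.source) : HessIsMultiple a b φ x := by
  have hψx := ψ.map_source hx'
  refine ⟨-(1 / 2) * pd 1 H (ψ (φ.symm x)), fun y z => ?_⟩
  rw [chartHess_transition ha hb hφ hn.mem_atlas hx hx', hn.chartHess_eq ha hb hψx,
    chartForm_transition b hφ hn.mem_atlas hx hx', chartForm_transition b hφ hn.mem_atlas hx hx',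
    hn.isAdaptedChart.form_eq _ hψx, hn.isAdaptedChart.form_eq _ hψx]

/-- Comparison of the `du²` components: `-(1/2) ∂_v H = c (1 - m)`, since `b_0 = 1` and `b² = 0`. -/
theorem HasNormalForm.berwaldFactor_eq (hn : HasNormalForm a b φ H W h)
    (hF : IsKropinaSpace m a b 𝒜) (hnull : IsNullForm a b) {c : M → ℝ}
    (hc : BerwaldCondition m a b c) (hx : x ∈ φ.target) :
    c (φ.symm x) = -(pd 1 H x) / (2 * (1 - m)) := by
  have hm := one_sub_ne_zero hF hnull hn.mem_atlas hx
  have h1 := hc φ hn.mem_atlas x hx 0 0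
  have h2 : formComp b φ 0 x = 1 := by
    rw [formComp_eq, hn.isAdaptedChart.form_eq x hx]
    simp
  rw [covDeriv_eq hF.metric hF.form hn.mem_atlas hx, hn.chartHess_eq hF.metric hF.form hx,
    hnull φ hn.mem_atlas x hx, h2] at h1
  simp only [PiLp.single_apply, if_true] at h1
  rw [eq_div_iff (mul_ne_zero two_ne_zero hm)]
  linarith

theorem isBerwald_iff_exists_hasNormalForm (hk : 2 < k + 2) (hm : m ≠ 0)
    (hF : IsKropinaSpace m a b 𝒜) (hclosed : IsClosedForm b) (hnull : IsNullForm a b) :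
    IsBerwald 𝒜 (kropina m a b) ↔
      ∀ p : M, ∃ (φ : OpenPartialHomeomorph M (Coord (k + 2)))
        (H : Coord (k + 2) → ℝ) (W : Fin k → ℝ → (Fin k → ℝ) → ℝ)
        (h : ℝ → (Fin k → ℝ) → Matrix (Fin k) (Fin k) ℝ),
        p ∈ φ.source ∧ HasNormalForm a b φ H W h := by
  refine ⟨fun hB p => ?_, fun hN => ?_⟩
  · obtain ⟨φ, ρ, hp, hρ, hφ⟩ := exists_adaptedChart hF hclosed hnull p
    obtain ⟨H, W, h, hn⟩ := hφ.exists_hasNormalForm hF.metric hF.form hρ fun x hx =>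
      hessIsMultiple_of_isBerwald hk hm hF hclosed hnull hB hφ.mem_atlas hx
    exact ⟨φ, H, W, h, hp, hn⟩
  · refine isBerwald_of_hessIsMultiple hF hclosed hnull fun φ hφ x hx => ?_
    obtain ⟨ψ, H, W, h, hp, hn⟩ := hN (φ.symm x)
    exact hn.hessIsMultiple hF.metric hF.form hφ hx hp

end NormalForm
end MKropina

theorem mainTheorem2 {k : ℕ} (hk : 2 < k + 2) {M : Type*} [TopologicalSpace M]
    [ChartedSpace (MKropina.Coord (k + 2)) M] [IsManifold (𝓡 (k + 2)) ∞ M]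
    (m : ℝ) (hm : m ≠ 0)
    (a : MKropina.BilinField (k + 2) M) (b : MKropina.CovectorField (k + 2) M)
    (𝒜 : Set (TangentBundle (𝓡 (k + 2)) M))
    (hF : MKropina.IsKropinaSpace m a b 𝒜)
    (hclosed : MKropina.IsClosedForm b) (hnull : MKropina.IsNullForm a b) :
    (MKropina.IsBerwald 𝒜 (MKropina.kropina m a b) ↔
      ∀ p : M, ∃ (φ : OpenPartialHomeomorph M (MKropina.Coord (k + 2)))
        (H : MKropina.Coord (k + 2) → ℝ) (W : Fin k → ℝ → (Fin k → ℝ) → ℝ)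
        (h : ℝ → (Fin k → ℝ) → Matrix (Fin k) (Fin k) ℝ),
        p ∈ φ.source ∧ MKropina.HasNormalForm a b φ H W h) ∧
    (MKropina.IsBerwald 𝒜 (MKropina.kropina m a b) →
      ∃ c : M → ℝ, ContMDiff (𝓡 (k + 2)) 𝓘(ℝ, ℝ) ∞ c ∧
        MKropina.BerwaldCondition m a b c ∧
        (∀ c' : M → ℝ, MKropina.BerwaldCondition m a b c' → c' = c) ∧
        ∀ (φ : OpenPartialHomeomorph M (MKropina.Coord (k + 2)))
          (H : MKropina.Coord (k + 2) → ℝ) (W : Fin k → ℝ → (Fin k → ℝ) → ℝ)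
          (h : ℝ → (Fin k → ℝ) → Matrix (Fin k) (Fin k) ℝ),
          MKropina.HasNormalForm a b φ H W h →
          ∀ x ∈ φ.target, c (φ.symm x) = -(MKropina.pd 1 H x) / (2 * (1 - m))) := by
  refine ⟨MKropina.isBerwald_iff_exists_hasNormalForm hk hm hF hclosed hnull, fun hB => ?_⟩
  obtain ⟨c, hc, hcond⟩ := MKropina.exists_berwaldCondition hF hnull fun φ hφ x hx =>
    MKropina.hessIsMultiple_of_isBerwald hk hm hF hclosed hnull hB hφ hx
  exact ⟨c, hc, hcond, fun c' hc' => hcond.unique hF hnull hc',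
    fun φ H W h hn x hx => hn.berwaldFactor_eq hF hnull hcond hx⟩
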